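/- Let $A=\{0,1,\#\}$. A right ideal of the free monoid $A^*$ is essential if it meets every non-empty right ideal. A right-ideal isomorphism is a bijection $\varphi:R_1\to R_2$ between right ideals with $\varphi(xz)=\varphi(x)z$ for all $x\in R_1$, $z\in A^*$; it is maximal if it has no strict extension to a right-ideal isomorphism. Every isomorphism $\varphi$ between essential right ideals has a unique maximum extension $\max\varphi$. Let $\mathcal G_{3,1}$ be the group of all maximal isomorphisms between essential right ideals of $A^*$, with product $\varphi\cdot\psi=\max(\varphi\circ\psi)$ ($\psi$ is applied first), and let $G_{3,1}\subseteq\mathcal G_{3,1}$ consist of the maximal isomorphisms between finitely generated essential right ideals. For $i=0,1,2,3$ let $\kappa_i\in\mathcal G_{3,1}$ be the element given by the following map on words $u\#w$ with $u\in\{0,1\}^*$, $w\in A^*$: it leaves $\#w$ unchanged, keeps the first $i$ bits of $u$ fixed, replaces each of the consecutive complete triples of bits $abc$ that follow by $cab$, and keeps fixed the at most two remaining bits in front of $\#$ (if $|u|<i+3$, then $u$ is unchanged). Let $\kappa_{321}=\kappa_3\kappa_2\kappa_1$. Let $G^{\mathrm{mod}\,3}_{3,1}(0,1)$ be the set of all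 $\varphi\in G_{3,1}$ such that $\varphi$ and $\varphi^{-1}$ map $\{0,1\}^*$ into $\{0,1\}^*$ (where they are defined) and $|\varphi(x)|\equiv|x| \pmod 3$ for all $x\in\{0,1\}^*$ for which $\varphi(x)$ is defined. Let $G^{\mathrm{mod}\,3}_{3,1}(0,1;\#)$ be the set of those $\varphi\in G^{\mathrm{mod}\,3}_{3,1}(0,1)$ for which $\varphi$ and $\varphi^{-1}$ are defined on all of $\{0,1\}^*\#$ and map it into $\{0,1\}^*\#$. Consider the subgroups of $\mathcal G_{3,1}$ $$K=\langle G_{3,1}\cup\{\kappa_0,\kappa_1,\kappa_2\}\rangle,\qquad H(0,1)=\langle G^{\mathrm{mod}\,3}_{3,1}(0,1)\cup\{\kappa_{321}\}\rangle,$$ $$H(0,1;\#)=\langle G^{\mathrm{mod}\,3}_{3,1}(0,1;\#)\cup\{\kappa_{321}\}\rangle,\qquad \langle G_{3,1}\cup\{\kappa_{321}\}\rangle .$$ **Theorem.** The group $K$ is finitely generated, and its word problem is in coNP. The groups $H(0,1)$, $H(0,1;\#)$ and $\langle G_{3,1}\cup\{\kappa_{321}\}\rangle$ are finitely generated subgroups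 of $K$, and their word problems are in coNP. Here "the word problem of a finitely generated group is in coNP" means that, for every finite generating family, the set of words over the generators and their inverses that represent the identity is in coNP. Moreover, for every finite family $S$ of elements of $K$ there is a constant $c$ such that for every word $w$ over $S^{\pm1}$ that does not represent the identity there is a string $x\in A^*$ with $|x|\le c\,|w|$ such that applying the letters of $w$ to $x$ one after the other (from right to left) is defined and gives a string $w(x)\ne x$; this string is also the value at $x$ of the element of $\mathcal G_{3,1}$ represented by $w$. -/

import Mathlib

open Turing Computability

noncomputable section

namespace Thompson

/-! ### Right ideals of the free monoid and their isomorphisms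

Words over an alphabet `A` are lists, concatenation is `++`, and partial injective maps between
words are Mathlib's `PEquiv`s, ordered by extension (`φ ≤ ψ` means that `ψ` extends `φ`). -/

/-- A right ideal of the free monoid `A*`. -/
def IsRightIdeal {A : Type} (R : Set (List A)) : Prop :=
  ∀ x ∈ R, ∀ z : List A, x ++ z ∈ R

/-- A right ideal is essential if it meets every (non-empty) right ideal. -/
def IsEssential {A : Type} (R : Set (List A)) : Prop :=
  ∀ J : Set (List A), IsRightIdeal J → J.Nonempty → (R ∩ J).Nonempty

/-- The right ideal `R` is generated by a finite set: `R = Γ A*`. -/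
def IsFinGenIdeal {A : Type} (R : Set (List A)) : Prop :=
  ∃ Γ : Finset (List A), R = {x | ∃ g ∈ Γ, ∃ z : List A, x = g ++ z}

/-- The domain of a partial injective map. -/
def dom {A : Type} (φ : List A ≃. List A) : Set (List A) := {x | ∃ y, y ∈ φ x}

/-- The image of a partial injective map. -/
def im {A : Type} (φ : List A ≃. List A) : Set (List A) := {y | ∃ x, y ∈ φ x}

/-- `φ` is an isomorphism between right ideals: `φ (x z) = φ(x) z` for `x` in the domain.
(This makes the domain and the image right ideals.) -/
def IsRightIdealIso {A : Type} (φ : List A ≃. List A) : Prop :=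
  ∀ x y z : List A, y ∈ φ x → y ++ z ∈ φ (x ++ z)

/-- `φ` is an isomorphism between essential right ideals. -/
structure IsEssentialIso {A : Type} (φ : List A ≃. List A) : Prop where
  iso : IsRightIdealIso φ
  dom_essential : IsEssential (dom φ)
  im_essential : IsEssential (im φ)

/-- `φ` has no strict extension to an isomorphism between right ideals. -/
def IsMaximalIso {A : Type} (φ : List A ≃. List A) : Prop :=
  ∀ ψ : List A ≃. List A, IsRightIdealIso ψ → φ ≤ ψ → ψ = φ

theorem IsRightIdealIso.dom {A : Type} {φ : List A ≃. List A} (h : IsRightIdealIso φ) :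
    IsRightIdeal (dom φ) := fun _ ⟨y, hy⟩ z => ⟨y ++ z, h _ _ z hy⟩

theorem IsRightIdealIso.im {A : Type} {φ : List A ≃. List A} (h : IsRightIdealIso φ) :
    IsRightIdeal (im φ) := fun _ ⟨x, hx⟩ z => ⟨x ++ z, h _ _ z hx⟩

theorem IsRightIdealIso.symm {A : Type} {φ : List A ≃. List A} (h : IsRightIdealIso φ) :
    IsRightIdealIso φ.symm := by
  intro x y z hy
  rw [PEquiv.mem_iff_mem] at hy ⊢
  exact h _ _ _ hy

theorem IsRightIdealIso.trans {A : Type} {φ ψ : List A ≃. List A} (h : IsRightIdealIso φ)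
    (h' : IsRightIdealIso ψ) : IsRightIdealIso (φ.trans ψ) := by
  intro x y z hy
  rw [PEquiv.mem_trans] at hy ⊢
  obtain ⟨b, hb, hy⟩ := hy
  exact ⟨b ++ z, h _ _ _ hb, h' _ _ _ hy⟩

theorem isEssential_iff {A : Type} {R : Set (List A)} :
    IsEssential R ↔ ∀ x : List A, ∃ z, x ++ z ∈ R := by
  constructor
  · intro h x
    obtain ⟨_, hy, z, rfl⟩ := h {y | ∃ z, y = x ++ z}
      (by rintro _ ⟨z, rfl⟩ z'; exact ⟨z ++ z', by simp⟩) ⟨x, [], by simp⟩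
    exact ⟨z, hy⟩
  · rintro h J hJ ⟨x, hx⟩
    obtain ⟨z, hz⟩ := h x
    exact ⟨x ++ z, hz, hJ x hx z⟩

theorem IsEssential.mono {A : Type} {R S : Set (List A)} (h : IsEssential R) (hRS : R ⊆ S) :
    IsEssential S := fun J hJ hne => (h J hJ hne).mono (Set.inter_subset_inter_left _ hRS)

theorem dom_mono {A : Type} {φ ψ : List A ≃. List A} (h : φ ≤ ψ) : dom φ ⊆ dom ψ :=
  fun _ ⟨y, hy⟩ => ⟨y, h _ _ hy⟩

theorem im_mono {A : Type} {φ ψ : List A ≃. List A} (h : φ ≤ ψ) : im φ ⊆ im ψ :=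
  fun _ ⟨x, hx⟩ => ⟨x, h _ _ hx⟩

theorem dom_symm {A : Type} (φ : List A ≃. List A) : dom φ.symm = im φ := by
  ext x; exact exists_congr fun y => PEquiv.mem_iff_mem φ

theorem im_symm {A : Type} (φ : List A ≃. List A) : im φ.symm = dom φ := by
  ext x; exact exists_congr fun y => PEquiv.mem_iff_mem φ

theorem IsEssentialIso.symm {A : Type} {φ : List A ≃. List A} (h : IsEssentialIso φ) :
    IsEssentialIso φ.symm :=
  ⟨h.iso.symm, by rw [dom_symm]; exact h.im_essential, by rw [im_symm]; exact h.dom_essential⟩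

theorem trans_dom_essential {A : Type} {φ ψ : List A ≃. List A} (h : IsEssentialIso φ)
    (h' : IsEssentialIso ψ) : IsEssential (dom (φ.trans ψ)) := by
  rw [isEssential_iff]
  intro x
  obtain ⟨z, y, hy⟩ := isEssential_iff.1 h.dom_essential x
  obtain ⟨u, w, hw⟩ := isEssential_iff.1 h'.dom_essential y
  refine ⟨z ++ u, w, ?_⟩
  rw [PEquiv.mem_trans]
  exact ⟨y ++ u, by rw [← List.append_assoc]; exact h.iso _ _ _ hy, hw⟩

theorem IsEssentialIso.trans {A : Type} {φ ψ : List A ≃. List A} (h : IsEssentialIso φ)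
    (h' : IsEssentialIso ψ) : IsEssentialIso (φ.trans ψ) := by
  refine ⟨h.iso.trans h'.iso, trans_dom_essential h h', ?_⟩
  rw [← dom_symm, PEquiv.symm_trans_rev]
  exact trans_dom_essential h'.symm h.symm

theorem isEssentialIso_refl {A : Type} : IsEssentialIso (PEquiv.refl (List A)) := by
  refine ⟨?_, ?_, ?_⟩
  · intro x y z hy
    simp at hy ⊢
    simp [hy]
  · exact isEssential_iff.2 fun x => ⟨[], _, rfl⟩
  · exact isEssential_iff.2 fun x => ⟨[], _, rfl⟩

/-! ### The maximum extension -/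

/-- `x` can be sent to `y` by an extension of `φ`: we have `φ (x z) = y z` whenever `φ (x z)` is
defined. -/
def Extends {A : Type} (φ : List A ≃. List A) (x y : List A) : Prop :=
  ∀ z w : List A, w ∈ φ (x ++ z) → w = y ++ z

theorem Extends.unique {A : Type} {φ : List A ≃. List A} (h : IsEssentialIso φ)
    {x y y' : List A} (hy : Extends φ x y) (hy' : Extends φ x y') : y = y' := by
  obtain ⟨z, w, hw⟩ := isEssential_iff.1 h.dom_essential x
  exact List.append_cancel_right ((hy z w hw).symm.trans (hy' z w hw))

theorem Extends.symm {A : Type} {φ : List A ≃. List A} (h : IsEssentialIso φ)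
    {x y : List A} (hy : Extends φ x y) : Extends φ.symm y x := by
  intro u v hv
  rw [PEquiv.mem_iff_mem] at hv
  obtain ⟨z, w, hw⟩ := isEssential_iff.1 h.dom_essential (x ++ u)
  have h1 : w = y ++ (u ++ z) := hy (u ++ z) w (by rw [← List.append_assoc]; exact hw)
  have h2 := h.iso _ _ z hv
  rw [List.append_assoc, ← h1] at h2
  exact List.append_cancel_right (PEquiv.inj _ h2 hw)

theorem extends_symm_iff {A : Type} {φ : List A ≃. List A} (h : IsEssentialIso φ)
    {x y : List A} : Extends φ.symm y x ↔ Extends φ x y :=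
  ⟨fun hx => hx.symm h.symm, fun hy => hy.symm h⟩

open Classical in
/-- The maximum extension `max φ` of an isomorphism `φ` between essential right ideals. -/
def maxExt {A : Type} (φ : List A ≃. List A) (h : IsEssentialIso φ) : List A ≃. List A where
  toFun x := if hx : ∃ y, Extends φ x y then some hx.choose else none
  invFun y := if hy : ∃ x, Extends φ x y then some hy.choose else none
  inv x y := by
    constructor
    · intro hx
      split_ifs at hx with hy
      have h1 := hy.choose_spec
      rw [Option.some_inj.1 hx] at h1
      have hex : ∃ y, Extends φ x y := ⟨y, h1⟩
      rw [dif_pos hex, hex.choose_spec.unique h h1]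
    · intro hy
      split_ifs at hy with hx
      have h1 := hx.choose_spec
      rw [Option.some_inj.1 hy] at h1
      have hex : ∃ x, Extends φ x y := ⟨x, h1⟩
      rw [dif_pos hex, (hex.choose_spec.symm h).unique h.symm (h1.symm h)]

theorem mem_maxExt {A : Type} {φ : List A ≃. List A} (h : IsEssentialIso φ) {x y : List A} :
    y ∈ maxExt φ h x ↔ Extends φ x y := by
  classical
  change (if hx : ∃ y, Extends φ x y then some hx.choose else none) = some y ↔ _
  constructor
  · intro hy
    split_ifs at hy with hx
    rw [← Option.some_inj.1 hy]
    exact hx.choose_spec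
  · intro hy
    have hex : ∃ y, Extends φ x y := ⟨y, hy⟩
    rw [dif_pos hex, hex.choose_spec.unique h hy]

/-- `max φ` is larger than every right-ideal isomorphism that extends `φ`. -/
theorem le_maxExt_of_le {A : Type} {φ ψ : List A ≃. List A} (h : IsEssentialIso φ)
    (hψ : IsRightIdealIso ψ) (hle : φ ≤ ψ) : ψ ≤ maxExt φ h := by
  intro x y hy
  rw [mem_maxExt]
  intro z w hw
  exact Option.mem_unique (hle _ _ hw) (hψ _ _ z hy)

theorem le_maxExt {A : Type} {φ : List A ≃. List A} (h : IsEssentialIso φ) : φ ≤ maxExt φ h :=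
  le_maxExt_of_le h h.iso le_rfl

theorem isEssentialIso_maxExt {A : Type} {φ : List A ≃. List A} (h : IsEssentialIso φ) :
    IsEssentialIso (maxExt φ h) := by
  refine ⟨?_, h.dom_essential.mono (dom_mono (le_maxExt h)),
    h.im_essential.mono (im_mono (le_maxExt h))⟩
  intro x y z hy
  rw [mem_maxExt] at hy ⊢
  intro u w hw
  rw [List.append_assoc] at hw ⊢
  exact hy _ _ hw

theorem isMaximalIso_maxExt {A : Type} {φ : List A ≃. List A} (h : IsEssentialIso φ) :
    IsMaximalIso (maxExt φ h) := fun _ hψ hle =>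
  le_antisymm (le_maxExt_of_le h hψ ((le_maxExt h).trans hle)) hle

theorem maxExt_eq_of_le {A : Type} {φ ψ : List A ≃. List A} (h : IsEssentialIso φ)
    (hψ : IsEssentialIso ψ) (hle : φ ≤ ψ) : maxExt φ h = maxExt ψ hψ :=
  isMaximalIso_maxExt hψ _ (isEssentialIso_maxExt h).iso
    (le_maxExt_of_le h (isEssentialIso_maxExt hψ).iso (hle.trans (le_maxExt hψ)))

theorem maxExt_eq_self {A : Type} {φ : List A ≃. List A} (h : IsEssentialIso φ)
    (hm : IsMaximalIso φ) : maxExt φ h = φ :=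
  hm _ (isEssentialIso_maxExt h).iso (le_maxExt h)

theorem trans_mono {A : Type} {φ φ' ψ ψ' : List A ≃. List A} (h : φ ≤ φ') (h' : ψ ≤ ψ') :
    φ.trans ψ ≤ φ'.trans ψ' := by
  intro x y hy
  rw [PEquiv.mem_trans] at hy ⊢
  obtain ⟨b, hb, hy⟩ := hy
  exact ⟨b, h _ _ hb, h' _ _ hy⟩

/-! ### The groups `𝒢_{N,1}` and `G_{N,1}` -/

/-- The Thompson-Higman group `𝒢_{N,1}`, `N = |A|`: all maximal isomorphisms between essential
right ideals of `A*`. -/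
def BigGroup (A : Type) : Type :=
  {φ : List A ≃. List A // IsEssentialIso φ ∧ IsMaximalIso φ}

/-- The underlying partial map of an element of `𝒢_{N,1}`. -/
def BigGroup.toMap {A : Type} (g : BigGroup A) : List A ≃. List A := g.1

/-- The element `max φ` of `𝒢_{N,1}`. -/
def BigGroup.ofIso {A : Type} (φ : List A ≃. List A) (h : IsEssentialIso φ) : BigGroup A :=
  ⟨maxExt φ h, isEssentialIso_maxExt h, isMaximalIso_maxExt h⟩

theorem isMaximalIso_refl {A : Type} : IsMaximalIso (PEquiv.refl (List A)) := by
  intro ψ _ hle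
  ext1 x
  exact hle x x rfl

theorem IsMaximalIso.symm {A : Type} {φ : List A ≃. List A} (h : IsMaximalIso φ) :
    IsMaximalIso φ.symm := by
  intro ψ hψ hle
  rw [← h ψ.symm hψ.symm, PEquiv.symm_symm]
  intro x y hy
  rw [PEquiv.mem_iff_mem]
  exact hle _ _ (by rwa [PEquiv.mem_iff_mem])

theorem ofIso_eq_of_le {A : Type} {φ ψ : List A ≃. List A} (h : IsEssentialIso φ)
    (hψ : IsEssentialIso ψ) (hle : φ ≤ ψ) : BigGroup.ofIso φ h = BigGroup.ofIso ψ hψ :=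
  Subtype.ext (maxExt_eq_of_le h hψ hle)

theorem ofIso_toMap {A : Type} (g : BigGroup A) : BigGroup.ofIso g.1 g.2.1 = g :=
  Subtype.ext (maxExt_eq_self g.2.1 g.2.2)

/-- The product `g * h` is `max (g ∘ h)`, where `h` is applied first. -/
instance {A : Type} : Mul (BigGroup A) :=
  ⟨fun g h => BigGroup.ofIso (h.1.trans g.1) (h.2.1.trans g.2.1)⟩

instance {A : Type} : One (BigGroup A) :=
  ⟨⟨PEquiv.refl _, isEssentialIso_refl, isMaximalIso_refl⟩⟩

instance {A : Type} : Inv (BigGroup A) :=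
  ⟨fun g => ⟨g.1.symm, g.2.1.symm, g.2.2.symm⟩⟩

theorem BigGroup.mul_def {A : Type} (g h : BigGroup A) :
    g * h = BigGroup.ofIso (h.1.trans g.1) (h.2.1.trans g.2.1) := rfl

instance {A : Type} : Group (BigGroup A) :=
  Group.ofLeftAxioms
    (by
      intro f g h
      have h1 : f * g * h = BigGroup.ofIso ((h.1.trans g.1).trans f.1)
          ((h.2.1.trans g.2.1).trans f.2.1) := by
        symm
        refine ofIso_eq_of_le _ _ ?_
        rw [PEquiv.trans_assoc]
        exact trans_mono le_rfl (le_maxExt (g.2.1.trans f.2.1))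
      have h2 : f * (g * h) = BigGroup.ofIso ((h.1.trans g.1).trans f.1)
          ((h.2.1.trans g.2.1).trans f.2.1) := by
        symm
        exact ofIso_eq_of_le _ _ (trans_mono (le_maxExt (h.2.1.trans g.2.1)) le_rfl)
      rw [h1, h2])
    (by
      intro g
      refine Eq.trans ?_ (ofIso_toMap g)
      refine ofIso_eq_of_le _ _ ?_
      change g.1.trans (PEquiv.refl _) ≤ g.1
      rw [PEquiv.trans_refl])
    (by
      intro g
      refine Eq.trans ?_ (ofIso_toMap 1)
      refine ofIso_eq_of_le _ _ ?_
      change g.1.trans g.1.symm ≤ PEquiv.refl _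
      intro x y hy
      rw [PEquiv.mem_trans] at hy
      obtain ⟨b, hb, hy⟩ := hy
      rw [PEquiv.mem_iff_mem] at hy
      rw [PEquiv.inj _ hb hy]
      rfl)

/-- The Thompson-Higman group `G_{N,1}`, as a subset of `𝒢_{N,1}`: the maximal isomorphisms between
finitely generated essential right ideals. -/
def smallGroup (A : Type) : Set (BigGroup A) :=
  {g | IsFinGenIdeal (dom g.toMap) ∧ IsFinGenIdeal (im g.toMap)}

/-! ### The alphabet `{0,1,#}` and the elements `κ_i` -/

/-- The alphabet `{0,1,#}`: the letters `0`, `1` are `some false`, `some true`, and `#` is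
`none`. -/
abbrev Letter : Type := Option Bool

/-- Bit strings as words over `{0,1,#}`. -/
def bits (u : List Bool) : List Letter := u.map some

/-- The permutation `γ_i = ⋯ (i+3 | i+4 | i+5) (i | i+1 | i+2) (i-1) ⋯ (0)` of `ℕ`, as a
function. -/
def gamma (i k : ℕ) : ℕ :=
  if k < i then k else if (k - i) % 3 = 2 then k - 2 else k + 1

/-- Apply the cyclic shift `a b c ↦ c a b` to the consecutive complete triples of a string; one or
two remaining letters at the right end are left fixed. -/
def rotTriples {α : Type} : List α → List α
  | a :: b :: c :: t => c :: a :: b :: rotTriples t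
  | l => l

/-- The inverse of `rotTriples`. -/
def unrotTriples {α : Type} : List α → List α
  | c :: a :: b :: t => a :: b :: c :: unrotTriples t
  | l => l

theorem unrot_rot {α : Type} (l : List α) : unrotTriples (rotTriples l) = l := by
  fun_induction rotTriples l with
  | case1 a b c t ih => simp [unrotTriples, ih]
  | case2 l h =>
    match l, h with
    | [], _ => rfl
    | [_], _ => rfl
    | [_, _], _ => rfl
    | a :: b :: c :: t, h => exact absurd rfl (h a b c t)

theorem rot_unrot {α : Type} (l : List α) : rotTriples (unrotTriples l) = l := by
  fun_induction unrotTriples l with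
  | case1 a b c t ih => simp [rotTriples, ih]
  | case2 l h =>
    match l, h with
    | [], _ => rfl
    | [_], _ => rfl
    | [_, _], _ => rfl
    | a :: b :: c :: t, h => exact absurd rfl (h a b c t)

/-- The action of `κ_i` on the bit string in front of the first `#`. -/
def permBits {α : Type} (i : ℕ) (u : List α) : List α := u.take i ++ rotTriples (u.drop i)

/-- The inverse of `permBits i`. -/
def unpermBits {α : Type} (i : ℕ) (u : List α) : List α := u.take i ++ unrotTriples (u.drop i)

theorem unperm_perm {α : Type} (i : ℕ) (u : List α) : unpermBits i (permBits i u) = u := by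
  rcases le_total i u.length with h | h
  · have hl : (u.take i).length = i := by simp [h]
    rw [unpermBits, permBits, List.take_left' hl, List.drop_left' hl, unrot_rot,
      List.take_append_drop]
  · simp [unpermBits, permBits, List.take_of_length_le h, List.drop_of_length_le h, rotTriples,
      unrotTriples]

theorem perm_unperm {α : Type} (i : ℕ) (u : List α) : permBits i (unpermBits i u) = u := by
  rcases le_total i u.length with h | h
  · have hl : (u.take i).length = i := by simp [h]
    rw [unpermBits, permBits, List.take_left' hl, List.drop_left' hl, rot_unrot,
      List.take_append_drop]
  · simp [unpermBits, permBits, List.take_of_length_le h, List.drop_of_length_le h, rotTriples,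
      unrotTriples]

/-- The word `u # w`, for a bit string `u` and a word `w`. -/
def joinHash (p : List Bool × List Letter) : List Letter := bits p.1 ++ none :: p.2

/-- Split a word as `u # w` with a bit string `u`, if it contains a letter `#`. -/
def splitHash : List Letter → Option (List Bool × List Letter)
  | [] => none
  | none :: w => some ([], w)
  | some b :: x => (splitHash x).map fun p => (b :: p.1, p.2)

theorem splitHash_eq_some {x : List Letter} {p : List Bool × List Letter} :
    splitHash x = some p ↔ x = joinHash p := by
  induction x generalizing p with
  | nil => simp [splitHash, joinHash]
  | cons a x ih =>
    obtain ⟨u, w⟩ := p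
    cases a with
    | none => cases u <;> simp [splitHash, joinHash, bits]
    | some b =>
      cases u with
      | nil => simp [splitHash, joinHash, bits]
      | cons c u =>
        have := @ih (u, w)
        simp only [joinHash, bits] at this
        simp only [splitHash, joinHash, bits, Option.map_eq_some_iff, Prod.mk.injEq,
          List.cons.injEq, Prod.exists, List.map_cons, List.cons_append, Option.some.injEq]
        rw [← this]
        constructor
        · rintro ⟨_, _, h, ⟨rfl, rfl⟩, rfl⟩; exact ⟨rfl, h⟩
        · rintro ⟨rfl, h⟩; exact ⟨_, _, h, ⟨rfl, rfl⟩, rfl⟩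

/-- The partial map `u # w ↦ u' # w`, where `u'` is `u` permuted by `κ_i`. -/
def kappaMap (i : ℕ) : List Letter ≃. List Letter where
  toFun x := (splitHash x).map fun p => joinHash (permBits i p.1, p.2)
  invFun x := (splitHash x).map fun p => joinHash (unpermBits i p.1, p.2)
  inv x y := by
    simp only [Option.map_eq_some_iff, splitHash_eq_some]
    constructor
    · rintro ⟨p, rfl, rfl⟩
      exact ⟨_, rfl, by rw [perm_unperm]⟩
    · rintro ⟨p, rfl, rfl⟩
      exact ⟨_, rfl, by rw [unperm_perm]⟩

theorem mem_kappaMap {i : ℕ} {x y : List Letter} :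
    y ∈ kappaMap i x ↔
      ∃ u w, x = bits u ++ none :: w ∧ y = bits (permBits i u) ++ none :: w := by
  change (splitHash x).map (fun p => joinHash (permBits i p.1, p.2)) = some y ↔ _
  simp only [Option.map_eq_some_iff, splitHash_eq_some, Prod.exists, joinHash, eq_comm (a := y)]

theorem exists_eq_joinHash (x : List Letter) :
    ∃ u w, x ++ [none] = bits u ++ none :: w := by
  induction x with
  | nil => exact ⟨[], [], rfl⟩
  | cons a x ih =>
    obtain ⟨u, w, h⟩ := ih
    cases a with
    | none => exact ⟨[], x ++ [none], rfl⟩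
    | some b => exact ⟨b :: u, w, by simp [bits, h]⟩

theorem isEssentialIso_kappaMap (i : ℕ) : IsEssentialIso (kappaMap i) := by
  refine ⟨?_, ?_, ?_⟩
  · intro x y z hy
    rw [mem_kappaMap] at hy ⊢
    obtain ⟨u, w, rfl, rfl⟩ := hy
    exact ⟨u, w ++ z, by simp, by simp⟩
  · refine isEssential_iff.2 fun x => ?_
    obtain ⟨u, w, h⟩ := exists_eq_joinHash x
    exact ⟨[none], _, mem_kappaMap.2 ⟨u, w, h, rfl⟩⟩
  · refine isEssential_iff.2 fun x => ?_
    obtain ⟨u, w, h⟩ := exists_eq_joinHash x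
    exact ⟨[none], _, mem_kappaMap.2 ⟨unpermBits i u, w, rfl, by rw [perm_unperm, h]⟩⟩

/-- The element `κ_i` of `𝒢_{3,1}`. -/
def kappa (i : ℕ) : BigGroup Letter := BigGroup.ofIso (kappaMap i) (isEssentialIso_kappaMap i)

/-- The element `κ_321 = κ_3 κ_2 κ_1` of `𝒢_{3,1}`. -/
def kappa321 : BigGroup Letter := kappa 3 * kappa 2 * kappa 1

/-- Where `κ_i` permutes bits (within complete triples), the bit at position `k` moves to position
`γ_i(k)`. -/
theorem permBits_getElem?_gamma {α : Type} (i : ℕ) (u : List α) (k : ℕ)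
    (hk : k < i + 3 * ((u.length - i) / 3)) : (permBits i u)[gamma i k]? = u[k]? := by
  have key : ∀ (l : List α) (j : ℕ), j < 3 * (l.length / 3) →
      (rotTriples l)[if j % 3 = 2 then j - 2 else j + 1]? = l[j]? := by
    intro l
    fun_induction rotTriples l with
    | case1 a b c t ih =>
      intro j hj
      match j, hj with
      | 0, _ => simp
      | 1, _ => simp
      | 2, _ => simp
      | j + 3, hj =>
        have h1 := ih j (by simp only [List.length_cons] at hj; omega)
        have h2 : (if (j + 3) % 3 = 2 then j + 3 - 2 else j + 3 + 1) =
            (if j % 3 = 2 then j - 2 else j + 1) + 3 := by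
          split_ifs <;> omega
        rw [h2]
        simpa using h1
    | case2 l h =>
      intro j hj
      match l, h with
      | [], _ => simp at hj
      | [_], _ => simp at hj
      | [_, _], _ => simp at hj
      | a :: b :: c :: t, h => exact absurd rfl (h a b c t)
  unfold gamma permBits
  split_ifs with h1 h2
  · rcases lt_or_ge k u.length with h | h
    · rw [List.getElem?_append_left (by simp; omega), List.getElem?_take_of_lt h1]
    · simp [List.drop_of_length_le (show u.length ≤ i by omega), rotTriples,
        List.take_of_length_le (show u.length ≤ i by omega)]
  all_goals
    have h3 := key (u.drop i) (k - i) (by simp; omega)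
    rw [List.getElem?_append_right (by simp; omega), List.length_take, min_eq_left (by omega)]
    simp only [h2, if_true, if_false] at h3
    rw [List.getElem?_drop, show i + (k - i) = k by omega] at h3
    rw [← h3]
    congr 1
    omega

/-- `κ_i` fixes the bits at the right end that do not belong to a complete triple. -/
theorem permBits_getElem?_of_le {α : Type} (i : ℕ) (u : List α) (k : ℕ)
    (hk : i + 3 * ((u.length - i) / 3) ≤ k) : (permBits i u)[k]? = u[k]? := by
  have key : ∀ (l : List α) (j : ℕ), 3 * (l.length / 3) ≤ j → (rotTriples l)[j]? = l[j]? := by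
    intro l
    fun_induction rotTriples l with
    | case1 a b c t ih =>
      intro j hj
      simp only [List.length_cons] at hj
      obtain ⟨j, rfl⟩ : ∃ j', j = j' + 3 := ⟨j - 3, by omega⟩
      simpa using ih j (by omega)
    | case2 l h => intro j _; rfl
  unfold permBits
  rcases lt_or_ge u.length i with h | h
  · simp [List.drop_of_length_le h.le, List.take_of_length_le h.le, rotTriples]
  · rw [List.getElem?_append_right (by simp; omega), List.length_take, min_eq_left h,
      key _ _ (by simp; omega), List.getElem?_drop, show i + (k - i) = k by omega]

/-! ### The subgroups of `𝒢_{3,1}` -/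

/-- `G_{3,1}^{mod 3}(0,1)`: the elements `φ` of `G_{3,1}` such that `φ` and `φ⁻¹` map bit strings to
bit strings (where they are defined), and `|φ(x)| ≡ |x|` mod `3` for all bit strings `x` for which
`φ(x)` is defined. -/
def mod3Bits : Set (BigGroup Letter) :=
  {g | g ∈ smallGroup Letter ∧
    (∀ u : List Bool, ∀ y ∈ g.toMap (bits u), ∃ v, y = bits v) ∧
    (∀ u : List Bool, ∀ y ∈ (g⁻¹).toMap (bits u), ∃ v, y = bits v) ∧
    ∀ u : List Bool, ∀ y ∈ g.toMap (bits u), y.length ≡ u.length [MOD 3]}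

/-- `G_{3,1}^{mod 3}(0,1;#)`: the elements `φ` of `G_{3,1}^{mod 3}(0,1)` such that `φ` and `φ⁻¹` are
defined on all words `x#` with a bit string `x` and map them to words of this form. -/
def mod3BitsHash : Set (BigGroup Letter) :=
  {g | g ∈ mod3Bits ∧
    (∀ u : List Bool, ∃ v, bits v ++ [none] ∈ g.toMap (bits u ++ [none])) ∧
    ∀ u : List Bool, ∃ v, bits v ++ [none] ∈ (g⁻¹).toMap (bits u ++ [none])}

/-- `⟨G_{3,1} ∪ {κ_0, κ_1, κ_2}⟩`. -/
def groupK012 : Subgroup (BigGroup Letter) :=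
  Subgroup.closure (smallGroup Letter ∪ {kappa 0, kappa 1, kappa 2})

/-- `⟨G_{3,1} ∪ {κ_321}⟩`. -/
def groupK321 : Subgroup (BigGroup Letter) :=
  Subgroup.closure (smallGroup Letter ∪ {kappa321})

/-- `H(0,1) = ⟨G_{3,1}^{mod 3}(0,1) ∪ {κ_321}⟩`. -/
def groupH : Subgroup (BigGroup Letter) :=
  Subgroup.closure (mod3Bits ∪ {kappa321})

/-- `H(0,1;#) = ⟨G_{3,1}^{mod 3}(0,1;#) ∪ {κ_321}⟩`. -/
def groupHHash : Subgroup (BigGroup Letter) :=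
  Subgroup.closure (mod3BitsHash ∪ {kappa321})

/-! ### Words over generators, and the complexity of the word problem -/

/-- The group element given by a letter `(i, true)`, read as `s i`, or `(i, false)`, read as
`(s i)⁻¹`. -/
def letterVal {G : Type} [Group G] {k : ℕ} (s : Fin k → G) (p : Fin k × Bool) : G :=
  if p.2 then s p.1 else (s p.1)⁻¹

/-- The group element given by a word over `s 0, …, s (k-1)` and their inverses. -/
def wordVal {G : Type} [Group G] {k : ℕ} (s : Fin k → G) (w : List (Fin k × Bool)) : G :=
  (w.map (letterVal s)).prod

/-- The partial map obtained from a word over elements of `𝒢_{N,1}` by applying the partial maps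
given by its letters one after the other, the rightmost first (without maximum extensions). -/
def wordComp {A : Type} {k : ℕ} (s : Fin k → BigGroup A) :
    List (Fin k × Bool) → (List A ≃. List A)
  | [] => PEquiv.refl _
  | p :: w => (wordComp s w).trans (letterVal s p).toMap

/-- The complexity class NP, for languages over a finite alphabet `α`: there are a polynomial `p`
and a relation `R` between words `x` and bit strings `c`, decidable in polynomial time by a
deterministic Turing machine, such that `x ∈ L` iff `R x c` holds for some `c` of length at most
`p(|x|)`. The Turing machines are Mathlib's multi-stack machines; a pair `(x, c)` is given as the
concatenation of `x` and `c` over the disjoint union of the two alphabets. -/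
def InNP {α : Type} [Fintype α] (L : Set (List α)) : Prop :=
  ∃ (p : Polynomial ℕ) (R : List α × List Bool → Bool),
    Nonempty (TM2ComputableInPolyTime
      (encodingProd (encodingList α) (encodingList Bool)).encode encodeBool R) ∧
    ∀ x : List α, x ∈ L ↔ ∃ c : List Bool, c.length ≤ p.eval x.length ∧ R (x, c) = true

/-- The complexity class coNP. -/
def InCoNP {α : Type} [Fintype α] (L : Set (List α)) : Prop := InNP Lᶜ

/-- The word problem of `G` is in coNP, over every finite generating family: the set of words over
the generators and their inverses that represent the identity is in coNP. -/
def WordProblemInCoNP (G : Type) [Group G] : Prop :=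
  ∀ (k : ℕ) (s : Fin k → G), Subgroup.closure (Set.range s) = ⊤ →
    InCoNP {w : List (Fin k × Bool) | wordVal s w = 1}

end Thompson

end

noncomputable section

namespace Thompson

/-! ### Elements of `𝒢_{N,1}` as partial maps -/

namespace BigGroup

variable {A : Type} {g h : BigGroup A} {x y z : List A}

/-! Two separate arguments carry the theorem: short witnesses for the word problems, and swaps of
cones for finite generation.

Short witnesses. An element of `G_{3,1}` rewrites a prefix of bounded length, and `κ_i` permutes
bits inside consecutive triples. If a factor of bits far from both ends of a word is replaced by one
of the same length modulo 3, the triple boundaries on its right do not shift, so the images of the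
outer parts stay the same up to a bounded erosion next to the factor. `LocalMap C` records this. The
constants add under composition, so a word of `n` letters acts locally with a constant linear in
`n`. Suppose that a local restriction `f` of `g` moves no word of length at most `6C + 10`. Then by
induction it fixes every longer word that ends with `#`. A `#` deep inside the word yields a shorter
prefix that is already fixed. Otherwise there is a long run of bits. Deleting a triple near its left
end shows that a suffix is unchanged, deleting one near its right end shows that a prefix is
unchanged, and the two overlap. Hence `g = 1` (`LocalMap.exists_short`), and a non-trivial word
moves a string of linear length.

Such a string is the NP certificate for non-triviality. Generators are computed by sequential
transducers that lengthen words by at most a constant, so a stack machine applies them one after the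
other in polynomial time (`Verifier.verifies_polyTime`).

Finite generation. An element of `G_{3,1}` maps a finite maximal prefix code onto another one. Both
codes arise from `{[]}` by repeatedly expanding a word, and counting their words shows that the
expansions are equally many. Products of swaps therefore carry one code to the other
(`Exp.exists_map`), and what remains is a permutation of a code, a product of transpositions. For
the groups with the condition modulo 3, words with and without `#` form two classes, which the
elements preserve, and bit strings are expanded three bits at a time. Long swaps are conjugate to
shorter ones by short swaps (`swap_mem_of_short`), so finitely many swaps suffice.

The inclusions in `K` hold because `κ_3 κ_0⁻¹` lies in `G_{3,1}`: it only permutes the first three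
bits. -/

theorem mem_append (hy : y ∈ g.toMap x) (z : List A) : y ++ z ∈ g.toMap (x ++ z) :=
  g.2.1.iso _ _ _ hy

theorem exists_mem (g : BigGroup A) (x : List A) : ∃ z y, y ∈ g.toMap (x ++ z) :=
  isEssential_iff.1 g.2.1.dom_essential x

/-- Maximality of `g` enters here: a value that is compatible with all values on extensions of `x`
is already taken. -/
theorem mem_of_extends (hxy : ∀ z w, w ∈ g.toMap (x ++ z) → w = y ++ z) : y ∈ g.toMap x := by
  have h1 : y ∈ maxExt g.1 g.2.1 x := (mem_maxExt g.2.1).2 hxy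
  rwa [maxExt_eq_self g.2.1 g.2.2] at h1

theorem mem_one (x : List A) : x ∈ (1 : BigGroup A).toMap x := rfl

theorem mem_one_iff : y ∈ (1 : BigGroup A).toMap x ↔ y = x :=
  ⟨fun h => Option.mem_unique h (mem_one x), fun h => h ▸ mem_one x⟩

theorem mem_mul (hy : y ∈ h.toMap x) (hz : z ∈ g.toMap y) : z ∈ (g * h).toMap x :=
  le_maxExt (h.2.1.trans g.2.1) _ _ ((PEquiv.mem_trans _ _ _ _).2 ⟨y, hy, hz⟩)

theorem mem_inv_iff : x ∈ (g⁻¹).toMap y ↔ y ∈ g.toMap x := PEquiv.mem_iff_mem g.1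

theorem mem_inj (hx : y ∈ g.toMap x) (hz : y ∈ g.toMap z) : x = z := PEquiv.inj _ hx hz

/-- Two elements that agree on an essential set are equal. -/
theorem eq_of_agree (H : ∀ x, ∃ z y, y ∈ g.toMap (x ++ z) ∧ y ∈ h.toMap (x ++ z)) : g = h := by
  have key : ∀ g h : BigGroup A, (∀ x, ∃ z y, y ∈ g.toMap (x ++ z) ∧ y ∈ h.toMap (x ++ z)) →
      g.toMap ≤ h.toMap := by
    intro g h H x y hy
    refine mem_of_extends fun z w hw => ?_
    obtain ⟨t, v, hg, hh⟩ := H (x ++ z)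
    have h1 := Option.mem_unique hg (mem_append (mem_append hy z) t)
    have h2 := Option.mem_unique hh (mem_append hw t)
    exact List.append_cancel_right (h2.symm.trans h1)
  refine Subtype.ext (le_antisymm (key g h H) (key h g fun x => ?_))
  obtain ⟨z, y, h1, h2⟩ := H x
  exact ⟨z, y, h2, h1⟩

theorem mem_ofIso {φ : List A ≃. List A} (hφ : IsEssentialIso φ) (hy : y ∈ φ x) :
    y ∈ (ofIso φ hφ).toMap x := le_maxExt hφ _ _ hy

end BigGroup

/-- A long word `x` has an extension in the essential ideal, and a generator below that extension is
no longer than `x`, hence a prefix of `x`. Conversely, if all words of length `N` are in the ideal,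
its finitely many words of length at most `N` generate it. -/
theorem mem_smallGroup_iff {A : Type} [Finite A] {g : BigGroup A} :
    g ∈ smallGroup A ↔ ∃ N, ∀ x : List A, N ≤ x.length → x ∈ dom g.toMap ∧ x ∈ im g.toMap := by
  have key : ∀ R : Set (List A), IsRightIdeal R → IsEssential R →
      (IsFinGenIdeal R ↔ ∃ N, ∀ x : List A, N ≤ x.length → x ∈ R) := by
    intro R hR hE
    constructor
    · rintro ⟨Γ, rfl⟩
      refine ⟨Γ.sup List.length, fun x hx => ?_⟩
      obtain ⟨z, g, hg, z', h⟩ := isEssential_iff.1 hE x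
      have hl : g.length ≤ x.length := (Finset.le_sup (f := List.length) hg).trans hx
      obtain ⟨t, ht⟩ := List.prefix_of_prefix_length_le (List.prefix_append g z')
        (h ▸ List.prefix_append x z) hl
      exact ⟨g, hg, t, ht.symm⟩
    · rintro ⟨N, hN⟩
      have hf : ({x : List A | x.length ≤ N} ∩ R).Finite :=
        (List.finite_length_le A N).subset Set.inter_subset_left
      refine ⟨hf.toFinset, Set.ext fun x => ⟨fun hx => ?_, ?_⟩⟩
      · rcases le_total x.length N with h | h
        · exact ⟨x, by simp [h, hx], [], by simp⟩
        · exact ⟨x.take N, by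
            rw [Set.Finite.mem_toFinset]
            exact ⟨by simp, hN _ (by simp [h])⟩, x.drop N, by simp⟩
      · rintro ⟨g, hg, z, rfl⟩
        rw [Set.Finite.mem_toFinset] at hg
        exact hR _ hg.2 z
  change IsFinGenIdeal (dom g.1) ∧ IsFinGenIdeal (im g.1) ↔ _
  rw [key _ g.2.1.iso.dom g.2.1.dom_essential, key _ g.2.1.iso.im g.2.1.im_essential]
  constructor
  · rintro ⟨⟨N, hN⟩, M, hM⟩
    exact ⟨max N M, fun x hx => ⟨hN x (le_of_max_le_left hx), hM x (le_of_max_le_right hx)⟩⟩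
  · rintro ⟨N, hN⟩
    exact ⟨⟨N, fun x hx => (hN x hx).1⟩, N, fun x hx => (hN x hx).2⟩

/-! ### Swapping two cones -/

/-- Neither of the words `p`, `q` is a prefix of the other. -/
def Incomp {A : Type} (p q : List A) : Prop := ¬ p <+: q ∧ ¬ q <+: p

theorem Incomp.symm {A : Type} {p q : List A} (h : Incomp p q) : Incomp q p := ⟨h.2, h.1⟩

theorem Incomp.append_left {A : Type} {p q : List A} (h : Incomp p q) (z : List A) :
    Incomp (p ++ z) q :=
  ⟨fun h' => h.1 ((List.prefix_append p z).trans h'), fun h' => by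
    rcases List.prefix_or_prefix_of_prefix (List.prefix_append p z) h' with h1 | h1
    exacts [h.1 h1, h.2 h1]⟩

theorem Incomp.append_right {A : Type} {p q : List A} (h : Incomp p q) (z : List A) :
    Incomp p (q ++ z) := (h.symm.append_left z).symm

theorem incomp_append_iff {A : Type} {p q r : List A} : Incomp (p ++ q) (p ++ r) ↔ Incomp q r := by
  simp [Incomp, List.prefix_append_right_inj]

theorem incomp_of_length {A : Type} {p q : List A} (h : p.length = q.length) (hne : p ≠ q) :
    Incomp p q :=
  ⟨fun h' => hne (h'.eq_of_length h), fun h' => hne (h'.eq_of_length h.symm).symm⟩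

theorem trichotomy {A : Type} (p q : List A) : Incomp p q ∨ p <+: q ∨ q <+: p := by
  unfold Incomp; tauto

namespace BigGroup

variable {A : Type} {g : BigGroup A} {p q p' q' : List A}

theorem prefix_of_mem (hp : p' ∈ g.toMap p) (hq : q' ∈ g.toMap q) (h : p <+: q) : p' <+: q' := by
  obtain ⟨z, rfl⟩ := h
  exact ⟨z, (Option.mem_unique hq (mem_append hp z)).symm⟩

theorem prefix_iff_of_mem (hp : p' ∈ g.toMap p) (hq : q' ∈ g.toMap q) : p' <+: q' ↔ p <+: q :=
  ⟨prefix_of_mem (g := g⁻¹) (mem_inv_iff.2 hp) (mem_inv_iff.2 hq), prefix_of_mem hp hq⟩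

theorem incomp_iff_of_mem (hp : p' ∈ g.toMap p) (hq : q' ∈ g.toMap q) :
    Incomp p' q' ↔ Incomp p q := by
  rw [Incomp, Incomp, prefix_iff_of_mem hp hq, prefix_iff_of_mem hq hp]

end BigGroup

open Classical in
/-- The map that exchanges the prefixes `p` and `q`. -/
def swapFun {A : Type} (p q x : List A) : Option (List A) :=
  if p <+: x then some (q ++ x.drop p.length)
  else if q <+: x then some (p ++ x.drop q.length)
  else if Incomp p x ∧ Incomp q x then some x else none

section Swap

variable {A : Type} {p q : List A}

theorem swapFun_left (p q z : List A) : swapFun p q (p ++ z) = some (q ++ z) := by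
  simp [swapFun]

theorem swapFun_right (h : Incomp p q) (z : List A) : swapFun p q (q ++ z) = some (p ++ z) := by
  rw [swapFun, if_neg (h.append_right z).1]
  simp

theorem swapFun_of_incomp {x : List A} (h1 : Incomp p x) (h2 : Incomp q x) :
    swapFun p q x = some x := by
  rw [swapFun, if_neg h1.1, if_neg h2.1, if_pos ⟨h1, h2⟩]

theorem swapFun_eq_some {x y : List A} (h : swapFun p q x = some y) :
    (∃ z, x = p ++ z ∧ y = q ++ z) ∨ (∃ z, x = q ++ z ∧ y = p ++ z) ∨
      (Incomp p x ∧ Incomp q x ∧ y = x) := by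
  unfold swapFun at h
  split_ifs at h with h1 h2 h3
  · obtain ⟨z, rfl⟩ := h1
    exact Or.inl ⟨z, rfl, by simpa using h.symm⟩
  · obtain ⟨z, rfl⟩ := h2
    exact Or.inr (Or.inl ⟨z, rfl, by simpa using h.symm⟩)
  · exact Or.inr (Or.inr ⟨h3.1, h3.2, (Option.some_inj.1 h).symm⟩)

theorem swapFun_swapFun (h : Incomp p q) {x y : List A} (hy : swapFun p q x = some y) :
    swapFun p q y = some x := by
  rcases swapFun_eq_some hy with ⟨z, rfl, rfl⟩ | ⟨z, rfl, rfl⟩ | ⟨h1, h2, rfl⟩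
  · exact swapFun_right h z
  · exact swapFun_left p q z
  · exact hy

/-- The map that exchanges the prefixes `p` and `q`, as a partial injective map. -/
def swapMap (p q : List A) (h : Incomp p q) : List A ≃. List A where
  toFun := swapFun p q
  invFun := swapFun p q
  inv _ _ := ⟨swapFun_swapFun h, swapFun_swapFun h⟩

theorem exists_swapFun (h : Incomp p q) (x : List A)
    (hx : max p.length q.length ≤ x.length) : ∃ y, swapFun p q x = some y := by
  rcases trichotomy p x with h1 | ⟨z, rfl⟩ | h1
  · rcases trichotomy q x with h2 | ⟨z, rfl⟩ | h2
    · exact ⟨x, swapFun_of_incomp h1 h2⟩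
    · exact ⟨_, swapFun_right h z⟩
    · obtain rfl := h2.eq_of_length (le_antisymm h2.length_le (le_of_max_le_right hx))
      exact ⟨p, by simpa using swapFun_right h []⟩
  · exact ⟨_, swapFun_left p q z⟩
  · obtain rfl := h1.eq_of_length (le_antisymm h1.length_le (le_of_max_le_left hx))
    exact ⟨q, by simpa using swapFun_left x q []⟩

theorem isEssentialIso_swapMap (h : Incomp p q) : IsEssentialIso (swapMap p q h) := by
  have hiso : IsRightIdealIso (swapMap p q h) := by
    intro x y z hy
    rcases swapFun_eq_some hy with ⟨t, rfl, rfl⟩ | ⟨t, rfl, rfl⟩ | ⟨h1, h2, rfl⟩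
    · rw [List.append_assoc, List.append_assoc]; exact swapFun_left p q _
    · rw [List.append_assoc, List.append_assoc]; exact swapFun_right h _
    · exact swapFun_of_incomp (h1.append_right z) (h2.append_right z)
  have hd : IsEssential (dom (swapMap p q h)) := by
    refine isEssential_iff.2 fun x => ?_
    by_cases hA : ∃ w : List A, max p.length q.length ≤ w.length
    · obtain ⟨w, hw⟩ := hA
      obtain ⟨y, hy⟩ := exists_swapFun h (x ++ w) (by simp; omega)
      exact ⟨w, y, hy⟩
    · exact absurd ⟨if p.length ≤ q.length then q else p, by split_ifs <;> omega⟩ hA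
  exact ⟨hiso, hd, by rw [← dom_symm]; exact hd⟩

open Classical in
/-- The element of `𝒢_{N,1}` that exchanges the prefixes `p` and `q` (the identity if `p` and `q`
are comparable). -/
def swap (p q : List A) : BigGroup A :=
  if h : Incomp p q then BigGroup.ofIso (swapMap p q h) (isEssentialIso_swapMap h) else 1

theorem mem_swap_of_eq (h : Incomp p q) {x y : List A} (hy : swapFun p q x = some y) :
    y ∈ (swap p q).toMap x := by
  rw [swap, dif_pos h]
  exact BigGroup.mem_ofIso _ hy

theorem mem_swap_left (h : Incomp p q) (z : List A) : q ++ z ∈ (swap p q).toMap (p ++ z) :=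
  mem_swap_of_eq h (swapFun_left p q z)

theorem mem_swap_left' (h : Incomp p q) : q ∈ (swap p q).toMap p := by
  simpa using mem_swap_left h []

theorem mem_swap_right (h : Incomp p q) (z : List A) : p ++ z ∈ (swap p q).toMap (q ++ z) :=
  mem_swap_of_eq h (swapFun_right h z)

theorem mem_swap_right' (h : Incomp p q) : p ∈ (swap p q).toMap q := by
  simpa using mem_swap_right h []

theorem mem_swap_of_incomp (h : Incomp p q) {x : List A} (h1 : Incomp p x) (h2 : Incomp q x) :
    x ∈ (swap p q).toMap x := mem_swap_of_eq h (swapFun_of_incomp h1 h2)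

theorem swap_comm (h : Incomp p q) : swap p q = swap q p := by
  refine BigGroup.eq_of_agree fun x => ?_
  -- Appending the longer of `p` and `q` makes any word long enough for `swapFun` to be defined.
  let w := if p.length ≤ q.length then q else p
  obtain ⟨y, hy⟩ := exists_swapFun h (x ++ w) (by simp only [w]; split_ifs <;> simp <;> omega)
  refine ⟨w, y, mem_swap_of_eq h hy, ?_⟩
  rcases swapFun_eq_some hy with ⟨z, h1, rfl⟩ | ⟨z, h1, rfl⟩ | ⟨h1, h2, rfl⟩
  · rw [h1]; exact mem_swap_right h.symm z
  · rw [h1]; exact mem_swap_left h.symm z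
  · exact mem_swap_of_incomp h.symm h2 h1

theorem swap_inv (p q : List A) : (swap p q)⁻¹ = swap p q := by
  by_cases h : Incomp p q
  · refine BigGroup.eq_of_agree fun x => ?_
    let w := if p.length ≤ q.length then q else p
    obtain ⟨y, hy⟩ := exists_swapFun h (x ++ w) (by simp only [w]; split_ifs <;> simp <;> omega)
    exact ⟨w, y, BigGroup.mem_inv_iff.2 (mem_swap_of_eq h (swapFun_swapFun h hy)),
      mem_swap_of_eq h hy⟩
  · rw [swap, dif_neg h, inv_one]

theorem swap_mem_smallGroup [Finite A] (p q : List A) : swap p q ∈ smallGroup A := by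
  by_cases h : Incomp p q
  · refine mem_smallGroup_iff.2 ⟨max p.length q.length, fun x hx => ?_⟩
    obtain ⟨y, hy⟩ := exists_swapFun h x hx
    exact ⟨⟨y, mem_swap_of_eq h hy⟩, y, mem_swap_of_eq h (swapFun_swapFun h hy)⟩
  · rw [swap, dif_neg h]
    exact mem_smallGroup_iff.2 ⟨0, fun x _ => ⟨⟨x, rfl⟩, x, rfl⟩⟩

/-- Conjugation of a swap by an element that is defined at both words. -/
theorem conj_swap {g : BigGroup A} {p' q' : List A} (h : Incomp p q) (hp : p' ∈ g.toMap p)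
    (hq : q' ∈ g.toMap q) : g * swap p q * g⁻¹ = swap p' q' := by
  have h' : Incomp p' q' := (BigGroup.incomp_iff_of_mem hp hq).2 h
  refine BigGroup.eq_of_agree fun x => ?_
  let w := if p.length ≤ q.length then q else p
  -- Extend `x` by `z` to reach the domain of `g⁻¹`, then by `w` to reach the domain of the swap.
  obtain ⟨z, y, hy⟩ := BigGroup.exists_mem g⁻¹ x
  obtain ⟨v, hv⟩ := exists_swapFun h (y ++ w) (by simp only [w]; split_ifs <;> simp <;> omega)
  have hyw := BigGroup.mem_append hy w
  have hxy := BigGroup.mem_inv_iff.1 hyw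
  refine ⟨z ++ w, ?_⟩
  rw [← List.append_assoc]
  have h1 := mem_swap_of_eq h hv
  rcases swapFun_eq_some hv with ⟨t, h2, rfl⟩ | ⟨t, h2, rfl⟩ | ⟨h2, h3, rfl⟩
  · refine ⟨q' ++ t, BigGroup.mem_mul hyw (BigGroup.mem_mul h1 (BigGroup.mem_append hq t)), ?_⟩
    rw [h2] at hxy
    rw [Option.mem_unique hxy (BigGroup.mem_append hp t)]
    exact mem_swap_left h' t
  · refine ⟨p' ++ t, BigGroup.mem_mul hyw (BigGroup.mem_mul h1 (BigGroup.mem_append hp t)), ?_⟩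
    rw [h2] at hxy
    rw [Option.mem_unique hxy (BigGroup.mem_append hq t)]
    exact mem_swap_right h' t
  · exact ⟨_, BigGroup.mem_mul hyw (BigGroup.mem_mul h1 hxy), mem_swap_of_incomp h'
      ((BigGroup.incomp_iff_of_mem hp hxy).2 h2) ((BigGroup.incomp_iff_of_mem hq hxy).2 h3)⟩

end Swap

/-! ### Sequential transducers -/

/-- A sequential transducer over the alphabet `{0,1,#}`: a deterministic automaton that writes a
word for every letter it reads, and a last word (or rejects) at the end of the input. -/
structure Transducer where
  /-- the states -/
  S : Type
  /-- there are finitely many states -/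
  [finS : Fintype S]
  /-- the initial state -/
  init : S
  /-- the next state and the output, after reading a letter -/
  next : S → Letter → S × List Letter
  /-- the output at the end of the input -/
  final : S → Option (List Letter)

namespace Transducer

variable (T : Transducer)

/-- The state and the output after reading a word. -/
def run (T : Transducer) (s : T.S) : List Letter → T.S × List Letter
  | [] => (s, [])
  | a :: x => ((run T (T.next s a).1 x).1, (T.next s a).2 ++ (run T (T.next s a).1 x).2)

/-- The output on a complete input word, starting in a given state. -/
def evalFrom (s : T.S) (x : List Letter) : Option (List Letter) :=
  (T.final (T.run s x).1).map ((T.run s x).2 ++ ·)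

/-- The partial function computed by a transducer. -/
def eval (x : List Letter) : Option (List Letter) := T.evalFrom T.init x

theorem run_nil (s : T.S) : T.run s [] = (s, []) := rfl

theorem run_cons (s : T.S) (a : Letter) (x : List Letter) : T.run s (a :: x) =
    ((T.run (T.next s a).1 x).1, (T.next s a).2 ++ (T.run (T.next s a).1 x).2) := rfl

theorem run_append (s : T.S) (x y : List Letter) :
    T.run s (x ++ y) =
      ((T.run (T.run s x).1 y).1, (T.run s x).2 ++ (T.run (T.run s x).1 y).2) := by
  induction x generalizing s with
  | nil => simp [run]
  | cons a x ih => simp [run, ih]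

theorem evalFrom_append (s : T.S) (x y : List Letter) :
    T.evalFrom s (x ++ y) = (T.evalFrom (T.run s x).1 y).map ((T.run s x).2 ++ ·) := by
  simp [evalFrom, run_append, Function.comp_def]

theorem evalFrom_cons (s : T.S) (a : Letter) (x : List Letter) :
    T.evalFrom s (a :: x) = (T.evalFrom (T.next s a).1 x).map ((T.next s a).2 ++ ·) := by
  simp [evalFrom, run, Function.comp_def]

/-- The composition of two transducers, `T₁` being applied first. -/
def comp (T₂ T₁ : Transducer) : Transducer :=
  letI := T₁.finS
  letI := T₂.finS
  { S := T₁.S × T₂.S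
    init := (T₁.init, T₂.init)
    next := fun s a => (((T₁.next s.1 a).1, (T₂.run s.2 (T₁.next s.1 a).2).1),
      (T₂.run s.2 (T₁.next s.1 a).2).2)
    final := fun s => (T₁.final s.1).bind (T₂.evalFrom s.2) }

theorem run_comp (T₂ T₁ : Transducer) (s₁ : T₁.S) (s₂ : T₂.S) (x : List Letter) :
    (T₂.comp T₁).run (s₁, s₂) x =
      (((T₁.run s₁ x).1, (T₂.run s₂ (T₁.run s₁ x).2).1), (T₂.run s₂ (T₁.run s₁ x).2).2) := by
  induction x generalizing s₁ s₂ with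
  | nil => rfl
  | cons a x ih =>
    have h := ih (T₁.next s₁ a).1 (T₂.run s₂ (T₁.next s₁ a).2).1
    simp only [run, run_append] at h ⊢
    simp only [comp] at h ⊢
    rw [h]

/-- At the end of the input `T₂` has read all that `T₁` wrote on the way, but not its final output;
this is why the final output of the composition is a whole run of `T₂`. -/
theorem eval_comp (T₂ T₁ : Transducer) (x : List Letter) :
    (T₂.comp T₁).eval x = (T₁.eval x).bind T₂.eval := by
  have h := run_comp T₂ T₁ T₁.init T₂.init x
  change Option.map (((T₂.comp T₁).run (T₁.init, T₂.init) x).2 ++ ·) ((T₂.comp T₁).final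
    ((T₂.comp T₁).run (T₁.init, T₂.init) x).1) = _
  rw [h]
  change Option.map _ ((T₁.final (T₁.run T₁.init x).1).bind
    (T₂.evalFrom (T₂.run T₂.init (T₁.run T₁.init x).2).1)) = _
  unfold eval
  rw [evalFrom]
  cases T₁.final (T₁.run T₁.init x).1 with
  | none => rfl
  | some o => simp [evalFrom_append]

end Transducer

/-! ### Partial functions that act locally -/

/-- The word ends with the letter `#`. -/
def EndsHash (s : List Letter) : Prop := ∃ t, s = t ++ [none]

theorem EndsHash.append {s : List Letter} (h : EndsHash s) (t : List Letter) :
    EndsHash (t ++ s) := by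
  obtain ⟨r, rfl⟩ := h
  exact ⟨t ++ r, by simp⟩

theorem EndsHash.of_append {t : List Letter} {a : Letter} {s : List Letter}
    (h : EndsHash (t ++ a :: s)) : EndsHash (a :: s) := by
  obtain ⟨r, h⟩ := h
  have h1 : (t ++ a :: s).getLast? = some none := by rw [h]; simp
  rw [List.getLast?_append_of_ne_nil _ (by simp)] at h1
  obtain ⟨l, h2⟩ := List.getLast?_eq_some_iff.1 h1
  exact ⟨l, h2⟩

/-- `f` changes a word `a y s` that ends with `#` only locally around its left end, where `y` is a
bit string that may be replaced by another one of the same length modulo `3`. -/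
def LocalMap (C : ℕ) (f : List Letter → Option (List Letter)) : Prop :=
  ∀ (a s : List Letter) (y y' : List Bool), C ≤ a.length → C ≤ s.length → EndsHash s →
    y.length % 3 = y'.length % 3 →
    ∃ (a₁ s₁ : List Letter) (y₁ y₁' : List Bool),
      f (a ++ bits y ++ s) = some (a₁ ++ bits y₁ ++ s₁) ∧
      f (a ++ bits y' ++ s) = some (a₁ ++ bits y₁' ++ s₁) ∧
      a.length ≤ a₁.length + C ∧ s.length ≤ s₁.length + C ∧ EndsHash s₁ ∧
      y₁.length + y'.length = y₁'.length + y.length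

/-- The output of `f₁` has the shape that `f₂` requires: its outer parts have lost at most `C₁`
letters, and since the difference of the lengths of the middle parts is preserved exactly, these are
still congruent modulo 3. -/
theorem LocalMap.comp {C₁ C₂ : ℕ} {f₁ f₂ : List Letter → Option (List Letter)}
    (h₁ : LocalMap C₁ f₁) (h₂ : LocalMap C₂ f₂) :
    LocalMap (C₁ + C₂) fun x => (f₁ x).bind f₂ := by
  intro a s y y' ha hs he hy
  obtain ⟨a₁, s₁, y₁, y₁', e, e', ha₁, hs₁, he₁, hy₁⟩ := h₁ a s y y' (by omega) (by omega) he hy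
  obtain ⟨a₂, s₂, y₂, y₂', e₂, e₂', ha₂, hs₂, he₂, hy₂⟩ :=
    h₂ a₁ s₁ y₁ y₁' (by omega) (by omega) he₁ (by omega)
  exact ⟨a₂, s₂, y₂, y₂', by simp only [e, Option.bind_some, e₂],
    by simp only [e', Option.bind_some, e₂'], by omega, by omega, he₂, by omega⟩

theorem LocalMap.mono {C D : ℕ} {f : List Letter → Option (List Letter)} (h : LocalMap C f)
    (hCD : C ≤ D) : LocalMap D f := by
  intro a s y y' ha hs he hy
  obtain ⟨a₁, s₁, y₁, y₁', e, e', ha₁, hs₁, he₁, hy₁⟩ := h a s y y' (by omega) (by omega) he hy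
  exact ⟨a₁, s₁, y₁, y₁', e, e', by omega, by omega, he₁, hy₁⟩

theorem localMap_some : LocalMap 0 some := fun a s y y' _ _ he _ =>
  ⟨a, s, y, y', rfl, rfl, le_rfl, le_rfl, he, by omega⟩

theorem bits_append (u v : List Bool) : bits (u ++ v) = bits u ++ bits v := List.map_append

@[simp] theorem length_bits (u : List Bool) : (bits u).length = u.length := List.length_map _

theorem bits_injective : Function.Injective bits :=
  List.map_injective_iff.2 (Option.some_injective _)

theorem drop_append_of_length_le {α : Type} {l₁ l₂ : List α} {n : ℕ} (h : l₁.length ≤ n) :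
    (l₁ ++ l₂).drop n = l₂.drop (n - l₁.length) := by
  rw [List.drop_append, List.drop_eq_nil_of_le h, List.nil_append]

/-- If `f` is a restriction of a non-trivial element of `𝒢_{3,1}` and changes words only locally,
then `f` moves a short word. -/
theorem LocalMap.exists_short {C : ℕ} {f : List Letter → Option (List Letter)} (h : LocalMap C f)
    {g : BigGroup Letter} (hfg : ∀ x y, f x = some y → y ∈ g.toMap x) (hg : g ≠ 1) :
    ∃ x y, x.length ≤ 6 * C + 10 ∧ f x = some y ∧ y ≠ x := by
  by_contra! hc
  refine hg ?_
  have hdef : ∀ x, EndsHash x → 2 * C ≤ x.length → ∃ y, f x = some y := by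
    intro x hx hl
    rcases C.eq_zero_or_pos with rfl | hC
    · obtain ⟨a, s, y, y', e, -⟩ := h [] x [] [] le_rfl (Nat.zero_le _) hx rfl
      exact ⟨_, by simpa [bits] using e⟩
    · have he : EndsHash (x.drop C) := by
        rw [← List.take_append_drop C x] at hx
        cases hd : x.drop C with
        | nil => rw [List.drop_eq_nil_iff] at hd; omega
        | cons b t => exact EndsHash.of_append (hd ▸ hx)
      obtain ⟨a, s, y, y', e, -⟩ := h (x.take C) (x.drop C) [] [] (by simp; omega) (by simp; omega)
        he rfl
      exact ⟨_, by simpa [bits] using e⟩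
  have key : ∀ n, ∀ x : List Letter, x.length = n → EndsHash x → 2 * C + 1 ≤ x.length →
      f x = some x := by
    intro n
    induction n using Nat.strong_induction_on with
    | _ n ih =>
      intro x hn hx hl
      obtain ⟨v, hv⟩ := hdef x hx (by omega)
      rcases le_or_gt n (6 * C + 10) with hle | hlt
      · rw [hv, hc x v (by omega) hv]
      obtain ⟨t, rfl⟩ := hx
      rw [List.length_append, List.length_singleton] at hn hl
      -- Either only bits occur between position `2C` and the last `#`, or some `#` there closes a
      -- proper prefix of the word.
      by_cases hb : ∃ b : List Bool, t.drop (2 * C) = bits b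
      · obtain ⟨b, hb⟩ := hb
        have hbl : b.length + 2 * C = t.length := by
          have := congrArg List.length hb
          rw [length_bits, List.length_drop] at this
          omega
        obtain ⟨a, ha, rfl⟩ : ∃ a : List Letter, a.length = 2 * C ∧ t = a ++ bits b :=
          ⟨t.take (2 * C), by simp; omega, by rw [← hb, List.take_append_drop]⟩
        -- Deleting the triple `y` gives a shorter word, fixed by induction. The common left part
        -- `a₁` has length at least `2C + |b₁| - C`, which gives the first equality. In the shorter
        -- word the common right part `s₁` starts at position `3C + |b₁|` at the latest; in the
        -- longer word everything there is shifted by 3.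
        have cut : ∀ b₁ y b₂ : List Bool, b = b₁ ++ y ++ b₂ → y.length = 3 → C ≤ b₂.length →
            v.take (C + b₁.length) = (a ++ bits b ++ [none]).take (C + b₁.length) ∧
            v.drop (3 * C + b₁.length + 3) =
              (a ++ bits b ++ [none]).drop (3 * C + b₁.length + 3) := by
          intro b₁ y b₂ hb' hy hb₂
          subst hb'
          obtain ⟨a₁, s₁, r, r', e, e', ha₁, hs₁, -, hr⟩ :=
            h (a ++ bits b₁) (bits b₂ ++ [none]) y [] (by simp; omega) (by simp; omega)
              ⟨bits b₂, rfl⟩ (by simp [hy])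
          simp only [List.length_append, length_bits] at hn
          have h3 := ih (n - 3) (by omega) (a ++ bits b₁ ++ (bits b₂ ++ [none]))
            (by simp; omega) ⟨a ++ bits b₁ ++ bits b₂, by simp⟩ (by simp; omega)
          have e1 : v = a₁ ++ bits r ++ s₁ := by
            rw [← Option.some_inj, ← e, ← hv]; simp [bits]
          have e2 : (a ++ bits b₁) ++ (bits b₂ ++ [none]) = a₁ ++ bits r' ++ s₁ := by
            rw [← Option.some_inj, ← e', ← h3]; simp [bits]
          simp only [List.length_append, length_bits, List.length_nil, List.length_singleton,
            ha] at ha₁ hs₁ hr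
          have l2 := congrArg List.length e2
          simp only [List.length_append, length_bits, List.length_singleton, ha] at l2
          have h5 : a ++ bits (b₁ ++ y ++ b₂) ++ [none] =
            (a ++ bits b₁) ++ (bits y ++ (bits b₂ ++ [none])) := by simp [bits]
          rw [h5]
          constructor
          · have := congrArg (List.take (C + b₁.length)) e2
            rw [List.append_assoc a₁, List.take_append_of_le_length (l₁ := a₁) (by omega),
              List.take_append_of_le_length (l₁ := a ++ bits b₁) (by simp; omega)] at this
            rw [e1, List.append_assoc a₁, List.take_append_of_le_length (l₁ := a₁) (by omega),
              ← this, List.take_append_of_le_length (l₁ := a ++ bits b₁) (by simp; omega)]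
          · have h4 := congrArg (List.drop (3 * C + b₁.length)) e2
            rw [drop_append_of_length_le (l₁ := a ++ bits b₁) (by simp; omega),
              drop_append_of_length_le (l₁ := a₁ ++ bits r') (by simp; omega)] at h4
            rw [e1, drop_append_of_length_le (l₁ := a₁ ++ bits r) (by simp; omega),
              ← List.append_assoc _ (bits y),
              drop_append_of_length_le (l₁ := a ++ bits b₁ ++ bits y) (by simp; omega)]
            convert h4.symm using 2
            · simp; omega
            · simp; omega
        -- Deleting the first triple of `b` fixes the suffix from `3C + 3` on. Deleting the triple
        -- in front of the last `C` bits fixes the prefix of length `|b| - 3`. They cover the word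
        -- because its length exceeds `6C + 10`, so that `|b| ≥ 4C + 10`.
        have h1 := (cut [] (b.take 3) (b.drop 3) (by simp) (by simp; omega) (by simp; omega)).2
        have h2 := (cut (b.take (b.length - C - 3)) ((b.drop (b.length - C - 3)).take 3)
          ((b.drop (b.length - C - 3)).drop 3) (by
            rw [List.append_assoc, List.take_append_drop, List.take_append_drop])
          (by simp; omega) (by simp; omega)).1
        rw [List.length_take, min_eq_left (by omega)] at h2
        have h3 := congrArg (List.drop (C + (b.length - C - 3) - (3 * C + 0 + 3))) h1
        rw [List.length_nil, List.drop_drop, List.drop_drop] at h3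
        rw [show 3 * C + 0 + 3 + (C + (b.length - C - 3) - (3 * C + 0 + 3)) =
          C + (b.length - C - 3) by omega] at h3
        rw [hv, ← List.take_append_drop (C + (b.length - C - 3)) v, h2, h3,
          List.take_append_drop]
      · have hmem : none ∈ t.drop (2 * C) := by
          by_contra hno
          refine hb ?_
          generalize t.drop (2 * C) = l at hno
          induction l with
          | nil => exact ⟨[], rfl⟩
          | cons c l ihl =>
            rw [List.mem_cons, not_or] at hno
            obtain ⟨u, rfl⟩ := ihl hno.2
            cases c with
            | none => exact absurd rfl hno.1
            | some c => exact ⟨c :: u, rfl⟩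
        obtain ⟨u, w, hw⟩ := List.append_of_mem hmem
        have ht : t = (t.take (2 * C) ++ u ++ [none]) ++ w := by
          rw [List.append_assoc, List.append_assoc, List.singleton_append, ← hw,
            List.take_append_drop]
        have hlen := congrArg List.length ht
        simp only [List.length_append, List.length_take, List.length_singleton] at hlen
        -- The prefix up to this `#` is shorter and ends with `#`, so it is fixed; then `g` fixes
        -- all its extensions.
        have h1 := ih (t.take (2 * C) ++ u ++ [none]).length (by simp; omega) _ rfl
          ⟨_, rfl⟩ (by simp; omega)
        have h2 := BigGroup.mem_append (hfg _ _ h1) (w ++ [none])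
        rw [← List.append_assoc, ← ht] at h2
        rw [hv]
        exact congrArg some (Option.mem_unique (hfg _ _ hv) h2)
  refine BigGroup.eq_of_agree fun x => ?_
  -- Every word becomes long enough, and ends with `#`, after `2C + 1` letters `#` are appended.
  refine ⟨List.replicate (2 * C) none ++ [none], _, ?_, BigGroup.mem_one _⟩
  exact hfg _ _ (key _ _ rfl ⟨_, (List.append_assoc _ _ _).symm⟩ (by simp))

/-! ### Elements of `𝒢_{3,1}` that are computed by transducers -/

/-- A restriction of `g` is computed by a transducer that changes words only locally and whose
output is longer than its input by at most a constant. -/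
def Realizes (T : Transducer) (C : ℕ) (g : BigGroup Letter) : Prop :=
  (∀ x y, T.eval x = some y → y ∈ g.toMap x) ∧ LocalMap C T.eval ∧
    ∀ x, (T.run T.init x).2.length ≤ x.length + C

/-- The growth of the output is additive, not multiplicative, so lengths add up linearly along a
product. -/
theorem Realizes.mul {T₁ T₂ : Transducer} {C₁ C₂ : ℕ} {g h : BigGroup Letter}
    (hg : Realizes T₂ C₂ g) (hh : Realizes T₁ C₁ h) : Realizes (T₂.comp T₁) (C₁ + C₂) (g * h) := by
  refine ⟨fun x y hy => ?_, ?_, fun x => ?_⟩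
  · rw [Transducer.eval_comp, Option.bind_eq_some_iff] at hy
    obtain ⟨z, hz, hy⟩ := hy
    exact BigGroup.mem_mul (hh.1 _ _ hz) (hg.1 _ _ hy)
  · convert hh.2.1.comp hg.2.1 using 1
    exact funext (Transducer.eval_comp T₂ T₁)
  · change ((T₂.comp T₁).run (T₁.init, T₂.init) x).2.length ≤ _
    rw [Transducer.run_comp]
    have h1 := hh.2.2 x
    have h2 := hg.2.2 (T₁.run T₁.init x).2
    simp only at h1 h2 ⊢
    omega

/-! ### Transducers for the elements of `G_{3,1}` -/

section Prefix

/-- The words of length at most `N`. -/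
abbrev ShortWord (α : Type) (N : ℕ) : Type := {l : List α // l.length ≤ N}

instance (α : Type) [Finite α] (N : ℕ) : Fintype (ShortWord α N) :=
  (List.finite_length_le α N).fintype

/-- The transducer that replaces the prefix `x` of length `N + 1` by `φ x`. -/
@[reducible] def prefixTransducer (N : ℕ) (φ : List Letter → List Letter) : Transducer where
  S := Option (ShortWord Letter N)
  init := some ⟨[], Nat.zero_le N⟩
  next s a := match s with
    | none => (none, [a])
    | some r => if h : r.1.length < N then (some ⟨r.1 ++ [a], by simpa using h⟩, [])
        else (none, φ (r.1 ++ [a]))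
  final s := match s with
    | none => some []
    | some _ => none

variable (N : ℕ) (φ : List Letter → List Letter)

theorem prefixTransducer_run_none (x : List Letter) :
    (prefixTransducer N φ).run none x = (none, x) := by
  induction x with
  | nil => rfl
  | cons a x ih => rw [Transducer.run_cons]; simp [prefixTransducer] at ih ⊢; simp [ih]

theorem prefixTransducer_run_short (r : ShortWord Letter N) (x : List Letter)
    (hx : r.1.length + x.length ≤ N) : (prefixTransducer N φ).run (some r) x =
      (some ⟨r.1 ++ x, by simpa using hx⟩, []) := by
  induction x generalizing r with
  | nil => simp [Transducer.run_nil]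
  | cons a x ih =>
    rw [List.length_cons] at hx
    have h : r.1.length < N := by omega
    have h1 : (prefixTransducer N φ).next (some r) a =
      (some ⟨r.1 ++ [a], by simpa using h⟩, []) := by simp [prefixTransducer, h]
    rw [Transducer.run_cons, h1, ih _ (by simp; omega)]
    simp

theorem prefixTransducer_run_long (p x : List Letter) (hp : p.length = N + 1) :
    (prefixTransducer N φ).run (prefixTransducer N φ).init (p ++ x) = (none, φ p ++ x) := by
  obtain ⟨r, a, rfl⟩ : ∃ r a, p = r ++ [a] :=
    ⟨p.dropLast, p.getLast (by rintro rfl; simp at hp), (List.dropLast_append_getLast _).symm⟩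
  have hr : r.length = N := by simpa using hp
  rw [List.append_assoc, Transducer.run_append]
  rw [show (prefixTransducer N φ).init = some ⟨[], Nat.zero_le N⟩ from rfl,
    prefixTransducer_run_short N φ _ r (by simp [hr])]
  have h1 : (prefixTransducer N φ).next (some ⟨r, hr.le⟩) a = (none, φ (r ++ [a])) := by
    simp [prefixTransducer, hr]
  simp only [List.nil_append, List.singleton_append]
  rw [Transducer.run_cons, h1, prefixTransducer_run_none]

theorem prefixTransducer_eval_long (p x : List Letter) (hp : p.length = N + 1) :
    (prefixTransducer N φ).eval (p ++ x) = some (φ p ++ x) := by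
  rw [Transducer.eval, Transducer.evalFrom, prefixTransducer_run_long N φ p x hp]
  simp

theorem prefixTransducer_eval_short (x : List Letter) (hx : x.length ≤ N) :
    (prefixTransducer N φ).eval x = none := by
  rw [Transducer.eval, Transducer.evalFrom, show (prefixTransducer N φ).init =
    some ⟨[], Nat.zero_le N⟩ from rfl, prefixTransducer_run_short N φ _ x (by simpa using hx)]
  rfl

end Prefix

/-- Such an element is defined on all words of some length `N`, hence acts on longer words by a
finite table for their prefixes of length `N + 1`. -/
theorem exists_realizes_of_mem_smallGroup {g : BigGroup Letter} (hg : g ∈ smallGroup Letter) :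
    ∃ T C, Realizes T C g := by
  obtain ⟨N, hN⟩ := mem_smallGroup_iff.1 hg
  choose φ hφ using fun p : {p : List Letter // N ≤ p.length} => (hN p.1 p.2).1
  let ψ : List Letter → List Letter := fun p => if h : N ≤ p.length then φ ⟨p, h⟩ else []
  have hψ : ∀ p, N ≤ p.length → ψ p ∈ g.toMap p := fun p hp => by
    simp only [ψ, dif_pos hp]; exact hφ ⟨p, hp⟩
  obtain ⟨B, hB⟩ : ∃ B, ∀ p : List Letter, p.length = N + 1 → (ψ p).length ≤ B := by
    obtain ⟨B, hB⟩ := ((List.finite_length_eq Letter (N + 1)).image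
      fun p => (ψ p).length).bddAbove
    exact ⟨B, fun p hp => hB ⟨p, hp, rfl⟩⟩
  have split : ∀ x : List Letter, N < x.length → ∃ p z, x = p ++ z ∧ p.length = N + 1 :=
    fun x hx => ⟨x.take (N + 1), x.drop (N + 1), by simp, by simp; omega⟩
  -- Locality costs the length `N + 1` of the replaced prefix; `B` bounds the entries of the table,
  -- hence the growth of the output.
  refine ⟨prefixTransducer N ψ, N + 1 + B, fun x y hy => ?_, ?_, fun x => ?_⟩
  · rcases le_or_gt x.length N with h | h
    · rw [prefixTransducer_eval_short N ψ x h] at hy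
      cases hy
    · obtain ⟨p, z, rfl, hp⟩ := split x h
      rw [prefixTransducer_eval_long N ψ p z hp] at hy
      obtain rfl := Option.some_inj.1 hy
      exact BigGroup.mem_append (hψ p (by omega)) z
  · refine LocalMap.mono (C := N + 1) ?_ (by omega)
    intro a s y y' ha _ he hy
    obtain ⟨p, z, rfl, hp⟩ := split a ha
    refine ⟨ψ p ++ z, s, y, y', ?_, ?_, by simp; omega, by omega, he, by omega⟩
    · simp only [List.append_assoc]; exact prefixTransducer_eval_long N ψ p _ hp
    · simp only [List.append_assoc]; exact prefixTransducer_eval_long N ψ p _ hp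
  · rcases le_or_gt x.length N with h | h
    · rw [show (prefixTransducer N ψ).init = some ⟨[], Nat.zero_le N⟩ from rfl,
        prefixTransducer_run_short N ψ _ x (by simpa using h)]
      simp
    · obtain ⟨p, z, rfl, hp⟩ := split x h
      rw [prefixTransducer_run_long N ψ p z hp]
      have := hB p hp
      simp only [List.length_append]
      omega

/-! ### Transducers for the elements `κ_i` -/

section Kappa

/-- The transducer that computes `κ_i`. -/
@[reducible] def kappaTransducer (i : ℕ) : Transducer where
  S := Option (Fin (i + 1) × ShortWord Bool 2)
  init := some (Fin.last i, ⟨[], Nat.zero_le 2⟩)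
  next s a := match s, a with
    | none, a => (none, [a])
    | some s, none => (none, bits s.2.1 ++ [none])
    | some s, some b =>
        if s.1.1 ≠ 0 then (some (⟨s.1.1 - 1, by omega⟩, s.2), [some b])
        else if h : s.2.1.length < 2 then (some (s.1, ⟨s.2.1 ++ [b], by simpa using h⟩), [])
        else (some (s.1, ⟨[], Nat.zero_le 2⟩), bits (rotTriples (s.2.1 ++ [b])))
  final s := match s with
    | none => some []
    | some _ => none

variable (i : ℕ)

theorem kappaTransducer_evalFrom_none (x : List Letter) :
    (kappaTransducer i).evalFrom none x = some x := by
  induction x with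
  | nil => rfl
  | cons a x ih =>
    rw [Transducer.evalFrom_cons]
    simp [kappaTransducer] at ih ⊢
    simp [ih]

/-- Once the counter is 0, the state stores the bits `l` of an incomplete triple, so the result is
as if `l` were still in front of the input. -/
theorem kappaTransducer_evalFrom_rot (l : ShortWord Bool 2) (u : List Bool) (w : List Letter) :
    (kappaTransducer i).evalFrom (some (0, l)) (bits u ++ none :: w) =
      some (bits (rotTriples (l.1 ++ u)) ++ none :: w) := by
  induction u generalizing l with
  | nil =>
    have h1 : (kappaTransducer i).next (some (0, l)) none = (none, bits l.1 ++ [none]) := rfl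
    have h2 : rotTriples l.1 = l.1 := by
      obtain ⟨l, hl⟩ := l
      match l, hl with
      | [], _ => rfl
      | [_], _ => rfl
      | [_, _], _ => rfl
      | a :: b :: c :: t, hl => simp at hl
    simp [bits, Transducer.evalFrom_cons, kappaTransducer_evalFrom_none, h2]
  | cons b u ih =>
    have h0 : bits (b :: u) ++ none :: w = some b :: (bits u ++ none :: w) := rfl
    by_cases h : l.1.length < 2
    · have h1 : (kappaTransducer i).next (some (0, l)) (some b) =
        (some (0, ⟨l.1 ++ [b], by simpa using h⟩), []) := by simp [kappaTransducer, h]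
      rw [h0, Transducer.evalFrom_cons, h1, ih]
      simp
    · have h1 : (kappaTransducer i).next (some (0, l)) (some b) =
        (some (0, ⟨[], Nat.zero_le 2⟩), bits (rotTriples (l.1 ++ [b]))) := by
          simp [kappaTransducer, h]
      rw [h0, Transducer.evalFrom_cons, h1, ih]
      obtain ⟨l, hl⟩ := l
      obtain ⟨c, d, rfl⟩ := List.length_eq_two.1 (le_antisymm hl (not_lt.1 h))
      simp [rotTriples, bits]

theorem permBits_cons {α : Type} (j : ℕ) (b : α) (u : List α) :
    permBits (j + 1) (b :: u) = b :: permBits j u := by simp [permBits]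

theorem kappaTransducer_evalFrom (j : Fin (i + 1)) (u : List Bool) (w : List Letter) :
    (kappaTransducer i).evalFrom (some (j, ⟨[], Nat.zero_le 2⟩)) (bits u ++ none :: w) =
      some (bits (permBits j u) ++ none :: w) := by
  induction u generalizing j with
  | nil =>
    have h1 : (kappaTransducer i).next (some (j, ⟨[], Nat.zero_le 2⟩)) none = (none, [none]) := rfl
    simp [bits, Transducer.evalFrom_cons, kappaTransducer_evalFrom_none, permBits, rotTriples]
  | cons b u ih =>
    by_cases hj : j.1 = 0
    · have : j = 0 := Fin.ext hj
      rw [this, kappaTransducer_evalFrom_rot]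
      simp [permBits]
    · have h1 : (kappaTransducer i).next (some (j, ⟨[], Nat.zero_le 2⟩)) (some b) =
          (some (⟨j.1 - 1, by omega⟩, ⟨[], Nat.zero_le 2⟩), [some b]) := by
        simp [kappaTransducer, hj]
      rw [show bits (b :: u) ++ none :: w = some b :: (bits u ++ none :: w) from rfl,
        Transducer.evalFrom_cons, h1, ih]
      obtain ⟨m, hm⟩ := Nat.exists_eq_succ_of_ne_zero hj
      simp [hm, permBits_cons, bits]

theorem kappaTransducer_eval (u : List Bool) (w : List Letter) :
    (kappaTransducer i).eval (bits u ++ none :: w) = some (bits (permBits i u) ++ none :: w) :=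
  kappaTransducer_evalFrom i (Fin.last i) u w

theorem kappaTransducer_evalFrom_bits (s : Fin (i + 1) × ShortWord Bool 2) (u : List Bool) :
    (kappaTransducer i).evalFrom (some s) (bits u) = none := by
  induction u generalizing s with
  | nil => rfl
  | cons b u ih =>
    have h1 : ∃ s', ((kappaTransducer i).next (some s) (some b)).1 = some s' := by
      simp only [kappaTransducer]
      split_ifs <;> exact ⟨_, rfl⟩
    obtain ⟨s', hs'⟩ := h1
    rw [show bits (b :: u) = some b :: bits u from rfl, Transducer.evalFrom_cons, hs', ih]
    rfl

theorem bits_or_hash (x : List Letter) :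
    (∃ u, x = bits u) ∨ ∃ u w, x = bits u ++ none :: w := by
  induction x with
  | nil => exact Or.inl ⟨[], rfl⟩
  | cons a x ih =>
    cases a with
    | none => exact Or.inr ⟨[], x, rfl⟩
    | some b =>
      rcases ih with ⟨u, rfl⟩ | ⟨u, w, rfl⟩
      · exact Or.inl ⟨b :: u, rfl⟩
      · exact Or.inr ⟨b :: u, w, rfl⟩

/-- The number of letters that have been read but not written. -/
def pending : Option (Fin (i + 1) × ShortWord Bool 2) → ℕ
  | none => 0
  | some s => s.2.1.length

theorem length_rotTriples {α : Type} (l : List α) : (rotTriples l).length = l.length := by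
  fun_induction rotTriples l with
  | case1 a b c t ih => simp [ih]
  | case2 l h => rfl

/-- A potential argument: the letters written plus the letters pending increase by at most one for
each letter read. -/
theorem kappaTransducer_run_length (s : Option (Fin (i + 1) × ShortWord Bool 2))
    (x : List Letter) :
    ((kappaTransducer i).run s x).2.length ≤ x.length + pending i s := by
  induction x generalizing s with
  | nil => simp [Transducer.run_nil]
  | cons a x ih =>
    have h1 : ((kappaTransducer i).next s a).2.length +
        pending i ((kappaTransducer i).next s a).1 ≤ 1 + pending i s := by
      rcases s with _ | s
      · simp [pending]
      · rcases a with _ | b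
        · simp [pending]
        · simp only
          split_ifs with h1 h2
          · simp [pending]
          · simp [pending]
          · simp [pending, length_rotTriples]
    have h2 := ih ((kappaTransducer i).next s a).1
    have h3 := congrArg (fun r => r.2.length) (Transducer.run_cons (kappaTransducer i) s a x)
    rw [List.length_append] at h3
    rw [h3, List.length_cons]
    omega

theorem rotTriples_append {α : Type} (l r : List α) (h : 3 ∣ l.length) :
    rotTriples (l ++ r) = rotTriples l ++ rotTriples r := by
  fun_induction rotTriples l with
  | case1 a b c t ih =>
    rw [List.length_cons, List.length_cons, List.length_cons] at h
    simp only [List.cons_append, rotTriples]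
    rw [ih (by omega)]
  | case2 l hl =>
    match l, hl with
    | [], _ => rfl
    | [_], _ => simp at h
    | [_, _], _ => simp at h
    | a :: b :: c :: t, hl => exact absurd rfl (hl a b c t)

/-- If `a` contains `#`, the map acts inside `a`. Otherwise enlarge `y` on both sides by at most two
bits, so that the enlarged factor begins and ends at boundaries of triples. The same enlargement
works for `y'`, since the lengths agree modulo 3, and the rotation acts separately on the three
pieces. -/
theorem localMap_kappaTransducer : LocalMap (i + 2) (kappaTransducer i).eval := by
  intro a s y y' ha hs he hy
  rcases bits_or_hash a with ⟨u, rfl⟩ | ⟨u, w, rfl⟩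
  · obtain ⟨t, rfl⟩ := he
    obtain ⟨v, w, hv⟩ := exists_eq_joinHash t
    rw [length_bits] at ha
    rw [hv] at hs ⊢
    have he' : EndsHash (none :: w) := EndsHash.of_append ⟨t, hv.symm⟩
    -- The cut is at the last triple boundary inside `a`; it lies beyond the `i` fixed bits because
    -- `|a| ≥ i + 2`.
    obtain ⟨u₀, u₁, rfl, hu₀, hu₁⟩ : ∃ u₀ u₁, u = u₀ ++ u₁ ∧ i ≤ u₀.length ∧
        (u₀.length - i) % 3 = 0 ∧ u₁.length ≤ 2 := by
      refine ⟨u.take (u.length - (u.length - i) % 3), u.drop (u.length - (u.length - i) % 3),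
        by simp, ?_, ?_, ?_⟩
      · simp; omega
      · simp; omega
      · simp; omega
    -- Modulo 3, twice a length is its negative, so `v₀` completes the last triple, unless the bits
    -- end before that; then `v₁` is empty.
    obtain ⟨v₀, v₁, rfl, hv₀, hv₁⟩ : ∃ v₀ v₁, v = v₀ ++ v₁ ∧ v₀.length ≤ 2 ∧
        ((u₁.length + y.length + v₀.length) % 3 = 0 ∨ v₁ = []) := by
      refine ⟨v.take ((2 * (u₁.length + y.length)) % 3), v.drop ((2 * (u₁.length + y.length)) % 3),
        by simp, ?_, ?_⟩
      · simp; omega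
      · rcases le_or_gt v.length ((2 * (u₁.length + y.length)) % 3) with h | h
        · exact Or.inr (List.drop_of_length_le h)
        · left; simp; omega
    have hperm : ∀ z : List Bool, z.length % 3 = y.length % 3 →
        permBits i (u₀ ++ u₁ ++ z ++ (v₀ ++ v₁)) =
          permBits i u₀ ++ rotTriples (u₁ ++ z ++ v₀) ++ rotTriples v₁ := by
      intro z hz
      have e1 : u₀ ++ u₁ ++ z ++ (v₀ ++ v₁) = u₀ ++ ((u₁ ++ z ++ v₀) ++ v₁) := by simp
      rw [e1, permBits, permBits, List.take_append_of_le_length hu₀,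
        List.drop_append_of_le_length hu₀, rotTriples_append (u₀.drop i) _ (by simp; omega)]
      have e2 : rotTriples (u₁ ++ z ++ v₀ ++ v₁) = rotTriples (u₁ ++ z ++ v₀) ++ rotTriples v₁ := by
        rcases hv₁ with h | rfl
        · exact rotTriples_append _ _ (by simp; omega)
        · simp [rotTriples]
      rw [e2]
      simp
    refine ⟨bits (permBits i u₀), bits (rotTriples v₁) ++ none :: w, rotTriples (u₁ ++ y ++ v₀),
      rotTriples (u₁ ++ y' ++ v₀), ?_, ?_, ?_, ?_, he'.append _, ?_⟩
    · have h1 := kappaTransducer_eval i (u₀ ++ u₁ ++ y ++ (v₀ ++ v₁)) w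
      rw [hperm y rfl] at h1
      simpa [bits_append] using h1
    · have h1 := kappaTransducer_eval i (u₀ ++ u₁ ++ y' ++ (v₀ ++ v₁)) w
      rw [hperm y' hy.symm] at h1
      simpa [bits_append] using h1
    · simp [permBits, length_rotTriples]; omega
    · simp [length_rotTriples]; omega
    · simp [length_rotTriples]; omega
  · refine ⟨bits (permBits i u) ++ none :: w, s, y, y', ?_, ?_, ?_, by omega, he, by omega⟩
    · simpa using kappaTransducer_eval i u (w ++ (bits y ++ s))
    · simpa using kappaTransducer_eval i u (w ++ (bits y' ++ s))
    · simp [permBits, length_rotTriples]; omega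

theorem mem_kappa (u : List Bool) (w : List Letter) :
    bits (permBits i u) ++ none :: w ∈ (kappa i).toMap (bits u ++ none :: w) :=
  BigGroup.mem_ofIso _ (mem_kappaMap.2 ⟨u, w, rfl, rfl⟩)

theorem realizes_kappa : Realizes (kappaTransducer i) (i + 2) (kappa i) := by
  refine ⟨fun x y hy => ?_, localMap_kappaTransducer i, fun x => ?_⟩
  · rcases bits_or_hash x with ⟨u, rfl⟩ | ⟨u, w, rfl⟩
    · rw [Transducer.eval, show (kappaTransducer i).init =
        some (Fin.last i, ⟨[], Nat.zero_le 2⟩) from rfl, kappaTransducer_evalFrom_bits] at hy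
      cases hy
    · rw [kappaTransducer_eval] at hy
      obtain rfl := Option.some_inj.1 hy
      exact mem_kappa i u w
  · have h1 := kappaTransducer_run_length i (some (Fin.last i, ⟨[], Nat.zero_le 2⟩)) x
    refine h1.trans ?_
    simp [pending]

theorem rotTriples_rotTriples_rotTriples {α : Type} (l : List α) :
    rotTriples (rotTriples (rotTriples l)) = l := by
  fun_induction rotTriples l with
  | case1 a b c t ih => simp [rotTriples, ih]
  | case2 l h =>
    match l, h with
    | [], _ => rfl
    | [_], _ => rfl
    | [_, _], _ => rfl
    | a :: b :: c :: t, h => exact absurd rfl (h a b c t)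

theorem permBits_permBits_permBits {α : Type} (u : List α) :
    permBits i (permBits i (permBits i u)) = u := by
  induction i generalizing u with
  | zero => simpa [permBits] using rotTriples_rotTriples_rotTriples u
  | succ i ih =>
    cases u with
    | nil => rfl
    | cons b u => rw [permBits_cons, permBits_cons, permBits_cons, ih]

/-- Rotating triples has order three, so inverses need no transducers of their own. -/
theorem kappa_inv : (kappa i)⁻¹ = kappa i * kappa i := by
  rw [inv_eq_iff_mul_eq_one]
  refine BigGroup.eq_of_agree fun x => ?_
  obtain ⟨u, w, h⟩ := exists_eq_joinHash x
  refine ⟨[none], _, ?_, BigGroup.mem_one _⟩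
  rw [h]
  have h1 := BigGroup.mem_mul (BigGroup.mem_mul (mem_kappa i u w) (mem_kappa i _ w))
    (mem_kappa i _ w)
  rwa [permBits_permBits_permBits] at h1

end Kappa

theorem inv_mem_smallGroup {A : Type} {g : BigGroup A} (hg : g ∈ smallGroup A) :
    g⁻¹ ∈ smallGroup A := by
  refine ⟨?_, ?_⟩
  · change IsFinGenIdeal (dom g.1.symm); rw [dom_symm]; exact hg.2
  · change IsFinGenIdeal (im g.1.symm); rw [im_symm]; exact hg.1

/-- Transducers compose but are not inverted, so the induction over the subgroup treats `g` and
`g⁻¹` together. -/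
theorem exists_realizes {g : BigGroup Letter} (hg : g ∈ groupK012) : ∃ T C, Realizes T C g := by
  suffices h : (∃ T C, Realizes T C g) ∧ ∃ T C, Realizes T C g⁻¹ from h.1
  have hk : ∀ i, (∃ T C, Realizes T C (kappa i)) ∧ ∃ T C, Realizes T C (kappa i)⁻¹ := by
    refine fun i => ⟨⟨_, _, realizes_kappa i⟩, ?_⟩
    rw [kappa_inv]
    exact ⟨_, _, (realizes_kappa i).mul (realizes_kappa i)⟩
  induction hg using Subgroup.closure_induction with
  | mem g hg =>
    rcases hg with hg | rfl | rfl | rfl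
    · exact ⟨exists_realizes_of_mem_smallGroup hg,
        exists_realizes_of_mem_smallGroup (inv_mem_smallGroup hg)⟩
    all_goals exact hk _
  | one =>
    have h : (1 : BigGroup Letter) ∈ smallGroup Letter :=
      mem_smallGroup_iff.2 ⟨0, fun x _ => ⟨⟨x, rfl⟩, x, rfl⟩⟩
    exact ⟨exists_realizes_of_mem_smallGroup h,
        exists_realizes_of_mem_smallGroup (inv_mem_smallGroup h)⟩
  | mul g h _ _ hg hh =>
    obtain ⟨⟨T₁, C₁, h₁⟩, T₁', C₁', h₁'⟩ := hg
    obtain ⟨⟨T₂, C₂, h₂⟩, T₂', C₂', h₂'⟩ := hh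
    exact ⟨⟨_, _, h₁.mul h₂⟩, by rw [mul_inv_rev]; exact ⟨_, _, h₂'.mul h₁'⟩⟩
  | inv g _ hg => exact ⟨hg.2, by rw [inv_inv]; exact hg.1⟩

/-! ### Words over elements computed by transducers -/

section Words

variable {k : ℕ} (T : Fin k × Bool → Transducer)

/-- Apply the transducers given by the letters of a word one after the other, the rightmost
first. -/
def wordEval : List (Fin k × Bool) → List Letter → Option (List Letter)
  | [], x => some x
  | p :: w, x => (wordEval w x).bind (T p).eval

variable {T} {s : Fin k → BigGroup Letter} {C : ℕ}

theorem wordEval_mem_wordComp (hT : ∀ p, Realizes (T p) C (letterVal s p))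
    (w : List (Fin k × Bool)) {x y : List Letter} (h : wordEval T w x = some y) :
    y ∈ wordComp s w x := by
  induction w generalizing y with
  | nil => exact h
  | cons p w ih =>
    rw [wordEval, Option.bind_eq_some_iff] at h
    obtain ⟨z, hz, hy⟩ := h
    exact (PEquiv.mem_trans _ _ _ _).2 ⟨z, ih hz, (hT p).1 _ _ hy⟩

theorem mem_wordVal_of_mem_wordComp (w : List (Fin k × Bool)) {x y : List Letter}
    (h : y ∈ wordComp s w x) : y ∈ (wordVal s w).toMap x := by
  induction w generalizing y with
  | nil => exact h
  | cons p w ih =>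
    obtain ⟨z, hz, hy⟩ := (PEquiv.mem_trans _ _ _ _).1 h
    rw [wordVal, List.map_cons, List.prod_cons]
    exact BigGroup.mem_mul (ih hz) hy

theorem localMap_wordEval (hT : ∀ p, Realizes (T p) C (letterVal s p))
    (w : List (Fin k × Bool)) : LocalMap (w.length * C) (wordEval T w) := by
  induction w with
  | nil =>
    rw [List.length_nil, Nat.zero_mul]
    exact localMap_some
  | cons p w ih =>
    have h := ih.comp (hT p).2.1
    rw [List.length_cons, add_mul, one_mul]
    exact h

theorem exists_short_wordEval (hT : ∀ p, Realizes (T p) C (letterVal s p))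
    {w : List (Fin k × Bool)} (hw : wordVal s w ≠ 1) :
    ∃ x y, x.length ≤ 6 * (w.length * C) + 10 ∧ wordEval T w x = some y ∧ y ≠ x :=
  (localMap_wordEval hT w).exists_short
    (fun _ _ h => mem_wordVal_of_mem_wordComp w (wordEval_mem_wordComp hT w h)) hw

theorem exists_transducers (hs : ∀ i, s i ∈ groupK012) :
    ∃ (T : Fin k × Bool → Transducer) (C : ℕ), ∀ p, Realizes (T p) C (letterVal s p) := by
  have h : ∀ p : Fin k × Bool, ∃ T C, Realizes T C (letterVal s p) := by
    intro p
    apply exists_realizes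
    unfold letterVal
    split_ifs
    exacts [hs _, inv_mem (hs _)]
  choose T C hTC using h
  refine ⟨T, Finset.univ.sup C, fun p => ?_⟩
  have hle : C p ≤ Finset.univ.sup C := Finset.le_sup (Finset.mem_univ p)
  exact ⟨(hTC p).1, (hTC p).2.1.mono hle, fun x => ((hTC p).2.2 x).trans (by omega)⟩

theorem exists_linear_witness (hs : ∀ i, s i ∈ groupK012) :
    ∃ c : ℕ, ∀ w : List (Fin k × Bool), wordVal s w ≠ 1 →
      ∃ x y : List Letter, x.length ≤ c * w.length ∧
        y ∈ wordComp s w x ∧ y ∈ (wordVal s w).toMap x ∧ y ≠ x := by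
  obtain ⟨T, C, hT⟩ := exists_transducers hs
  -- A word that is not the identity has at least one letter, so the additive 10 is absorbed into
  -- the linear term.
  refine ⟨6 * C + 10, fun w hw => ?_⟩
  obtain ⟨x, y, hl, hy, hne⟩ := exists_short_wordEval hT hw
  have hy' := wordEval_mem_wordComp hT w hy
  refine ⟨x, y, ?_, hy', mem_wordVal_of_mem_wordComp w hy', hne⟩
  have h0 : 1 ≤ w.length := by
    cases w with
    | nil => exact absurd rfl hw
    | cons p w => simp
  nlinarith

end Words

/-! ### A Turing machine that verifies witnesses -/

/-- Decode a bit string as a word over `{0,1,#}`: a letter is given by two bits. -/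
def decodeLetters : List Bool → List Letter
  | b :: c :: t => (if b then none else some c) :: decodeLetters t
  | _ => []

theorem exists_decodeLetters (x : List Letter) :
    ∃ c, c.length = 2 * x.length ∧ decodeLetters c = x := by
  induction x with
  | nil => exact ⟨[], rfl, rfl⟩
  | cons a x ih =>
    obtain ⟨c, hc, rfl⟩ := ih
    refine ⟨a.isNone :: a.getD false :: c, by simp [hc]; omega, ?_⟩
    cases a <;> simp [decodeLetters]

/-- The relation that is decided by the machine: the word `w` moves the word given by `c`. -/
def verifies {k : ℕ} (T : Fin k × Bool → Transducer) (p : List (Fin k × Bool) × List Bool) :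
    Bool :=
  -- The machine pushes the decoded letters on a stack, from which they are read in reverse order.
  match wordEval T p.1 (decodeLetters p.2).reverse with
  | none => false
  | some y => y ≠ (decodeLetters p.2).reverse

namespace Verifier

/-- The stacks: the input, the word over the generators that remains to be applied, the current
word over `{0,1,#}`, a buffer for the output of a transducer, a copy of the given word over
`{0,1,#}`, and the output. -/
inductive Stack
  | inp | prog | word | buf | orig | out
  deriving DecidableEq

instance : Fintype Stack :=
  ⟨{.inp, .prog, .word, .buf, .orig, .out}, fun a => by cases a <;> decide⟩

/-- The labels: read the input, take the next generator, run its transducer, move its output back,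
compare the result with the given word, and clear the stacks. -/
inductive Label
  | read | next | run | back | cmp | clean
  deriving DecidableEq

instance : Fintype Label :=
  ⟨{.read, .next, .run, .back, .cmp, .clean}, fun a => by cases a <;> decide⟩

variable {k : ℕ} (T : Fin k × Bool → Transducer)

/-- The stack alphabets. -/
@[reducible] def Γ (k : ℕ) : Stack → Type
  | .inp | .prog => (Fin k × Bool) ⊕ Bool
  | .word | .buf | .orig => Letter
  | .out => Bool

/-- The internal states: the last symbols that were read from the stacks, the first of the two bits
of a letter, the state of a transducer, a flag and the answer. -/
structure State where
  /-- the last input symbol -/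
  inp : Option ((Fin k × Bool) ⊕ Bool) := none
  /-- the first of the two bits that encode a letter -/
  bit : Option Bool := none
  /-- the state of the current transducer -/
  cur : Option (Σ p, (T p).S) := none
  /-- the last letter from the current word or the buffer -/
  ltr : Option Letter := none
  /-- the last letter from the given word -/
  orig : Option Letter := none
  /-- whether one of the stacks was not empty -/
  busy : Bool := false
  /-- the answer -/
  ans : Bool := false

instance : Fintype (State T) :=
  letI := fun p => (T p).finS
  Fintype.ofInjective (fun v : State T => (v.inp, v.bit, v.cur, v.ltr, v.orig, v.busy, v.ans)) (by
    rintro ⟨⟩ ⟨⟩ h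
    simpa using h)

open TM2.Stmt

/-- The statements of the machine. -/
abbrev Stm := TM2.Stmt (Γ k) Label (State T)

/-- The configurations of the machine. -/
abbrev Config := TM2.Cfg (Γ k) Label (State T)

variable {T}

/-- Push a word of length at most `n` to a stack, the first letter first. -/
def pushList {σ : Type} (a : Stack) (d : Γ k a) :
    ℕ → (σ → List (Γ k a)) → TM2.Stmt (Γ k) Label σ → TM2.Stmt (Γ k) Label σ
  | 0, _, q => q
  | n + 1, f, q => branch (fun v => (f v).isEmpty) q
      (push a (fun v => (f v).headD d) (pushList a d n (fun v => (f v).tail) q))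

theorem stepAux_pushList {σ : Type} (a : Stack) (d : Γ k a) (n : ℕ) (f : σ → List (Γ k a))
    (q : TM2.Stmt (Γ k) Label σ) (v : σ) (S : ∀ a, List (Γ k a)) (h : (f v).length ≤ n) :
    TM2.stepAux (pushList a d n f q) v S =
      TM2.stepAux q v (Function.update S a ((f v).reverse ++ S a)) := by
  induction n generalizing f S with
  | zero =>
    rw [List.eq_nil_of_length_eq_zero (Nat.le_zero.1 h)]
    simp [pushList]
  | succ n ih =>
    rw [pushList, TM2.stepAux]
    cases hf : f v with
    | nil => simp
    | cons b l =>
      rw [hf, List.length_cons] at h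
      rw [List.isEmpty_cons, cond_false, TM2.stepAux, ih _ _ (by simp [hf]; omega)]
      simp [hf]

variable (T)

/-- The output of the current transducer when it reads the last letter. -/
def outNext (v : State T) : List Letter :=
  match v.cur, v.ltr with
  | some ⟨p, s⟩, some a => ((T p).next s a).2
  | _, _ => []

/-- The output of the current transducer at the end of the word. -/
def outFinal (v : State T) : Option (List Letter) :=
  v.cur.bind fun s => (T s.1).final s.2

/-- The next state of the current transducer when it reads the last letter. -/
def nextState (v : State T) : Option (Σ p, (T p).S) :=
  match v.cur, v.ltr with
  | some ⟨p, s⟩, some a => some ⟨p, ((T p).next s a).1⟩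
  | _, _ => none

/-- The letter that is given by the stored bit and the last input symbol. -/
def inputLetter (v : State T) : Letter :=
  if v.bit.getD false then none else some ((v.inp.bind Sum.getRight?).getD false)

/-- The program of the machine; `n` is a bound for the length of the words that are written by the
transducers in one step. -/
def program (n : ℕ) : Label → Stm T
  | .read =>
    pop .inp (fun v o => { v with inp := o }) <|
    branch (fun v => v.inp.isNone) (goto fun _ => .next) <|
    branch (fun v => (v.inp.bind Sum.getLeft?).isSome)
      (push .prog (fun v => v.inp.getD (Sum.inr false)) <| goto fun _ => .read) <|
    branch (fun v => v.bit.isNone)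
      (load (fun v => { v with bit := v.inp.bind Sum.getRight? }) <| goto fun _ => .read) <|
    push .word (inputLetter T) <| push .orig (inputLetter T) <|
    load (fun v => { v with bit := none }) <| goto fun _ => .read
  -- Reading the input has left the last generator on top of this stack, so the rightmost one is
  -- applied first.
  | .next =>
    pop .prog (fun v o => { v with cur := (o.bind Sum.getLeft?).map fun p => ⟨p, (T p).init⟩ }) <|
    branch (fun v => v.cur.isNone) (goto fun _ => .cmp) (goto fun _ => .run)
  | .run =>
    pop .word (fun v o => { v with ltr := o }) <|
    branch (fun v => v.ltr.isNone)
      (branch (fun v => (outFinal T v).isNone)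
        (load (fun v => { v with ans := false }) <| goto fun _ => .clean)
        (pushList .buf none n (fun v => (outFinal T v).getD []) <| goto fun _ => .back)) <|
    pushList .buf none n (outNext T) <| load (fun v => { v with cur := nextState T v }) <|
    goto fun _ => .run
  -- The buffer holds the output in reverse; moving it back restores the order.
  | .back =>
    pop .buf (fun v o => { v with ltr := o }) <|
    branch (fun v => v.ltr.isNone) (goto fun _ => .next) <|
    push .word (fun v => v.ltr.getD none) <| goto fun _ => .back
  | .cmp =>
    pop .word (fun v o => { v with ltr := o }) <| pop .orig (fun v o => { v with orig := o }) <|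
    branch (fun v => v.ltr ≠ v.orig)
      (load (fun v => { v with ans := true }) <| goto fun _ => .clean) <|
    branch (fun v => v.ltr.isNone)
      (load (fun v => { v with ans := false }) <| goto fun _ => .clean) <|
    goto fun _ => .cmp
  -- A computation has to end with the initial internal state and with all stacks but the output
  -- empty. Each round pops one symbol from every remaining stack and repeats if it found any.
  | .clean =>
    load (fun v => { v with busy := false }) <|
    pop .prog (fun v o => { v with busy := v.busy || o.isSome }) <|
    pop .word (fun v o => { v with busy := v.busy || o.isSome }) <|
    pop .buf (fun v o => { v with busy := v.busy || o.isSome }) <|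
    pop .orig (fun v o => { v with busy := v.busy || o.isSome }) <|
    branch (fun v => v.busy) (goto fun _ => .clean) <|
    push .out (fun v => v.ans) <| load (fun _ => {}) halt

/-- The stacks with the given contents. -/
def contents (i p : List ((Fin k × Bool) ⊕ Bool)) (w b o : List Letter) (u : List Bool) :
    ∀ a, List (Γ k a)
  | .inp => i
  | .prog => p
  | .word => w
  | .buf => b
  | .orig => o
  | .out => u

section Update

variable (i p : List ((Fin k × Bool) ⊕ Bool)) (w b o : List Letter) (u : List Bool)

theorem update_inp (l) : Function.update (contents i p w b o u) .inp l = contents l p w b o u := by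
  funext a; cases a <;> rfl

theorem update_prog (l) : Function.update (contents i p w b o u) .prog l = contents i l w b o u := by
  funext a; cases a <;> rfl

theorem update_word (l) : Function.update (contents i p w b o u) .word l = contents i p l b o u := by
  funext a; cases a <;> rfl

theorem update_buf (l) : Function.update (contents i p w b o u) .buf l = contents i p w l o u := by
  funext a; cases a <;> rfl

theorem update_orig (l) : Function.update (contents i p w b o u) .orig l = contents i p w b l u := by
  funext a; cases a <;> rfl

theorem update_out (l) : Function.update (contents i p w b o u) .out l = contents i p w b o l := by
  funext a; cases a <;> rfl

theorem contents_inp : contents i p w b o u .inp = i := rfl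
theorem contents_prog : contents i p w b o u .prog = p := rfl
theorem contents_word : contents i p w b o u .word = w := rfl
theorem contents_buf : contents i p w b o u .buf = b := rfl
theorem contents_orig : contents i p w b o u .orig = o := rfl
theorem contents_out : contents i p w b o u .out = u := rfl

end Update

/-- The machine gets from `c` to `d` in at most `m` steps. -/
def Reach (n m : ℕ) (c d : Config T) : Prop :=
  Nonempty (StateTransition.EvalsToInTime (TM2.step (program T n)) c (some d) m)

variable {T} {n : ℕ}

theorem Reach.refl (c : Config T) : Reach T n 0 c c :=
  ⟨StateTransition.EvalsToInTime.refl _ _⟩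

theorem Reach.trans {m m' : ℕ} {c d e : Config T} (h : Reach T n m c d) (h' : Reach T n m' d e) :
    Reach T n (m + m') c e := by
  obtain ⟨h⟩ := h
  obtain ⟨h'⟩ := h'
  rw [add_comm]
  exact ⟨StateTransition.EvalsToInTime.trans _ _ _ _ _ _ h h'⟩

theorem Reach.mono {m m' : ℕ} {c d : Config T} (h : Reach T n m c d) (hm : m ≤ m') :
    Reach T n m' c d := by
  obtain ⟨h⟩ := h
  exact ⟨⟨h.1, h.2.trans hm⟩⟩

theorem Reach.step {l : Label} {v : State T} {S : ∀ a, List (Γ k a)} {d : Config T}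
    (h : TM2.stepAux (program T n l) v S = d) : Reach T n 1 ⟨some l, v, S⟩ d :=
  ⟨⟨⟨1, congrArg some h⟩, le_rfl⟩⟩

theorem Reach.head {m : ℕ} {l : Label} {v : State T} {S : ∀ a, List (Γ k a)} {d e : Config T}
    (h : TM2.stepAux (program T n l) v S = d) (h' : Reach T n m d e) :
    Reach T n (m + 1) ⟨some l, v, S⟩ e := by
  rw [add_comm]
  exact (Reach.step h).trans h'

/-- The machine halts with the given answer in at most `m` steps, all other stacks being empty. -/
def Halts (n m : ℕ) (c : Config T) (r : Bool) : Prop :=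
  Reach T n m c ⟨none, {}, contents [] [] [] [] [] [r]⟩

/-- Each round shortens every non-empty stack by one; the extra step is the round that finds all of
them empty. -/
theorem halts_clean (m : ℕ) (v : State T) (p : List ((Fin k × Bool) ⊕ Bool)) (w b o : List Letter)
    (hp : p.length ≤ m) (hw : w.length ≤ m) (hb : b.length ≤ m) (ho : o.length ≤ m) :
    Halts n (m + 1) ⟨some .clean, v, contents [] p w b o []⟩ v.ans := by
  induction m generalizing v p w b o with
  | zero =>
    obtain rfl := List.eq_nil_of_length_eq_zero (Nat.le_zero.1 hp)
    obtain rfl := List.eq_nil_of_length_eq_zero (Nat.le_zero.1 hw)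
    obtain rfl := List.eq_nil_of_length_eq_zero (Nat.le_zero.1 hb)
    obtain rfl := List.eq_nil_of_length_eq_zero (Nat.le_zero.1 ho)
    refine Reach.step ?_
    simp [program, update_prog, update_word, update_buf, update_orig, update_out, contents_prog,
      contents_word, contents_buf, contents_orig, contents_out]
  | succ m ih =>
    by_cases he : p = [] ∧ w = [] ∧ b = [] ∧ o = []
    · obtain ⟨rfl, rfl, rfl, rfl⟩ := he
      exact Reach.mono (ih v [] [] [] [] (Nat.zero_le _) (Nat.zero_le _) (Nat.zero_le _)
        (Nat.zero_le _)) (Nat.le_succ _)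
    · have hbusy : (p.head?.isSome || w.head?.isSome || b.head?.isSome || o.head?.isSome) = true := by
        cases p <;> cases w <;> cases b <;> cases o <;> simp at he ⊢
      refine Reach.head ?_ (ih { v with busy := true } p.tail w.tail b.tail o.tail (by simp; omega)
        (by simp; omega) (by simp; omega) (by simp; omega))
      simp [program, update_prog, update_word, update_buf, update_orig, contents_prog,
        contents_word, contents_buf, contents_orig, hbusy]

/-- The comparison runs along `w` at most, and the clean-up costs at most the lengths of what is
left, whence `w` counts twice. -/
theorem halts_cmp (v : State T) (w o : List Letter) :
    Halts n (2 * w.length + o.length + 2) ⟨some .cmp, v, contents [] [] w [] o []⟩ (w ≠ o) := by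
  induction w generalizing v o with
  | nil =>
    cases o with
    | nil =>
      refine Reach.mono (Reach.head ?_ (halts_clean 0
        { v with ltr := none, orig := none, ans := false } [] [] [] [] le_rfl le_rfl le_rfl le_rfl)) (by simp)
      simp [program, update_word, update_orig, contents_word, contents_orig]
    | cons a o =>
      refine Reach.mono (Reach.head ?_ (halts_clean o.length
        { v with ltr := none, orig := some a, ans := true } [] [] [] o (by simp) (by simp) (by simp) le_rfl)) (by simp)
      simp [program, update_word, update_orig, contents_word, contents_orig]
  | cons a w ih =>
    by_cases h : o.head? = some a
    · obtain ⟨o, rfl⟩ : ∃ o', o = a :: o' := by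
        cases o with
        | nil => simp at h
        | cons b o => simp at h; exact ⟨o, by rw [h]⟩
      have h1 := ih { v with ltr := some a, orig := some a } o
      rw [show decide (a :: w ≠ a :: o) = decide (w ≠ o) by simp]
      refine Reach.mono (Reach.head ?_ h1) (by simp; omega)
      simp [program, update_word, update_orig, contents_word, contents_orig]
    · rw [show decide (a :: w ≠ o) = true by cases o <;> simp at h ⊢; tauto]
      refine Reach.mono (Reach.head ?_ (halts_clean (w.length + o.length)
        { v with ltr := some a, orig := o.head?, ans := true } [] w [] o.tail (by simp) (by simp) (by simp)
        (by simp; omega))) (by simp; omega)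
      simp [program, update_word, update_orig, contents_word, contents_orig, Ne.symm h]

theorem reach_back (v : State T) (p : List ((Fin k × Bool) ⊕ Bool)) (w b o : List Letter) :
    ∃ v', Reach T n (b.length + 1) ⟨some .back, v, contents [] p w b o []⟩
      ⟨some .next, v', contents [] p (b.reverse ++ w) [] o []⟩ := by
  induction b generalizing v w with
  | nil =>
    refine ⟨{ v with ltr := none }, Reach.step ?_⟩
    simp [program, update_buf, contents_buf]
  | cons a b ih =>
    obtain ⟨v', h⟩ := ih { v with ltr := some a } (a :: w)
    refine ⟨v', ?_⟩
    rw [List.reverse_cons, List.append_assoc, List.singleton_append]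
    refine Reach.head ?_ h
    simp [program, update_buf, contents_buf, update_word, contents_word]

theorem reach_run (hn : ∀ p s a, ((T p).next s a).2.length ≤ n) (v : State T)
    {q : Fin k × Bool} {s : (T q).S} (hv : v.cur = some ⟨q, s⟩)
    (p : List ((Fin k × Bool) ⊕ Bool)) (w b o : List Letter) :
    ∃ v', v'.cur = some ⟨q, ((T q).run s w).1⟩ ∧
      Reach T n w.length ⟨some .run, v, contents [] p w b o []⟩
        ⟨some .run, v', contents [] p [] (((T q).run s w).2.reverse ++ b) o []⟩ := by
  induction w generalizing v s b with
  | nil => exact ⟨v, hv, Reach.refl _⟩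
  | cons a w ih =>
    obtain ⟨v', h, h'⟩ := ih { v with ltr := some a, cur := some ⟨q, ((T q).next s a).1⟩ } rfl
      (((T q).next s a).2.reverse ++ b)
    refine ⟨v', h, ?_⟩
    rw [Transducer.run_cons, List.reverse_append, List.append_assoc]
    refine Reach.head ?_ h'
    have h1 : outNext T { v with ltr := some a } = ((T q).next s a).2 := by
      simp [outNext, hv]
    have h2 : nextState T { v with ltr := some a } = some ⟨q, ((T q).next s a).1⟩ := by
      simp [nextState, hv]
    simp only [program, TM2.stepAux, contents_word, update_word, List.head?_cons, Option.isNone_some,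
      cond_false, List.tail_cons]
    rw [stepAux_pushList _ _ _ _ _ _ _ (by rw [h1]; exact hn _ _ _)]
    simp [h1, h2, update_buf, contents_buf]

end Verifier

/-- `wordEval` recurses on the first letter, while the machine consumes the word from its right end.
-/
theorem wordEval_concat {k : ℕ} (T : Fin k × Bool → Transducer) (w : List (Fin k × Bool))
    (p : Fin k × Bool) (x : List Letter) :
    wordEval T (w ++ [p]) x = ((T p).eval x).bind (wordEval T w) := by
  induction w with
  | nil =>
    change (some x).bind (T p).eval = _
    rw [Option.bind_some]
    cases (T p).eval x <;> rfl
  | cons q w ih => simp only [List.cons_append, wordEval, ih, Option.bind_assoc]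

namespace Verifier

variable {k : ℕ} {T : Fin k × Bool → Transducer} {n D : ℕ}

/-- A bound for the running time of the machine, after reading the input. -/
def time (E m l : ℕ) : ℕ := (m + 1) * (4 * (l + m * E + m) + 10)

/-- The recursion for the running time: one generator costs at most `4 (l + E) + 10` steps and
lengthens the current word by at most `E`. -/
theorem time_succ (E m l : ℕ) :
    time E m (l + E) + 4 * (l + E) + 10 ≤ time E (m + 1) l := by
  unfold time
  nlinarith [Nat.zero_le (m * E), Nat.zero_le (m * l), Nat.zero_le (m * m),
    Nat.zero_le (m * m * E)]

theorem le_time (E m l : ℕ) : 4 * (l + m * E + m) + 10 ≤ time E m l := by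
  unfold time
  nlinarith [Nat.zero_le (m * (4 * (l + m * E + m) + 10))]

/-- Here `P` is the stack of generators, hence the reversed word. One pass adds at most `D` letters
while reading and `n` at the end, so `D + n` is the growth per generator. A rejecting transducer
leads directly to the clean-up with answer `false`. -/
theorem halts_next (hn : ∀ p s a, ((T p).next s a).2.length ≤ n)
    (hf : ∀ p s o, (T p).final s = some o → o.length ≤ n)
    (hD : ∀ p x, ((T p).run (T p).init x).2.length ≤ x.length + D)
    (P : List (Fin k × Bool)) (v : State T) (w o : List Letter) (l : ℕ) (hw : w.length ≤ l)
    (ho : o.length ≤ l) :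
    Halts n (time (D + n) P.length l) ⟨some .next, v, contents [] (P.map Sum.inl) w [] o []⟩
      (match wordEval T P.reverse w with
        | none => false
        | some y => y ≠ o) := by
  induction P generalizing v w l with
  | nil =>
    have h1 := halts_cmp (T := T) (n := n) { v with cur := none } w o
    refine Reach.mono (Reach.head ?_ h1) ?_
    · simp [program, update_prog, contents_prog]
    · have := le_time (D + n) 0 l
      simp only [List.length_nil]
      omega
  | cons p P ih =>
    rw [List.reverse_cons, wordEval_concat]
    have h0 : TM2.stepAux (program T n .next) v (contents [] ((p :: P).map Sum.inl) w [] o []) =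
        ⟨some .run, { v with cur := some ⟨p, (T p).init⟩ },
          contents [] (P.map Sum.inl) w [] o []⟩ := by
      simp [program, update_prog, contents_prog]
    obtain ⟨v₁, hv₁, h1⟩ := reach_run hn { v with cur := some ⟨p, (T p).init⟩ } rfl
      (P.map Sum.inl) w [] o
    have hl := hD p w
    have ht := time_succ (D + n) P.length l
    rw [List.append_nil] at h1
    have hfin : outFinal T { v₁ with ltr := none } =
        (T p).final ((T p).run (T p).init w).1 := by
      simp [outFinal, hv₁]
    rw [Transducer.eval, Transducer.evalFrom]
    cases ho' : (T p).final ((T p).run (T p).init w).1 with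
    | none =>
      rw [ho'] at hfin
      have h2 := halts_clean (n := n) (P.length + l + D) { v₁ with ltr := none, ans := false }
        (P.map Sum.inl) [] (((T p).run (T p).init w).2.reverse) o (by simp; omega) (by simp)
        (by simp; omega) (by omega)
      have h3 := Reach.head (n := n) (v := v₁) (l := .run)
        (S := contents [] (P.map Sum.inl) [] (((T p).run (T p).init w).2.reverse) o [])
        (by simp [program, update_word, contents_word, hfin]) h2
      have h4 := (Reach.head h0 h1).trans h3
      have ht' := le_time (D + n) P.length (l + (D + n))
      refine Reach.mono h4 ?_
      rw [List.length_cons]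
      have : P.length ≤ time (D + n) P.length (l + (D + n)) := by omega
      omega
    | some r =>
      rw [ho'] at hfin
      obtain ⟨v₂, h2⟩ := reach_back (n := n) { v₁ with ltr := none } (P.map Sum.inl) []
        (r.reverse ++ ((T p).run (T p).init w).2.reverse) o
      have h3 := Reach.head (n := n) (v := v₁) (l := .run)
        (S := contents [] (P.map Sum.inl) [] (((T p).run (T p).init w).2.reverse) o [])
        (by
          simp only [program, TM2.stepAux, contents_word, update_word, List.head?_nil,
            Option.isNone_none, cond_true, List.tail_nil, hfin, Option.isNone_some, cond_false]
          rw [stepAux_pushList _ _ _ _ _ _ _ (by rw [hfin]; exact hf _ _ _ ho')]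
          simp only [hfin, update_buf, contents_buf, TM2.stepAux, Option.getD_some]) h2
      have hr := hf _ _ _ ho'
      have h4 := ih v₂ (((T p).run (T p).init w).2 ++ r) (l + (D + n)) (by simp; omega) (by omega)
      rw [List.reverse_append, List.reverse_reverse, List.reverse_reverse, List.append_nil] at h3
      have h5 := ((Reach.head h0 h1).trans h3).trans h4
      refine Reach.mono h5 ?_
      rw [List.length_cons, List.length_append, List.length_reverse, List.length_reverse]
      omega

theorem reach_read_prog (w : List (Fin k × Bool)) (v : State T)
    (i p : List ((Fin k × Bool) ⊕ Bool)) :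
    ∃ v', v'.bit = v.bit ∧ Reach T n w.length
      ⟨some .read, v, contents (w.map Sum.inl ++ i) p [] [] [] []⟩
      ⟨some .read, v', contents i ((w.map Sum.inl).reverse ++ p) [] [] [] []⟩ := by
  induction w generalizing v p with
  | nil => exact ⟨v, rfl, Reach.refl _⟩
  | cons a w ih =>
    obtain ⟨v', hv', h⟩ := ih { v with inp := some (Sum.inl a) } (Sum.inl a :: p)
    refine ⟨v', hv', ?_⟩
    rw [List.map_cons, List.reverse_cons, List.append_assoc, List.singleton_append]
    refine Reach.head ?_ h
    simp [program, update_inp, contents_inp, update_prog, contents_prog]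

theorem reach_read_letters (c : List Bool) (v : State T) (hv : v.bit = none)
    (p : List ((Fin k × Bool) ⊕ Bool)) (w o : List Letter) :
    ∃ v', Reach T n (c.length + 1) ⟨some .read, v, contents (c.map Sum.inr) p w [] o []⟩
      ⟨some .next, v',
        contents [] p ((decodeLetters c).reverse ++ w) [] ((decodeLetters c).reverse ++ o) []⟩ := by
  fun_induction decodeLetters c generalizing v w o with
  | case1 b c t ih =>
    obtain ⟨v', h⟩ := ih { v with inp := some (Sum.inr c), bit := none } rfl
      ((if b then none else some c) :: w) ((if b then none else some c) :: o)
    refine ⟨v', ?_⟩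
    rw [List.reverse_cons, List.append_assoc, List.append_assoc, List.singleton_append,
      List.singleton_append]
    refine Reach.head (d := ⟨some .read, { v with inp := some (Sum.inr b), bit := some b },
      contents ((c :: t).map Sum.inr) p w [] o []⟩) ?_ (Reach.head ?_ h)
    · simp [program, update_inp, contents_inp, hv]
    · simp [program, update_inp, contents_inp, update_word, contents_word, update_orig,
        contents_orig, inputLetter]
  | case2 c hc =>
    match c, hc with
    | [], _ =>
      refine ⟨{ v with inp := none }, Reach.step ?_⟩
      simp [program, update_inp, contents_inp]
    -- `decodeLetters` ignores an unpaired last bit; the machine merely keeps it in its state.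
    | [b], _ =>
      refine ⟨{ v with inp := none, bit := some b }, ?_⟩
      refine Reach.head (d := ⟨some .read, { v with inp := some (Sum.inr b), bit := some b },
        contents [] p w [] o []⟩) ?_ (Reach.step ?_)
      · simp [program, update_inp, contents_inp, hv]
      · simp [program, update_inp, contents_inp]
    | b :: c :: t, hc => exact absurd rfl (hc b c t)

theorem halts_read (hn : ∀ p s a, ((T p).next s a).2.length ≤ n)
    (hf : ∀ p s o, (T p).final s = some o → o.length ≤ n)
    (hD : ∀ p x, ((T p).run (T p).init x).2.length ≤ x.length + D)
    (w : List (Fin k × Bool)) (c : List Bool) :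
    Halts (T := T) n (w.length + (c.length + 1) + time (D + n) w.length c.length)
      ⟨some .read, {}, contents (w.map Sum.inl ++ c.map Sum.inr) [] [] [] [] []⟩
      (verifies T (w, c)) := by
  obtain ⟨v₁, hv₁, h1⟩ := reach_read_prog (n := n) w {} (c.map Sum.inr) []
  obtain ⟨v₂, h2⟩ := reach_read_letters (n := n) c v₁ hv₁ ((w.map Sum.inl).reverse ++ []) [] []
  have hl : ∀ c : List Bool, (decodeLetters c).length ≤ c.length := by
    intro c
    fun_induction decodeLetters c with
    | case1 b c t ih => simp; omega
    | case2 => simp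
  have h3 := halts_next (T := T) (n := n) hn hf hD w.reverse v₂ (decodeLetters c).reverse
    (decodeLetters c).reverse c.length (by simpa using hl c) (by simpa using hl c)
  rw [List.append_nil, List.append_nil, ← List.map_reverse] at h2
  rw [List.append_nil, ← List.map_reverse] at h1
  rw [List.reverse_reverse, List.length_reverse] at h3
  exact (h1.trans h2).trans h3

/-- The machine. -/
def machine (T : Fin k × Bool → Transducer) (n : ℕ) : FinTM2 where
  K := Stack
  k₀ := .inp
  k₁ := .out
  Γ := Γ k
  Λ := Label
  main := .read
  σ := State T
  initialState := {}
  Γk₀Fin := inferInstanceAs (Fintype ((Fin k × Bool) ⊕ Bool))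
  m := program T n

theorem verifies_polyTime (hn : ∀ p s a, ((T p).next s a).2.length ≤ n)
    (hf : ∀ p s o, (T p).final s = some o → o.length ≤ n)
    (hD : ∀ p x, ((T p).run (T p).init x).2.length ≤ x.length + D) :
    Nonempty (TM2ComputableInPolyTime
      (encodingProd (encodingList (Fin k × Bool)) (encodingList Bool)).encode encodeBool
      (verifies T)) := by
  refine ⟨⟨⟨machine T n, Equiv.refl _, Equiv.refl _⟩,
    -- Reading time plus `time`, with both the number of generators and the length of the
    -- certificate bounded by the input length.
    Polynomial.X + 1 + (Polynomial.X + 1) *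
      (4 * (Polynomial.X + Polynomial.X * Polynomial.C (D + n) + Polynomial.X) + 10), ?_⟩⟩
  rintro ⟨w, c⟩
  have h := halts_read hn hf hD w c
  have hi : initList (machine T n) (w.map Sum.inl ++ c.map Sum.inr) =
      ⟨some .read, {}, contents (w.map Sum.inl ++ c.map Sum.inr) [] [] [] [] []⟩ := by
    refine congrArg (TM2.Cfg.mk _ _) (funext fun a => ?_)
    cases a <;> rfl
  have ho : haltList (machine T n) [verifies T (w, c)] =
      ⟨none, {}, contents [] [] [] [] [] [verifies T (w, c)]⟩ := by
    refine congrArg (TM2.Cfg.mk _ _) (funext fun a => ?_)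
    cases a <;> rfl
  have hle : w.length + (c.length + 1) + time (D + n) w.length c.length ≤
      Polynomial.eval (w.length + c.length) (Polynomial.X + 1 + (Polynomial.X + 1) *
      (4 * (Polynomial.X + Polynomial.X * Polynomial.C (D + n) + Polynomial.X) + 10)) := by
    simp only [Polynomial.eval_add, Polynomial.eval_mul, Polynomial.eval_X, Polynomial.eval_one,
      Polynomial.eval_C, Polynomial.eval_ofNat, time]
    have h1 : w.length * (D + n) ≤ (w.length + c.length) * (D + n) :=
      Nat.mul_le_mul_right _ (Nat.le_add_right _ _)
    have h2 : (w.length + 1) * (4 * (c.length + w.length * (D + n) + w.length) + 10) ≤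
      (w.length + c.length + 1) * (4 * (w.length + c.length + (w.length + c.length) * (D + n) +
        (w.length + c.length)) + 10) := Nat.mul_le_mul (by omega) (by omega)
    omega
  have h' := Classical.choice (h.mono hle)
  have hlen : ((encodingProd (encodingList (Fin k × Bool)) (encodingList Bool)).encode
      (w, c)).length = w.length + c.length := by simp [encodingProd, encodingList]
  have e1 : ((encodingProd (encodingList (Fin k × Bool)) (encodingList Bool)).encode
      (w, c)).map (Equiv.refl _).invFun = w.map Sum.inl ++ c.map Sum.inr := List.map_id _
  rw [hlen]
  refine cast ?_ h'
  unfold TM2OutputsInTime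
  congr 1
  · exact hi.symm.trans (congrArg (initList (machine T n)) e1.symm)
  · exact congrArg some ho.symm

end Verifier
-- The word problem is in coNP
theorem exists_length_bound {k : ℕ} (T : Fin k × Bool → Transducer) :
    ∃ n, (∀ p s a, ((T p).next s a).2.length ≤ n) ∧
      ∀ p s o, (T p).final s = some o → o.length ≤ n := by
  let _ := fun p => (T p).finS
  refine ⟨Finset.univ.sup (fun x : (Σ p, (T p).S) × Letter => ((T x.1.1).next x.1.2 x.2).2.length) +
    Finset.univ.sup (fun x : Σ p, (T p).S => (((T x.1).final x.2).getD []).length),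
    fun p s a => ?_, fun p s o h => ?_⟩
  · exact (Finset.le_sup (f := fun x : (Σ p, (T p).S) × Letter =>
      ((T x.1.1).next x.1.2 x.2).2.length) (Finset.mem_univ (⟨p, s⟩, a))).trans (Nat.le_add_right _ _)
  · have h1 := Finset.le_sup (f := fun x : Σ p, (T p).S => (((T x.1).final x.2).getD []).length)
      (Finset.mem_univ ⟨p, s⟩)
    simp only [h, Option.getD_some] at h1
    exact h1.trans (Nat.le_add_left _ _)

/-- A moved string certifies that a word is not the identity. Completeness is the existence of short
witnesses; soundness holds because the transducers compute restrictions of the group elements. -/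
theorem wordProblemInCoNP {L : Subgroup (BigGroup Letter)} (hL : L ≤ groupK012) :
    WordProblemInCoNP L := by
  intro k s _
  let s' : Fin k → BigGroup Letter := fun i => s i
  have hval : ∀ w, wordVal s w = 1 ↔ wordVal s' w = 1 := by
    intro w
    have h1 : L.subtype (wordVal s w) = wordVal s' w := by
      rw [wordVal, map_list_prod, List.map_map, wordVal]
      congr 2
      funext p
      simp only [Function.comp, letterVal]
      split_ifs <;> rfl
    rw [← h1, L.coe_subtype, OneMemClass.coe_eq_one]
  obtain ⟨T, C, hT⟩ := exists_transducers (s := s') fun i => hL (s i).2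
  obtain ⟨n, hn, hf⟩ := exists_length_bound T
  -- The bound for the witness, doubled because a letter is encoded by two bits.
  refine ⟨2 * (6 * (Polynomial.X * Polynomial.C C) + 10), verifies T,
    Verifier.verifies_polyTime hn hf fun p => (hT p).2.2, fun w => ?_⟩
  change ¬ (wordVal s w = 1) ↔ _
  rw [hval]
  constructor
  · intro hw
    obtain ⟨x, y, hl, hy, hne⟩ := exists_short_wordEval hT hw
    obtain ⟨c, hc, hx⟩ := exists_decodeLetters x.reverse
    refine ⟨c, ?_, ?_⟩
    · rw [hc, List.length_reverse]
      simpa using hl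
    · simp [verifies, hx, hy, hne]
  · rintro ⟨c, -, hc⟩ h1
    rw [verifies] at hc
    cases hy : wordEval T w (decodeLetters c).reverse with
    | none => simp [hy] at hc
    | some y =>
      simp only [hy, decide_eq_true_eq] at hc
      have h2 := mem_wordVal_of_mem_wordComp w (wordEval_mem_wordComp hT w hy)
      rw [h1] at h2
      exact hc (BigGroup.mem_one_iff.1 h2)

/-! ### Finite maximal prefix codes -/

/-- A finite maximal prefix code: its words are pairwise incomparable, and every word is comparable
to one of them. -/
structure IsCode (P : Finset (List Letter)) : Prop where
  incomp : ∀ p ∈ P, ∀ q ∈ P, p ≠ q → Incomp p q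
  maximal : ∀ x, ∃ p ∈ P, p <+: x ∨ x <+: p

/-- Replace the word `p` in `P` by the words `p z` with `z ∈ Z`. -/
def expand (P : Finset (List Letter)) (p : List Letter) (Z : Finset (List Letter)) :
    Finset (List Letter) := P.erase p ∪ Z.image (p ++ ·)

theorem mem_expand {P Z : Finset (List Letter)} {p x : List Letter} :
    x ∈ expand P p Z ↔ (x ≠ p ∧ x ∈ P) ∨ ∃ z ∈ Z, p ++ z = x := by
  simp [expand]

theorem IsCode.eq_of_prefix {P : Finset (List Letter)} (h : IsCode P) {p q : List Letter}
    (hp : p ∈ P) (hq : q ∈ P) (hpq : p <+: q) : p = q := by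
  by_contra hne
  exact (h.incomp p hp q hq hne).1 hpq

theorem IsCode.eq_singleton {P : Finset (List Letter)} (h : IsCode P) (hP : [] ∈ P) : P = {[]} :=
  Finset.eq_singleton_iff_unique_mem.2 ⟨hP, fun _ hq => (h.eq_of_prefix hP hq List.nil_prefix).symm⟩

theorem isCode_singleton : IsCode {[]} :=
  ⟨by simp, fun x => ⟨[], by simp⟩⟩

theorem IsCode.expand {P Z : Finset (List Letter)} (hP : IsCode P) (hZ : IsCode Z)
    {p : List Letter} (hp : p ∈ P) : IsCode (expand P p Z) := by
  refine ⟨fun x hx y hy hne => ?_, fun x => ?_⟩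
  · rw [mem_expand] at hx hy
    rcases hx with ⟨hxp, hx⟩ | ⟨z, hz, rfl⟩
    · rcases hy with ⟨hyp, hy⟩ | ⟨z', hz', rfl⟩
      · exact hP.incomp x hx y hy hne
      · exact (hP.incomp x hx p hp hxp).append_right z'
    · rcases hy with ⟨hyp, hy⟩ | ⟨z', hz', rfl⟩
      · exact (hP.incomp p hp y hy (Ne.symm hyp)).append_left z
      · exact incomp_append_iff.2 (hZ.incomp z hz z' hz' fun h => hne (h ▸ rfl))
  · obtain ⟨q, hq, h⟩ := hP.maximal x
    by_cases hqp : q = p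
    · subst hqp
      rcases h with ⟨t, rfl⟩ | h
      · obtain ⟨z, hz, h⟩ := hZ.maximal t
        exact ⟨q ++ z, mem_expand.2 (Or.inr ⟨z, hz, rfl⟩), by
          simpa [List.prefix_append_right_inj] using h⟩
      · obtain ⟨z, hz, -⟩ := hZ.maximal []
        exact ⟨q ++ z, mem_expand.2 (Or.inr ⟨z, hz, rfl⟩), Or.inr (h.trans (List.prefix_append _ _))⟩
    · exact ⟨q, mem_expand.2 (Or.inl ⟨hqp, hq⟩), h⟩

/-- A maximal prefix code that contains all words `q z` with `z ∈ Z` is an expansion. -/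
theorem IsCode.exists_eq_expand {P Z : Finset (List Letter)} (hP : IsCode P) (hZ : IsCode Z)
    (hcard : 2 ≤ Z.card) {q : List Letter} (hq : ∀ z ∈ Z, q ++ z ∈ P) :
    ∃ P', IsCode P' ∧ q ∈ P' ∧ P = Thompson.expand P' q Z ∧ P'.card < P.card ∧
      ∀ p ∈ P', p ∈ P ∨ p = q := by
  obtain ⟨z₁, hz₁, z₂, hz₂, hz⟩ := Finset.one_lt_card.1 hcard
  have hqP : q ∉ P := by
    intro h
    have e1 := hP.eq_of_prefix h (hq z₁ hz₁) (List.prefix_append _ _)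
    have e2 := hP.eq_of_prefix h (hq z₂ hz₂) (List.prefix_append _ _)
    exact hz (List.append_cancel_left (e1.symm.trans e2))
  have hsub : Z.image (q ++ ·) ⊆ P := by
    intro x hx
    obtain ⟨z, hz, rfl⟩ := Finset.mem_image.1 hx
    exact hq z hz
  have hinj : (Z.image (q ++ ·)).card = Z.card :=
    Finset.card_image_of_injective _ fun _ _ h => List.append_cancel_left h
  refine ⟨insert q (P \ Z.image (q ++ ·)), ⟨?_, ?_⟩, Finset.mem_insert_self _ _, ?_, ?_, ?_⟩
  · have key : ∀ p ∈ P \ Z.image (q ++ ·), Incomp p q := by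
      intro p hp
      rw [Finset.mem_sdiff] at hp
      refine ⟨fun h => hp.2 ?_, ?_⟩
      · rw [hP.eq_of_prefix hp.1 (hq z₁ hz₁) (h.trans (List.prefix_append _ _))]
        exact Finset.mem_image_of_mem _ hz₁
      -- A word `q t` of `P` is comparable to some `q z` with `z ∈ Z`, hence equal to it and
      -- therefore removed.
      · rintro ⟨t, rfl⟩
        obtain ⟨z, hz, h⟩ := hZ.maximal t
        refine hp.2 (Finset.mem_image.2 ⟨z, hz, ?_⟩)
        rcases h with h | h
        · exact hP.eq_of_prefix (hq z hz) hp.1 ((List.prefix_append_right_inj q).2 h)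
        · exact (hP.eq_of_prefix hp.1 (hq z hz) ((List.prefix_append_right_inj q).2 h)).symm
    intro x hx y hy hne
    rcases Finset.mem_insert.1 hx with rfl | hx
    · rcases Finset.mem_insert.1 hy with rfl | hy
      · exact absurd rfl hne
      · exact (key y hy).symm
    · rcases Finset.mem_insert.1 hy with rfl | hy
      · exact key x hx
      · exact hP.incomp x (Finset.mem_sdiff.1 hx).1 y (Finset.mem_sdiff.1 hy).1 hne
  · intro x
    obtain ⟨p, hp, h⟩ := hP.maximal x
    by_cases hpi : p ∈ Z.image (q ++ ·)
    · obtain ⟨z, hz, rfl⟩ := Finset.mem_image.1 hpi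
      refine ⟨q, Finset.mem_insert_self _ _, ?_⟩
      rcases h with h | h
      · exact Or.inl ((List.prefix_append _ _).trans h)
      · exact (List.prefix_or_prefix_of_prefix h (List.prefix_append _ _)).symm
    · exact ⟨p, Finset.mem_insert_of_mem (Finset.mem_sdiff.2 ⟨hp, hpi⟩), h⟩
  · rw [Thompson.expand, Finset.erase_insert (by simp [hqP]),
      Finset.sdiff_union_of_subset hsub]
  · rw [Finset.card_insert_of_notMem (by simp [hqP]), Finset.card_sdiff_of_subset hsub, hinj]
    have := Finset.card_le_card hsub
    omega
  · intro p hp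
    rcases Finset.mem_insert.1 hp with rfl | hp
    · exact Or.inr rfl
    · exact Or.inl (Finset.mem_sdiff.1 hp).1

/-- The image of a maximal prefix code under an element of `𝒢_{3,1}`. -/
theorem IsCode.image {P : Finset (List Letter)} (hP : IsCode P) {g : BigGroup Letter}
    {f : List Letter → List Letter} (hf : ∀ p ∈ P, f p ∈ g.toMap p) : IsCode (P.image f) := by
  refine ⟨fun x hx y hy hne => ?_, fun x => ?_⟩
  · obtain ⟨p, hp, rfl⟩ := Finset.mem_image.1 hx
    obtain ⟨q, hq, rfl⟩ := Finset.mem_image.1 hy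
    exact (BigGroup.incomp_iff_of_mem (hf p hp) (hf q hq)).2
      (hP.incomp p hp q hq fun h => hne (h ▸ rfl))
  · obtain ⟨z, y, hy⟩ := BigGroup.exists_mem g⁻¹ x
    rw [BigGroup.mem_inv_iff] at hy
    obtain ⟨p, hp, h⟩ := hP.maximal y
    refine ⟨f p, Finset.mem_image_of_mem f hp, ?_⟩
    rcases h with h | h
    · exact List.prefix_or_prefix_of_prefix (BigGroup.prefix_of_mem (hf p hp) hy h)
        (List.prefix_append x z)
    · exact Or.inr ((List.prefix_append x z).trans (BigGroup.prefix_of_mem hy (hf p hp) h))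

/-- The words of length one. -/
def letterCode : Finset (List Letter) := {[none], [some false], [some true]}

theorem mem_letterCode {z : List Letter} : z ∈ letterCode ↔ ∃ a, z = [a] := by
  simp only [letterCode, Finset.mem_insert, Finset.mem_singleton]
  constructor
  · rintro (rfl | rfl | rfl) <;> exact ⟨_, rfl⟩
  · rintro ⟨_ | _ | _, rfl⟩ <;> simp

theorem isCode_letterCode : IsCode letterCode := by
  refine ⟨fun p hp q hq hne => ?_, fun x => ?_⟩
  · obtain ⟨a, rfl⟩ := mem_letterCode.1 hp
    obtain ⟨b, rfl⟩ := mem_letterCode.1 hq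
    exact incomp_of_length rfl hne
  · cases x with
    | nil => exact ⟨[none], mem_letterCode.2 ⟨_, rfl⟩, Or.inr List.nil_prefix⟩
    | cons a x => exact ⟨[a], mem_letterCode.2 ⟨_, rfl⟩, Or.inl ⟨x, rfl⟩⟩

/-- The last letter of a longest word can be replaced by every letter. -/
theorem IsCode.exists_siblings {P : Finset (List Letter)} (hP : IsCode P)
    {c : List Letter → Prop} (hc : ∀ r z, c r → c (r ++ z))
    (h : ∃ r a, r ++ [a] ∈ P ∧ c r) : ∃ r, c r ∧ ∀ z ∈ letterCode, r ++ z ∈ P := by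
  classical
  obtain ⟨r₀, a₀, h₀, hr₀⟩ := h
  -- Take a longest word whose parent `r` satisfies `c`. A word of `P` strictly below a sibling `r
  -- b` would be a longer candidate, as `c` passes to extensions; one strictly above would be a
  -- proper prefix of `r a`.
  obtain ⟨x, hx, hmax⟩ := Finset.exists_max_image (P.filter fun x => ∃ r a, x = r ++ [a] ∧ c r)
    List.length ⟨_, Finset.mem_filter.2 ⟨h₀, r₀, a₀, rfl, hr₀⟩⟩
  obtain ⟨hxP, r, a, rfl, hr⟩ := Finset.mem_filter.1 hx
  refine ⟨r, hr, fun z hz => ?_⟩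
  obtain ⟨b, rfl⟩ := mem_letterCode.1 hz
  obtain ⟨p, hp, h | h⟩ := hP.maximal (r ++ [b])
  · rcases List.prefix_concat_iff.1 h with rfl | h
    · exact hp
    · have e := hP.eq_of_prefix hp hxP (h.trans (List.prefix_append _ _))
      have := h.length_le
      rw [e] at this
      simp at this
  · obtain ⟨t, rfl⟩ := h
    rcases List.eq_nil_or_concat t with rfl | ⟨t, d, rfl⟩
    · simpa using hp
    · have := hmax _ (Finset.mem_filter.2 ⟨hp, r ++ ([b] ++ t), d, by simp, hc r _ hr⟩)
      simp at this

/-! ### Codes that are obtained by expansions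

The words are divided into two classes, given by a predicate `cls`; words outside of the class are
expanded by a given code, words in the class (if this is permitted by `hi`) by all letters. -/

/-- The codes that are obtained from `{[]}` by `n` expansions of words outside of the class `cls`,
followed by `m` expansions of words in the class. -/
inductive Exp (cls : List Letter → Prop) (Z : Finset (List Letter)) (hi : Prop) :
    ℕ → ℕ → Finset (List Letter) → Prop
  | nil : Exp cls Z hi 0 0 {[]}
  | low {n P p} : Exp cls Z hi n 0 P → p ∈ P → ¬ cls p → Exp cls Z hi (n + 1) 0 (expand P p Z)
  | high {n m P p} : hi → Exp cls Z hi n m P → p ∈ P → cls p →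
      Exp cls Z hi n (m + 1) (expand P p letterCode)

section Exp

variable {cls : List Letter → Prop} {Z : Finset (List Letter)} {hi : Prop} {n m : ℕ}
  {P Q : Finset (List Letter)}

theorem Exp.isCode (hZ : IsCode Z) (h : Exp cls Z hi n m P) : IsCode P := by
  induction h with
  | nil => exact isCode_singleton
  | low _ hp _ ih => exact ih.expand hZ hp
  | high _ _ hp _ ih => exact ih.expand isCode_letterCode hp

theorem card_filter_expand (c : List Letter → Prop) [DecidablePred c] (hP : IsCode P)
    {p : List Letter} (hp : p ∈ P) :
    ((expand P p Z).filter c).card + (if c p then 1 else 0) =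
      (P.filter c).card + (Z.filter fun z => c (p ++ z)).card := by
  have hd : Disjoint (P.erase p) (Z.image (p ++ ·)) := by
    rw [Finset.disjoint_right]
    intro x hx hx'
    obtain ⟨z, hz, rfl⟩ := Finset.mem_image.1 hx
    rw [Finset.mem_erase] at hx'
    exact hx'.1 (hP.eq_of_prefix hp hx'.2 (List.prefix_append _ _)).symm
  rw [expand, Finset.filter_union, Finset.card_union_of_disjoint (hd.mono (Finset.filter_subset _ _)
    (Finset.filter_subset _ _)), Finset.filter_image,
    Finset.card_image_of_injective _ fun _ _ h => List.append_cancel_left h, Finset.filter_erase]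
  split_ifs with h
  · have := Finset.card_erase_add_one (Finset.mem_filter.2 ⟨hp, h⟩)
    omega
  · rw [Finset.erase_eq_of_notMem (by simp [h])]
    omega

/-- These counts determine the numbers of expansions: only a low expansion changes the number of
words outside the class, and a high one adds two words to the class. -/
theorem Exp.card [DecidablePred cls] (hcls : ∀ x y, cls (x ++ y) ↔ cls x ∨ cls y)
    (hnil : ¬ cls []) (hZ : IsCode Z) (h : Exp cls Z hi n m P) :
    (P.filter fun x => ¬ cls x).card + n = 1 + n * (Z.filter fun x => ¬ cls x).card ∧
      (P.filter cls).card = n * (Z.filter cls).card + 2 * m := by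
  induction h with
  | nil => simp [Finset.filter_singleton, hnil]
  | @low n P p h hp hc ih =>
    have h1 := card_filter_expand (Z := Z) cls (h.isCode hZ) hp
    have h2 := card_filter_expand (Z := Z) (fun x => ¬ cls x) (h.isCode hZ) hp
    simp only [hcls, hc, false_or, if_false, not_false_eq_true, if_true] at h1 h2
    change _ = _ + (Z.filter cls).card at h1
    rw [add_mul, add_mul, one_mul, one_mul]
    omega
  | @high n m P p _ h hp hc ih =>
    have h1 := card_filter_expand (Z := letterCode) cls (h.isCode hZ) hp
    have h2 := card_filter_expand (Z := letterCode) (fun x => ¬ cls x) (h.isCode hZ) hp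
    have h3 : letterCode.card = 3 := rfl
    simp only [hcls, hc, true_or, if_true, not_true_eq_false, if_false, Finset.filter_true,
      Finset.filter_false, Finset.card_empty, h3] at h1 h2
    omega

/-- Swaps of words of the same class map any two expansions of the same kind to each other. -/
theorem Exp.exists_map (hcls : ∀ x y, cls (x ++ y) ↔ cls x ∨ cls y) (hZ : IsCode Z)
    {Γ : Subgroup (BigGroup Letter)}
    (hsw : ∀ n m P, Exp cls Z hi n m P → ∀ p ∈ P, ∀ q ∈ P, (cls p ↔ cls q) → p ≠ q →
      swap p q ∈ Γ) (hP : Exp cls Z hi n m P) (hQ : Exp cls Z hi n m Q) :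
    ∃ g ∈ Γ, ∀ p ∈ P, ∃ q ∈ Q, q ∈ g.toMap p ∧ (cls p ↔ cls q) := by
  have step : ∀ {n m P Q p q Y}, Exp cls Z hi n m Q → p ∈ P → q ∈ Q → (cls p ↔ cls q) →
      (∃ g ∈ Γ, ∀ p ∈ P, ∃ q ∈ Q, q ∈ g.toMap p ∧ (cls p ↔ cls q)) →
      ∃ g ∈ Γ, ∀ x ∈ expand P p Y, ∃ y ∈ expand Q q Y, y ∈ g.toMap x ∧ (cls x ↔ cls y) := by
    rintro n m P Q p q Y hQ hp hq hpq ⟨g, hg, hgP⟩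
    -- Correct `g` by one swap inside a class so that it maps `p` to `q`; then it carries the
    -- expansion at `p` to the expansion at `q`.
    obtain ⟨g', hg', hgP', hgp⟩ : ∃ g ∈ Γ, (∀ p ∈ P, ∃ q ∈ Q, q ∈ g.toMap p ∧ (cls p ↔ cls q)) ∧
        q ∈ g.toMap p := by
      obtain ⟨x, hx, hxp, hpx⟩ := hgP p hp
      by_cases hxq : x = q
      · exact ⟨g, hg, hgP, hxq ▸ hxp⟩
      · have hinc := (hQ.isCode hZ).incomp x hx q hq hxq
        refine ⟨swap x q * g, mul_mem (hsw _ _ _ hQ x hx q hq (hpx.symm.trans hpq) hxq) hg, ?_,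
          BigGroup.mem_mul hxp (mem_swap_left' hinc)⟩
        intro r hr
        obtain ⟨y, hy, hyr, hry⟩ := hgP r hr
        by_cases h1 : y = x
        · subst h1
          exact ⟨q, hq, BigGroup.mem_mul hyr (mem_swap_left' hinc),
            hry.trans (hpx.symm.trans hpq)⟩
        · by_cases h2 : y = q
          · subst h2
            exact ⟨x, hx, BigGroup.mem_mul hyr (mem_swap_right' hinc),
              hry.trans (hpq.symm.trans hpx)⟩
          · exact ⟨y, hy, BigGroup.mem_mul hyr (mem_swap_of_incomp hinc
              ((hQ.isCode hZ).incomp x hx y hy (Ne.symm h1))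
              ((hQ.isCode hZ).incomp q hq y hy (Ne.symm h2))), hry⟩
    refine ⟨g', hg', fun x hx => ?_⟩
    rcases mem_expand.1 hx with ⟨hxp, hx⟩ | ⟨z, hz, rfl⟩
    · obtain ⟨y, hy, hyx, hxy⟩ := hgP' x hx
      refine ⟨y, mem_expand.2 (Or.inl ⟨?_, hy⟩), hyx, hxy⟩
      rintro rfl
      exact hxp (BigGroup.mem_inj hyx hgp)
    · exact ⟨q ++ z, mem_expand.2 (Or.inr ⟨z, hz, rfl⟩), BigGroup.mem_append hgp z, by
        rw [hcls, hcls, hpq]⟩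
  induction hP generalizing Q with
  | nil =>
    cases hQ
    exact ⟨1, one_mem _, fun p hp => ⟨p, hp, BigGroup.mem_one p, Iff.rfl⟩⟩
  | low hP hp hc ih =>
    cases hQ with
    | low hQ hq hc' => exact step hQ hp hq (by simp [hc, hc']) (ih hQ)
  | high _ hP hp hc ih =>
    cases hQ with
    | high _ hQ hq hc' => exact step hQ hp hq (by simp [hc, hc']) (ih hQ)

/-- An element that permutes the words of a code inside of their classes is a product of swaps. -/
theorem IsCode.mem_of_permutes (hP : IsCode P) {Γ : Subgroup (BigGroup Letter)}
    (hsw : ∀ p ∈ P, ∀ q ∈ P, (cls p ↔ cls q) → p ≠ q → swap p q ∈ Γ) {g : BigGroup Letter}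
    (hg : ∀ p ∈ P, ∃ q ∈ P, q ∈ g.toMap p ∧ (cls p ↔ cls q)) : g ∈ Γ := by
  classical
  -- Induction on the number of words that are moved: composing with the swap of `p` and its image
  -- `q` fixes `p` and unfixes nothing.
  induction hk : (P.filter fun p => p ∉ g.toMap p).card using Nat.strong_induction_on
    generalizing g with
  | _ k ih =>
    by_cases hfix : ∀ p ∈ P, p ∈ g.toMap p
    · have h1 : g = 1 := by
        refine BigGroup.eq_of_agree fun x => ?_
        obtain ⟨p, hp, ⟨t, rfl⟩ | ⟨t, rfl⟩⟩ := hP.maximal x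
        · refine ⟨[], _, ?_, BigGroup.mem_one _⟩
          simpa using BigGroup.mem_append (hfix p hp) t
        · exact ⟨t, _, hfix _ hp, BigGroup.mem_one _⟩
      rw [h1]
      exact one_mem _
    · push Not at hfix
      obtain ⟨p, hp, hpp⟩ := hfix
      obtain ⟨q, hq, hqp, hpq⟩ := hg p hp
      have hne : p ≠ q := fun h => hpp (by rw [← h] at hqp; exact hqp)
      have hinc := hP.incomp p hp q hq hne
      have hs := hsw p hp q hq hpq hne
      have hmap : ∀ r ∈ P, ∃ y ∈ P, y ∈ (swap p q * g).toMap r ∧ (cls r ↔ cls y) := by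
        intro r hr
        obtain ⟨y, hy, hyr, hry⟩ := hg r hr
        by_cases h1 : y = p
        · subst h1
          exact ⟨q, hq, BigGroup.mem_mul hyr (mem_swap_left' hinc), hry.trans hpq⟩
        · by_cases h2 : y = q
          · subst h2
            exact ⟨p, hp, BigGroup.mem_mul hyr (mem_swap_right' hinc), hry.trans hpq.symm⟩
          · exact ⟨y, hy, BigGroup.mem_mul hyr (mem_swap_of_incomp hinc
              (hP.incomp p hp y hy (Ne.symm h1)) (hP.incomp q hq y hy (Ne.symm h2))), hry⟩
      have hlt : (P.filter fun r => r ∉ (swap p q * g).toMap r).card < k := by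
        rw [← hk]
        refine Finset.card_lt_card ⟨fun r hr => ?_, fun h => ?_⟩
        · rw [Finset.mem_filter] at hr ⊢
          refine ⟨hr.1, fun h => hr.2 ?_⟩
          have h1 : r ≠ p := fun e => hpp (e ▸ h)
          have h2 : r ≠ q := fun e => hne (BigGroup.mem_inj hqp (e ▸ h))
          exact BigGroup.mem_mul h (mem_swap_of_incomp hinc
            (hP.incomp p hp r hr.1 (Ne.symm h1)) (hP.incomp q hq r hr.1 (Ne.symm h2)))
        · have h1 := h (Finset.mem_filter.2 ⟨hp, hpp⟩)
          exact (Finset.mem_filter.1 h1).2 (BigGroup.mem_mul hqp (mem_swap_right' hinc))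
      have h1 := ih _ hlt hmap rfl
      have h2 := mul_mem (inv_mem hs) h1
      rwa [inv_mul_cancel_left] at h2

/-- An element that maps a code to another one and preserves the classes is a product of swaps. -/
theorem mem_of_maps_code [DecidablePred cls] (hcls : ∀ x y, cls (x ++ y) ↔ cls x ∨ cls y)
    (hnil : ¬ cls []) (hZ : IsCode Z) (hZc : 2 ≤ (Z.filter fun x => ¬ cls x).card)
    {Γ : Subgroup (BigGroup Letter)}
    (hsw : ∀ n m P, Exp cls Z hi n m P → ∀ p ∈ P, ∀ q ∈ P, (cls p ↔ cls q) → p ≠ q →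
      swap p q ∈ Γ) {g : BigGroup Letter} {f : List Letter → List Letter}
    (hf : ∀ p ∈ P, f p ∈ g.toMap p ∧ (cls p ↔ cls (f p)))
    (hP : ∃ n m, Exp cls Z hi n m P) (hQ : ∃ n m, Exp cls Z hi n m (P.image f)) : g ∈ Γ := by
  obtain ⟨n, m, hP⟩ := hP
  obtain ⟨n', m', hQ⟩ := hQ
  have hinj : Set.InjOn f P := fun x hx y hy h =>
    BigGroup.mem_inj (hf x hx).1 (h ▸ (hf y hy).1)
  have hcard : ∀ c : List Letter → Prop, [DecidablePred c] → (∀ p ∈ P, c p ↔ c (f p)) →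
      ((P.image f).filter c).card = (P.filter c).card := by
    intro c _ hc
    rw [Finset.filter_image, Finset.card_image_of_injOn (hinj.mono (by
      intro x hx; exact (Finset.mem_filter.1 hx).1))]
    congr 1
    exact Finset.filter_congr fun p hp => (hc p hp).symm
  have h1 := hP.card hcls hnil hZ
  have h2 := hQ.card hcls hnil hZ
  rw [hcard cls fun p hp => (hf p hp).2, hcard (fun x => ¬ cls x) fun p hp =>
    not_congr (hf p hp).2] at h2
  -- The number of words outside the class is `1 + n (z - 1)`, where `z ≥ 2` counts such words in
  -- `Z`, so it determines `n`; the size of the class then gives `m`.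
  have hn : n = n' := by
    obtain ⟨d, hd⟩ := Nat.exists_eq_add_of_le hZc
    have e1 := h1.1
    have e2 := h2.1
    rw [hd] at e1 e2
    have e3 : n * (1 + d) = n' * (1 + d) := by nlinarith
    exact Nat.eq_of_mul_eq_mul_right (by omega) e3
  subst hn
  have hm : m = m' := by omega
  subst hm
  -- Return from the image code to `P` by swaps; then `h * g` permutes `P`.
  obtain ⟨h, hh, hmap⟩ := hQ.exists_map hcls hZ hsw hP
  have hperm : h * g ∈ Γ := by
    refine (hP.isCode hZ).mem_of_permutes (cls := cls) (hsw n m P hP) fun p hp => ?_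
    obtain ⟨q, hq, hqp, hc⟩ := hmap (f p) (Finset.mem_image_of_mem f hp)
    exact ⟨q, hq, BigGroup.mem_mul (hf p hp).1 hqp, (hf p hp).2.trans hc⟩
  have h3 := mul_mem (inv_mem hh) hperm
  rwa [inv_mul_cancel_left] at h3

end Exp

/-! ### Generating swaps by short swaps -/

/-- The swaps of incomparable words of length at most `L` that are related by `τ`. -/
def shortSwaps (L : ℕ) (τ : List Letter → List Letter → Prop) : Set (BigGroup Letter) :=
  {g | ∃ p q, p.length ≤ L ∧ q.length ≤ L ∧ Incomp p q ∧ τ p q ∧ g = swap p q}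

theorem finite_shortSwaps (L : ℕ) (τ : List Letter → List Letter → Prop) :
    (shortSwaps L τ).Finite := by
  refine (((List.finite_length_le Letter L).prod (List.finite_length_le Letter L)).image
    fun x => swap x.1 x.2).subset ?_
  rintro _ ⟨p, q, hp, hq, -, -, rfl⟩
  exact ⟨(p, q), ⟨hp, hq⟩, rfl⟩

theorem swap_mem_closure_shortSwaps {L : ℕ} {τ : List Letter → List Letter → Prop}
    {p q : List Letter} (hp : p.length ≤ L) (hq : q.length ≤ L) (h : Incomp p q) (hτ : τ p q) :
    swap p q ∈ Subgroup.closure (shortSwaps L τ) :=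
  Subgroup.subset_closure ⟨p, q, hp, hq, h, hτ, rfl⟩

/-- Conjugation by the swap of `p₀` and the shorter word `r` replaces `p = p₀ z` by `r z`. It does
not lengthen `q`, since `q` is incomparable to `r`. So the sum of the two lengths decreases. -/
theorem swap_mem_of_short {Γ : Subgroup (BigGroup Letter)} {τ : List Letter → Prop} {L : ℕ}
    (hshort : ∀ p q, τ p → τ q → p.length ≤ L → q.length ≤ L → Incomp p q → swap p q ∈ Γ)
    (hstep : ∀ p q, τ p → τ q → Incomp p q → L < p.length → ∃ p₀ r, p₀ <+: p ∧ swap p₀ r ∈ Γ ∧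
      r.length < p₀.length ∧ Incomp p₀ r ∧ Incomp r q ∧ ∀ z, τ (p₀ ++ z) → τ (r ++ z))
    {p q : List Letter} (hp : τ p) (hq : τ q) (h : Incomp p q) : swap p q ∈ Γ := by
  induction hn : p.length + q.length using Nat.strong_induction_on generalizing p q with
  | _ n ih =>
    have key : ∀ {p q}, τ p → τ q → Incomp p q → p.length + q.length = n → L < p.length →
        swap p q ∈ Γ := by
      intro p q hp hq h hn hL
      obtain ⟨p₀, r, ⟨z, rfl⟩, hs, hlt, hpr, hrq, hτ⟩ := hstep p q hp hq h hL
      obtain ⟨q', hq', hqq', hle⟩ : ∃ q' : List Letter, τ q' ∧ q' ∈ (swap p₀ r).toMap q ∧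
          q'.length ≤ q.length := by
        rcases trichotomy p₀ q with h1 | ⟨t, rfl⟩ | h1
        · exact ⟨q, hq, mem_swap_of_incomp hpr h1 hrq, le_rfl⟩
        · exact ⟨r ++ t, hτ t hq, mem_swap_left hpr t, by simp; omega⟩
        · exact absurd (h1.trans (List.prefix_append _ _)) h.2
      have hpp' := mem_swap_left hpr z
      have h1 := ih _ (by simp at hn ⊢; omega) (hτ z hp) hq'
        ((BigGroup.incomp_iff_of_mem hpp' hqq').2 h) rfl
      rw [← conj_swap h hpp' hqq'] at h1
      have h2 := mul_mem (mul_mem (inv_mem hs) h1) hs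
      simpa [mul_assoc] using h2
    rcases lt_or_ge L p.length with h1 | h1
    · exact key hp hq h hn h1
    · rcases lt_or_ge L q.length with h2 | h2
      · rw [swap_comm h]
        exact key hq hp h.symm (by omega) h2
      · exact hshort p q hp hq h1 h2 h

theorem incomp_of_getElem? {p q : List Letter} (i : ℕ) {a b : Letter} (hp : p[i]? = some a)
    (hq : q[i]? = some b) (hab : a ≠ b) : Incomp p q := by
  constructor
  · rintro ⟨t, rfl⟩
    rw [List.getElem?_append_left (List.getElem?_eq_some_iff.1 hp).1, hp] at hq
    exact hab (Option.some_inj.1 hq)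
  · rintro ⟨t, rfl⟩
    rw [List.getElem?_append_left (List.getElem?_eq_some_iff.1 hq).1, hq] at hp
    exact hab (Option.some_inj.1 hp).symm

theorem Incomp.ne_nil {p q : List Letter} (h : Incomp p q) : p ≠ [] := by
  rintro rfl
  exact h.1 List.nil_prefix

/-- With three letters there is always a letter `e` different from the first letters of both words,
so the first two letters of `p` can be replaced by `e`. -/
theorem swap_mem_closure (p q : List Letter) (h : Incomp p q) :
    swap p q ∈ Subgroup.closure (shortSwaps 2 fun _ _ => True) := by
  refine swap_mem_of_short (τ := fun _ => True) (L := 1) (fun p q _ _ hp hq h =>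
    swap_mem_closure_shortSwaps (by omega) (by omega) h trivial) ?_ trivial trivial h
  intro p q _ _ h hp
  obtain ⟨a, b, t, rfl⟩ : ∃ a b t, p = a :: b :: t := by
    match p, hp with
    | a :: b :: t, _ => exact ⟨a, b, t, rfl⟩
  obtain ⟨d, s, rfl⟩ := List.exists_cons_of_ne_nil h.symm.ne_nil
  have hdec : ∀ a d : Letter, ∃ e, e ≠ a ∧ e ≠ d := by decide
  obtain ⟨e, he, he'⟩ := hdec a d
  have h1 : Incomp [a, b] [e] := incomp_of_getElem? 0 rfl rfl (Ne.symm he)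
  exact ⟨[a, b], [e], ⟨t, rfl⟩, swap_mem_closure_shortSwaps le_rfl (by simp) h1 trivial,
    by simp, h1, incomp_of_getElem? 0 rfl rfl he', fun _ _ => trivial⟩

/-! ### Finite generation of `G_{3,1}` -/

/-- A longest word has all its siblings in `P`; collapsing them to their parent gives a smaller
code. -/
theorem IsCode.exists_exp (P : Finset (List Letter)) (hP : IsCode P) :
    ∃ n m, Exp (fun _ => False) letterCode False n m P := by
  suffices h : ∃ n, Exp (fun _ => False) letterCode False n 0 P from h.imp fun n h => ⟨0, h⟩
  induction hk : P.card using Nat.strong_induction_on generalizing P with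
  | _ k ih =>
    by_cases hnil : [] ∈ P
    · rw [hP.eq_singleton hnil]
      exact ⟨0, Exp.nil⟩
    · obtain ⟨p, hp, -⟩ := hP.maximal []
      obtain ⟨r, -, hr⟩ := hP.exists_siblings (c := fun _ => True) (fun _ _ _ => trivial)
        ⟨p.dropLast, p.getLast fun h => hnil (h ▸ hp), by
          rwa [List.dropLast_append_getLast], trivial⟩
      obtain ⟨P', hP', hrP', rfl, hlt, -⟩ := hP.exists_eq_expand isCode_letterCode (by decide) hr
      obtain ⟨n, hn⟩ := ih _ (hk ▸ hlt) P' hP' rfl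
      exact ⟨n + 1, hn.low hrP' not_false⟩

/-- The words of length `N`. -/
def uniformCode (N : ℕ) : Finset (List Letter) := (List.finite_length_eq Letter N).toFinset

theorem mem_uniformCode {N : ℕ} {x : List Letter} : x ∈ uniformCode N ↔ x.length = N := by
  simp [uniformCode]

theorem isCode_uniformCode (N : ℕ) : IsCode (uniformCode N) := by
  refine ⟨fun p hp q hq hne => incomp_of_length ?_ hne, fun x => ?_⟩
  · rw [mem_uniformCode.1 hp, mem_uniformCode.1 hq]
  · rcases le_total N x.length with h | h
    · exact ⟨x.take N, mem_uniformCode.2 (by simp [h]), Or.inl (List.take_prefix _ _)⟩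
    · exact ⟨x ++ List.replicate (N - x.length) none, mem_uniformCode.2 (by simp; omega),
        Or.inr (List.prefix_append _ _)⟩

/-- An element that is defined on a code, as a function. -/
theorem exists_fun_of_dom {g : BigGroup Letter} {P : Finset (List Letter)}
    (h : ∀ p ∈ P, p ∈ dom g.toMap) : ∃ f : List Letter → List Letter, ∀ p ∈ P, f p ∈ g.toMap p := by
  classical
  choose f hf using fun p : {p // p ∈ P} => h p.1 p.2
  exact ⟨fun p => if hp : p ∈ P then f ⟨p, hp⟩ else [], fun p hp => by
    simp only [dif_pos hp]; exact hf ⟨p, hp⟩⟩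

/-- Without a condition on the elements a single class suffices: no word is in `cls`, and every
expansion is by letters. -/
theorem smallGroup_subset_closure :
    smallGroup Letter ⊆ Subgroup.closure (shortSwaps 2 fun _ _ => True) := by
  intro g hg
  obtain ⟨N, hN⟩ := mem_smallGroup_iff.1 hg
  obtain ⟨f, hf⟩ := exists_fun_of_dom (P := uniformCode N) (g := g)
    fun p hp => (hN p (mem_uniformCode.1 hp).ge).1
  refine mem_of_maps_code (cls := fun _ => False) (Z := letterCode) (hi := False) (P := uniformCode N)
    (f := f) (by simp) not_false isCode_letterCode (by simp [letterCode])
    (fun n m P hP p hp q hq _ hne => swap_mem_closure p q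
      ((hP.isCode isCode_letterCode).incomp p hp q hq hne))
    (fun p hp => ⟨hf p hp, Iff.rfl⟩) (IsCode.exists_exp _ (isCode_uniformCode N))
    (IsCode.exists_exp _ ((isCode_uniformCode N).image hf))

/-! ### Words with and without the letter `#` -/

/-- The bit strings whose length is divisible by three. -/
def IsTripleWord (p : List Letter) : Prop := ∃ u, p = bits u ∧ 3 ∣ u.length

/-- The words `u #` with a bit string `u`. -/
def IsHashWord (p : List Letter) : Prop := ∃ u, p = bits u ++ [none]

theorem none_notMem_bits (u : List Bool) : none ∉ bits u := by simp [bits]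

theorem IsHashWord.mem {p : List Letter} (h : IsHashWord p) : none ∈ p := by
  obtain ⟨u, rfl⟩ := h
  simp

theorem IsTripleWord.notMem {p : List Letter} (h : IsTripleWord p) : none ∉ p := by
  obtain ⟨u, rfl, -⟩ := h
  exact none_notMem_bits u

theorem exists_bits_of_append {x y : List Letter} {u : List Bool} (h : x ++ y = bits u) :
    ∃ v w, x = bits v ∧ y = bits w ∧ u = v ++ w := by
  obtain ⟨v, w, rfl, rfl, rfl⟩ := List.map_eq_append_iff.1 h.symm
  exact ⟨v, w, rfl, rfl, rfl⟩

theorem exists_bits_of_prefix {x : List Letter} {u : List Bool} (h : x <+: bits u) :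
    ∃ v, x = bits v := by
  obtain ⟨y, h⟩ := h
  obtain ⟨v, -, hv, -⟩ := exists_bits_of_append h
  exact ⟨v, hv⟩

theorem bits_prefix_bits {u v : List Bool} : bits u <+: bits v ↔ u <+: v :=
  List.prefix_map_iff_of_injective (Option.some_injective Bool)

theorem not_hash_prefix_bits {p : List Letter} (hp : none ∈ p) (u : List Bool) : ¬ p <+: bits u :=
  fun h => none_notMem_bits u (h.subset hp)

theorem eq_of_hash_prefix_hash {u v : List Bool} (h : bits u ++ [none] <+: bits v ++ [none]) :
    u = v := by
  rcases List.prefix_concat_iff.1 h with h | h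
  · exact bits_injective (List.append_cancel_right h)
  · exact absurd h (not_hash_prefix_bits (by simp) v)

/-- The code of the bit strings of length `N` and the words `u #` for shorter bit strings `u`. -/
def hashCode (N : ℕ) : Finset (List Letter) :=
  (List.finite_length_eq Bool N).toFinset.image bits ∪
    (List.finite_length_lt Bool N).toFinset.image fun u => bits u ++ [none]

theorem mem_hashCode {N : ℕ} {x : List Letter} : x ∈ hashCode N ↔
    (∃ u, u.length = N ∧ bits u = x) ∨ ∃ u, u.length < N ∧ bits u ++ [none] = x := by
  simp [hashCode]

theorem isCode_hashCode (N : ℕ) : IsCode (hashCode N) := by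
  have h1 : ∀ u v : List Bool, u.length = N → v.length < N → Incomp (bits u) (bits v ++ [none]) := by
    intro u v hu hv
    refine ⟨fun h => ?_, not_hash_prefix_bits (by simp) u⟩
    rcases List.prefix_concat_iff.1 h with h | h
    · exact none_notMem_bits u (h ▸ by simp)
    · have := h.length_le
      simp at this
      omega
  refine ⟨fun p hp q hq hne => ?_, fun x => ?_⟩
  · rcases mem_hashCode.1 hp with ⟨u, hu, rfl⟩ | ⟨u, hu, rfl⟩
    · rcases mem_hashCode.1 hq with ⟨v, hv, rfl⟩ | ⟨v, hv, rfl⟩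
      · exact incomp_of_length (by simp [hu, hv]) hne
      · exact h1 u v hu hv
    · rcases mem_hashCode.1 hq with ⟨v, hv, rfl⟩ | ⟨v, hv, rfl⟩
      · exact (h1 v u hv hu).symm
      · exact ⟨fun h => hne (eq_of_hash_prefix_hash h ▸ rfl),
          fun h => hne (eq_of_hash_prefix_hash h ▸ rfl)⟩
  · rcases bits_or_hash x with ⟨u, rfl⟩ | ⟨u, w, rfl⟩
    · rcases le_total N u.length with h | h
      · exact ⟨_, mem_hashCode.2 (Or.inl ⟨u.take N, by simp [h], rfl⟩),
          Or.inl ((List.take_prefix N u).map _)⟩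
      · exact ⟨_, mem_hashCode.2 (Or.inl ⟨u ++ List.replicate (N - u.length) false, by
          simp; omega, rfl⟩), Or.inr ((List.prefix_append _ _).map _)⟩
    · rcases lt_or_ge u.length N with h | h
      · exact ⟨_, mem_hashCode.2 (Or.inr ⟨u, h, rfl⟩), Or.inl ⟨w, by simp⟩⟩
      · exact ⟨_, mem_hashCode.2 (Or.inl ⟨u.take N, by simp [h], rfl⟩),
          Or.inl (((List.take_prefix N u).map _).trans (List.prefix_append _ _))⟩

theorem two_le_card_hashCode : 2 ≤ ((hashCode 3).filter fun x => ¬ none ∈ x).card := by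
  refine Finset.one_lt_card.2 ⟨bits [true, true, true], ?_, bits [false, true, true], ?_, ?_⟩
  · exact Finset.mem_filter.2 ⟨mem_hashCode.2 (Or.inl ⟨_, rfl, rfl⟩), none_notMem_bits _⟩
  · exact Finset.mem_filter.2 ⟨mem_hashCode.2 (Or.inl ⟨_, rfl, rfl⟩), none_notMem_bits _⟩
  · simp [bits]

/-- A code of bit strings, of lengths divisible by three, and words `u #` is an expansion. -/
theorem IsCode.exists_exp_low (hi : Prop) (P : Finset (List Letter)) (hP : IsCode P)
    (hW : ∀ p ∈ P, IsTripleWord p ∨ IsHashWord p) :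
    ∃ n, Exp (none ∈ ·) (hashCode 3) hi n 0 P := by
  induction hk : P.card using Nat.strong_induction_on generalizing P with
  | _ k ih =>
    -- Pad `u` with zeros beyond the length of every word of `P`: a word comparable to the result is
    -- a prefix of it, hence a bit string.
    have hlong : ∀ u : List Bool, ∃ v, bits v ∈ P ∧ 3 ∣ v.length ∧
        bits v <+: bits (u ++ List.replicate (P.sup List.length) false) := by
      intro u
      obtain ⟨p, hp, h⟩ := hP.maximal (bits (u ++ List.replicate (P.sup List.length) false))
      have hle : p.length ≤ P.sup List.length := Finset.le_sup (f := List.length) hp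
      have hpre : p <+: bits (u ++ List.replicate (P.sup List.length) false) := by
        rcases h with h | h
        · exact h
        · rw [h.eq_of_length (le_antisymm h.length_le (by simp; omega))]
      obtain ⟨v, rfl⟩ := exists_bits_of_prefix hpre
      rcases hW _ hp with ⟨v', hv', h3⟩ | h'
      · rw [bits_injective hv'] at hp hpre
        exact ⟨v', hp, h3, hpre⟩
      · exact absurd h'.mem (none_notMem_bits v)
    by_cases hnil : [] ∈ P
    · rw [hP.eq_singleton hnil]
      exact ⟨0, Exp.nil⟩
    · obtain ⟨v₀, hv₀, -, -⟩ := hlong []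
      obtain ⟨x, hx, hmax⟩ := Finset.exists_max_image (P.filter fun x => none ∉ x) List.length
        ⟨_, Finset.mem_filter.2 ⟨hv₀, none_notMem_bits v₀⟩⟩
      obtain ⟨hxP, hxn⟩ := Finset.mem_filter.1 hx
      obtain ⟨u, rfl, hu⟩ := (hW x hxP).resolve_right fun h => hxn h.mem
      have hu0 : u.length ≠ 0 := by
        intro h
        rw [List.eq_nil_of_length_eq_zero h] at hxP
        exact hnil hxP
      obtain ⟨r, t, rfl, ht⟩ : ∃ r t, u = r ++ t ∧ t.length = 3 :=
        ⟨u.take (u.length - 3), u.drop (u.length - 3), by simp, by simp; omega⟩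
      have hr : 3 ∣ r.length := by
        rw [List.length_append, ht] at hu
        omega
      have hbits : ∀ v, bits v ∈ P → v.length ≤ r.length + 3 := by
        intro v hv
        have := hmax _ (Finset.mem_filter.2 ⟨hv, none_notMem_bits v⟩)
        simpa [ht] using this
      have hnot : ∀ v, bits v ∈ P → ¬ v <+: r := by
        intro v hv h
        have e := hP.eq_of_prefix hv hxP ((h.trans (List.prefix_append r t)).map _)
        have := h.length_le
        rw [bits_injective e] at this
        simp [ht] at this
      -- `r` is a longest bit string of `P` without its last triple. No prefix of `r` is in `P`, and
      -- bit strings of `P` have lengths divisible by 3 and at most `|r| + 3`, so `P` contains all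
      -- of `r s` with `|s| = 3`, and then all of `r s #` with `|s| < 3`.
      have hZ : ∀ z ∈ hashCode 3, bits r ++ z ∈ P := by
        intro z hz
        rcases mem_hashCode.1 hz with ⟨s, hs, rfl⟩ | ⟨s, hs, rfl⟩
        · obtain ⟨v, hv, hv3, hpre⟩ := hlong (r ++ s)
          rw [bits_prefix_bits] at hpre
          have h1 := hbits v hv
          have h2 : v <+: r ++ s := List.prefix_of_prefix_length_le hpre
            (List.prefix_append _ _) (by simp; omega)
          by_cases h3 : v.length = (r ++ s).length
          · rw [← bits_append, ← h2.eq_of_length h3]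
            exact hv
          · exact absurd (List.prefix_of_prefix_length_le h2 (List.prefix_append r s) (by
              have := h2.length_le
              simp at this h3
              omega)) (hnot v hv)
        · obtain ⟨p, hp, h⟩ := hP.maximal (bits r ++ (bits s ++ [none]))
          rw [← List.append_assoc, ← bits_append] at h ⊢
          rcases h with h | h
          · rcases List.prefix_concat_iff.1 h with rfl | h
            · exact hp
            · obtain ⟨v, rfl⟩ := exists_bits_of_prefix h
              obtain ⟨v', hv', h3⟩ := (hW _ hp).resolve_right fun h' =>
                none_notMem_bits v h'.mem
              rw [← bits_injective hv'] at h3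
              have h2 := bits_prefix_bits.1 h
              exact absurd (List.prefix_of_prefix_length_le h2 (List.prefix_append r s) (by
                have := h2.length_le
                simp at this
                omega)) (hnot v hp)
          · rcases hW p hp with h' | ⟨v, rfl⟩
            · exact absurd (h.subset (by simp)) h'.notMem
            · rcases List.prefix_concat_iff.1 h with h | h
              · rwa [h]
              · exact absurd h (not_hash_prefix_bits (by simp) v)
      obtain ⟨P', hP', hrP', rfl, hlt, hsub⟩ := hP.exists_eq_expand (isCode_hashCode 3)
        (two_le_card_hashCode.trans (Finset.card_le_card (Finset.filter_subset _ _))) hZ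
      obtain ⟨n, hn⟩ := ih _ (hk ▸ hlt) P' hP' (fun p hp => by
        rcases hsub p hp with h | rfl
        · exact hW p h
        · exact Or.inl ⟨r, rfl, hr⟩) rfl
      exact ⟨n + 1, hn.low hrP' (none_notMem_bits r)⟩

/-- A code of bit strings, of lengths divisible by three, and words that contain `#` is an
expansion. -/
theorem IsCode.exists_exp_high (P : Finset (List Letter)) (hP : IsCode P)
    (hW : ∀ p ∈ P, IsTripleWord p ∨ none ∈ p) :
    ∃ n m, Exp (none ∈ ·) (hashCode 3) True n m P := by
  induction hk : P.card using Nat.strong_induction_on generalizing P with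
  | _ k ih =>
    -- First collapse siblings behind a `#`. When none are left, every word with `#` ends at its
    -- first `#`, which is the low case.
    by_cases h : ∃ r a, r ++ [a] ∈ P ∧ none ∈ r
    · obtain ⟨r, hr, hZ⟩ := hP.exists_siblings (c := (none ∈ ·))
        (fun _ _ h => List.mem_append_left _ h) h
      obtain ⟨P', hP', hrP', rfl, hlt, hsub⟩ := hP.exists_eq_expand isCode_letterCode (by decide) hZ
      obtain ⟨n, m, hn⟩ := ih _ (hk ▸ hlt) P' hP' (fun p hp => by
        rcases hsub p hp with h | rfl
        · exact hW p h
        · exact Or.inr hr) rfl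
      exact ⟨n, m + 1, hn.high trivial hrP' hr⟩
    · push Not at h
      obtain ⟨n, hn⟩ := hP.exists_exp_low True P fun p hp => by
        rcases hW p hp with h' | h'
        · exact Or.inl h'
        · right
          rcases bits_or_hash p with ⟨u, rfl⟩ | ⟨u, w, rfl⟩
          · exact absurd h' (none_notMem_bits u)
          · rcases List.eq_nil_or_concat w with rfl | ⟨w, a, rfl⟩
            · exact ⟨u, rfl⟩
            · exact absurd (by simp) (h (bits u ++ none :: w) a (by simpa using hp))
      exact ⟨n, 0, hn⟩

/-! ### Swaps of bit strings and of words with the letter `#` -/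

/-- Two bit strings of lengths divisible by three, or two words that contain `#`. -/
def TripleOrHash (p q : List Letter) : Prop :=
  (IsTripleWord p ∧ IsTripleWord q) ∨ (none ∈ p ∧ none ∈ q)

/-- Two bit strings of lengths divisible by three, or two words `u #`. -/
def TripleOrHashWord (p q : List Letter) : Prop :=
  (IsTripleWord p ∧ IsTripleWord q) ∨ (IsHashWord p ∧ IsHashWord q)

theorem TripleOrHashWord.tripleOrHash {p q : List Letter} (h : TripleOrHashWord p q) :
    TripleOrHash p q := h.imp_right fun h => ⟨h.1.mem, h.2.mem⟩

theorem exists_six {u : List Bool} (h : 6 ≤ u.length) :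
    ∃ a b c d e f t, u = [a, b, c, d, e, f] ++ t := by
  match u, h with
  | a :: b :: c :: d :: e :: f :: t, _ => exact ⟨a, b, c, d, e, f, t, rfl⟩

/-- Replace the first six bits of `p` by three, which keeps lengths divisible by 3. The first new
bit differs from that of `p`, the second one from that of `q`, so the replacement is incomparable to
both. -/
theorem swap_triple_mem {Γ : Subgroup (BigGroup Letter)}
    (h : ∀ p q, IsTripleWord p → IsTripleWord q → p.length ≤ 6 → q.length ≤ 6 → Incomp p q →
      swap p q ∈ Γ) {p q : List Letter} (hp : IsTripleWord p) (hq : IsTripleWord q)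
    (hpq : Incomp p q) : swap p q ∈ Γ := by
  refine swap_mem_of_short h ?_ hp hq hpq
  rintro p q ⟨u, rfl, hu⟩ ⟨v, rfl, hv⟩ hpq hl
  rw [length_bits] at hl
  obtain ⟨a, b, c, d, e, f, t, rfl⟩ := exists_six hl.le
  obtain ⟨x, y, s, rfl⟩ : ∃ x y s, v = x :: y :: s := by
    match v, hpq.symm.ne_nil, hv with
    | [], h, _ => exact absurd rfl h
    | [_], _, hv => simp at hv
    | x :: y :: s, _, _ => exact ⟨x, y, s, rfl⟩
  have h1 : Incomp (bits [a, b, c, d, e, f]) (bits [!a, !y, false]) :=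
    incomp_of_getElem? (a := some a) (b := some !a) 0 rfl rfl (by simp)
  refine ⟨bits [a, b, c, d, e, f], bits [!a, !y, false], ⟨bits t, (bits_append _ _).symm⟩,
    h _ _ ⟨_, rfl, by simp⟩ ⟨_, rfl, by simp⟩ (by simp) (by simp) h1, by simp, h1,
    incomp_of_getElem? (a := some !y) (b := some y) 1 rfl rfl (by simp), ?_⟩
  rintro z ⟨w, hw, h3⟩
  obtain ⟨w₁, w₂, h4, rfl, rfl⟩ := exists_bits_of_append hw
  rw [← bits_injective h4] at h3
  exact ⟨[!a, !y, false] ++ w₂, (bits_append _ _).symm, by simp at h3 ⊢; omega⟩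

/-- A word that begins with two bits is incomparable to a given word with `#` if the second bit
is chosen suitably. -/
theorem exists_incomp_hash {q : List Letter} (hq : none ∈ q) :
    ∃ e : Bool, ∀ (d : Bool) (x : Letter), Incomp [some d, some e, x] q := by
  match q, hq with
  | [c], hq =>
    have hc : c = none := (List.mem_singleton.1 hq).symm
    exact ⟨false, fun d x => incomp_of_getElem? (a := some d) (b := c) 0 rfl rfl (by simp [hc])⟩
  | c :: c' :: t, _ =>
    have hdec : ∀ c' : Letter, ∃ e : Bool, some e ≠ c' := by decide
    obtain ⟨e, he⟩ := hdec c'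
    exact ⟨e, fun d x => incomp_of_getElem? 1 rfl rfl he⟩

theorem exists_shorten_hash {Γ : Subgroup (BigGroup Letter)}
    (h : ∀ p q, IsTripleWord p → IsTripleWord q → Incomp p q → swap p q ∈ Γ) {u : List Bool}
    (hu : 6 ≤ u.length) {q : List Letter} (hq : none ∈ q) :
    ∃ v v' : List Bool, v <+: u ∧ swap (bits v) (bits v') ∈ Γ ∧ v'.length < v.length ∧
      Incomp (bits v) (bits v') ∧ Incomp (bits v') q := by
  obtain ⟨a, b, c, d, e, f, t, rfl⟩ := exists_six hu
  obtain ⟨y, hy⟩ := exists_incomp_hash hq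
  have h1 : Incomp (bits [a, b, c, d, e, f]) (bits [!a, y, false]) :=
    incomp_of_getElem? (a := some a) (b := some !a) 0 rfl rfl (by simp)
  exact ⟨[a, b, c, d, e, f], [!a, y, false], ⟨t, rfl⟩, h _ _ ⟨_, rfl, by simp⟩ ⟨_, rfl, by simp⟩ h1,
    by simp, h1, hy _ _⟩

/-- If `p` begins with six bits, shorten them by a swap of bit strings. Otherwise its first seven
letters contain `#` and can be exchanged with a word of length three that ends with `#`. -/
theorem swap_hash_mem {Γ : Subgroup (BigGroup Letter)}
    (h : ∀ p q, IsTripleWord p → IsTripleWord q → Incomp p q → swap p q ∈ Γ)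
    (h' : ∀ p q, none ∈ p → none ∈ q → p.length ≤ 7 → q.length ≤ 7 → Incomp p q → swap p q ∈ Γ)
    {p q : List Letter} (hp : none ∈ p) (hq : none ∈ q) (hpq : Incomp p q) : swap p q ∈ Γ := by
  refine swap_mem_of_short (τ := (none ∈ ·)) h' ?_ hp hq hpq
  intro p q hp hq hpq hl
  obtain ⟨u, w, rfl⟩ := (bits_or_hash p).resolve_left
    (by rintro ⟨u, rfl⟩; exact none_notMem_bits u hp)
  rcases le_or_gt 6 u.length with hu | hu
  · obtain ⟨v, v', hv, hs, hlt, h1, h2⟩ := exists_shorten_hash h hu hq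
    refine ⟨bits v, bits v', (bits_prefix_bits.2 hv).trans (List.prefix_append _ _), hs,
      by simpa using hlt, h1, h2, fun z hz => ?_⟩
    rw [List.mem_append] at hz ⊢
    exact Or.inr (hz.resolve_left (none_notMem_bits v))
  · obtain ⟨e, he⟩ := exists_incomp_hash hq
    have hdec : ∀ c : Letter, ∃ d : Bool, c ≠ some d := by decide
    obtain ⟨d, hd⟩ := hdec ((bits u ++ none :: w).headD none)
    have hmem : none ∈ (bits u ++ none :: w).take 7 := by
      rw [List.take_append, List.mem_append, length_bits,
        show 7 - u.length = 6 - u.length + 1 by omega]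
      simp
    have hlen : ((bits u ++ none :: w).take 7).length = 7 := by
      rw [List.length_take]; omega
    have h1 : Incomp ((bits u ++ none :: w).take 7) [some d, some e, none] := by
      refine incomp_of_getElem? 0 ?_ rfl hd
      cases u <;> simp [bits]
    exact ⟨_, _, List.take_prefix 7 _, h' _ _ hmem (by simp) hlen.le (by simp) h1, by simp [hlen],
      h1, he _ _, fun _ _ => by simp⟩

theorem hash_suffix {u v : List Bool} {z : List Letter} (h : bits u ++ z = bits v ++ [none]) :
    ∃ w, z = bits w ++ [none] ∧ v = u ++ w := by
  rcases List.eq_nil_or_concat z with rfl | ⟨z, a, rfl⟩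
  · exact absurd (by rw [← List.append_nil (bits u), h]; simp) (none_notMem_bits u)
  · rw [List.concat_eq_append] at h ⊢
    rw [← List.append_assoc] at h
    obtain ⟨h1, h2⟩ := List.append_inj' h rfl
    obtain ⟨w₁, w₂, h3, rfl, rfl⟩ := exists_bits_of_append h1
    rw [h2, bits_injective h3]
    exact ⟨w₂, rfl, rfl⟩

/-- A word `u #` of length above 7 begins with six bits, and shortening these keeps the form `u #`.
-/
theorem swap_hashWord_mem {Γ : Subgroup (BigGroup Letter)}
    (h : ∀ p q, IsTripleWord p → IsTripleWord q → Incomp p q → swap p q ∈ Γ)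
    (h' : ∀ p q, IsHashWord p → IsHashWord q → p.length ≤ 7 → q.length ≤ 7 → Incomp p q →
      swap p q ∈ Γ)
    {p q : List Letter} (hp : IsHashWord p) (hq : IsHashWord q) (hpq : Incomp p q) :
    swap p q ∈ Γ := by
  refine swap_mem_of_short h' ?_ hp hq hpq
  rintro _ q ⟨u, rfl⟩ hq hpq hl
  obtain ⟨v, v', hv, hs, hlt, h1, h2⟩ := exists_shorten_hash h (u := u) (by simp at hl; omega) hq.mem
  refine ⟨bits v, bits v', (bits_prefix_bits.2 hv).trans (List.prefix_append _ _), hs,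
    by simpa using hlt, h1, h2, ?_⟩
  rintro z ⟨w, hw⟩
  obtain ⟨w', rfl, -⟩ := hash_suffix hw
  exact ⟨v' ++ w', by simp [bits]⟩

theorem swap_mem_closure_tripleOrHash {p q : List Letter} (h : Incomp p q)
    (hpq : TripleOrHash p q) : swap p q ∈ Subgroup.closure (shortSwaps 7 TripleOrHash) := by
  have h1 : ∀ p q, IsTripleWord p → IsTripleWord q → Incomp p q →
      swap p q ∈ Subgroup.closure (shortSwaps 7 TripleOrHash) := fun p q hp hq h =>
    swap_triple_mem (fun p q hp hq hl hl' h => swap_mem_closure_shortSwaps (by omega) (by omega) h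
      (Or.inl ⟨hp, hq⟩)) hp hq h
  rcases hpq with ⟨hp, hq⟩ | ⟨hp, hq⟩
  · exact h1 p q hp hq h
  · exact swap_hash_mem h1 (fun p q hp hq hl hl' h => swap_mem_closure_shortSwaps hl hl' h
      (Or.inr ⟨hp, hq⟩)) hp hq h

theorem swap_mem_closure_tripleOrHashWord {p q : List Letter} (h : Incomp p q)
    (hpq : TripleOrHashWord p q) :
    swap p q ∈ Subgroup.closure (shortSwaps 7 TripleOrHashWord) := by
  have h1 : ∀ p q, IsTripleWord p → IsTripleWord q → Incomp p q →
      swap p q ∈ Subgroup.closure (shortSwaps 7 TripleOrHashWord) := fun p q hp hq h =>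
    swap_triple_mem (fun p q hp hq hl hl' h => swap_mem_closure_shortSwaps (by omega) (by omega) h
      (Or.inl ⟨hp, hq⟩)) hp hq h
  rcases hpq with ⟨hp, hq⟩ | ⟨hp, hq⟩
  · exact h1 p q hp hq h
  · exact swap_hashWord_mem h1 (fun p q hp hq hl hl' h => swap_mem_closure_shortSwaps hl hl' h
      (Or.inr ⟨hp, hq⟩)) hp hq h

/-- As a maximal extension, the swap may be defined on more words than `swapFun`. So the claim is
checked on a long extension of `u` by bits, which are cancelled afterwards. -/
theorem swap_mem_mod3Bits {p q : List Letter} (h : Incomp p q) (hpq : TripleOrHash p q) :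
    swap p q ∈ mod3Bits := by
  have key : ∀ u : List Bool, ∀ y ∈ (swap p q).toMap (bits u), ∃ v, y = bits v ∧
      v.length ≡ u.length [MOD 3] := by
    intro u y hy
    let t := List.replicate (max p.length q.length) false
    obtain ⟨y', hy'⟩ := exists_swapFun h (bits (u ++ t)) (by simp [t])
    have h1 := BigGroup.mem_append hy (bits t)
    rw [← bits_append] at h1
    have h2 := Option.mem_unique h1 (mem_swap_of_eq h hy')
    obtain ⟨v', rfl, hv'⟩ : ∃ v', y' = bits v' ∧ v'.length ≡ (u ++ t).length [MOD 3] := by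
      have aux : ∀ {p q z}, TripleOrHash p q → bits (u ++ t) = p ++ z →
          ∃ v', q ++ z = bits v' ∧ v'.length ≡ (u ++ t).length [MOD 3] := by
        intro p q z hpq e
        obtain ⟨p₁, z₁, rfl, rfl, e'⟩ := exists_bits_of_append e.symm
        rcases hpq with ⟨⟨p₂, e₂, hp₂⟩, q₂, rfl, hq₂⟩ | ⟨hp, -⟩
        · rw [← bits_injective e₂] at hp₂
          refine ⟨q₂ ++ z₁, (bits_append _ _).symm, ?_⟩
          rw [e', List.length_append, List.length_append]
          unfold Nat.ModEq
          omega
        · exact absurd hp (none_notMem_bits p₁)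
      rcases swapFun_eq_some hy' with ⟨z, e, rfl⟩ | ⟨z, e, rfl⟩ | ⟨-, -, rfl⟩
      · exact aux hpq e
      · exact aux (hpq.imp And.symm And.symm) e
      · exact ⟨_, rfl, rfl⟩
    obtain ⟨v, w, rfl, hw, rfl⟩ := exists_bits_of_append h2
    refine ⟨v, rfl, ?_⟩
    rw [← bits_injective hw, List.length_append, List.length_append] at hv'
    exact Nat.ModEq.add_right_cancel' _ hv'
  refine ⟨swap_mem_smallGroup p q, fun u y hy => ?_, fun u y hy => ?_, fun u y hy => ?_⟩
  · obtain ⟨v, hv, -⟩ := key u y hy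
    exact ⟨v, hv⟩
  · rw [swap_inv] at hy
    obtain ⟨v, hv, -⟩ := key u y hy
    exact ⟨v, hv⟩
  · obtain ⟨v, rfl, hv⟩ := key u y hy
    simpa using hv

/-- A word `u #` is comparable to `p` only if `p` is a bit string in front of it or `p = u #`; so no
proper prefix of a swapped word, where the swap could be undefined, occurs. -/
theorem swap_mem_mod3BitsHash {p q : List Letter} (h : Incomp p q) (hpq : TripleOrHashWord p q) :
    swap p q ∈ mod3BitsHash := by
  have key : ∀ u : List Bool, ∃ v, bits v ++ [none] ∈ (swap p q).toMap (bits u ++ [none]) := by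
    intro u
    have aux : ∀ {p q}, Incomp p q → TripleOrHashWord p q → ¬ Incomp p (bits u ++ [none]) →
        ∃ v, bits v ++ [none] ∈ (swap p q).toMap (bits u ++ [none]) := by
      intro p q h hpq hu
      rcases (trichotomy p (bits u ++ [none])).resolve_left hu with ⟨t, e⟩ | e
      · rcases hpq with ⟨⟨p, rfl, -⟩, q, rfl, -⟩ | ⟨⟨p, rfl⟩, q, rfl⟩
        · obtain ⟨w, rfl, rfl⟩ := hash_suffix e
          rw [← e]
          exact ⟨q ++ w, by simpa [bits] using mem_swap_left h (bits w ++ [none])⟩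
        · obtain rfl := eq_of_hash_prefix_hash ⟨t, e⟩
          exact ⟨q, mem_swap_left' h⟩
      · rcases hpq with ⟨⟨p, rfl, -⟩, q, rfl, -⟩ | ⟨⟨p, rfl⟩, q, rfl⟩
        · exact absurd e (not_hash_prefix_bits (by simp) p)
        · obtain rfl := eq_of_hash_prefix_hash e
          exact ⟨q, mem_swap_left' h⟩
    by_cases h1 : Incomp p (bits u ++ [none])
    · by_cases h2 : Incomp q (bits u ++ [none])
      · exact ⟨u, mem_swap_of_incomp h h1 h2⟩
      · rw [swap_comm h]
        exact aux h.symm (hpq.imp And.symm And.symm) h2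
    · exact aux h hpq h1
  exact ⟨swap_mem_mod3Bits h hpq.tripleOrHash, key, by rw [swap_inv]; exact key⟩

/-! ### Finite generation of the groups with a condition modulo three -/

theorem Exp.tripleWord_or_hash {hi : Prop} {n m : ℕ} {P : Finset (List Letter)}
    (h : Exp (none ∈ ·) (hashCode 3) hi n m P) : ∀ p ∈ P, IsTripleWord p ∨ none ∈ p := by
  induction h with
  | nil =>
    intro p hp
    exact Or.inl ⟨[], Finset.mem_singleton.1 hp, by simp⟩
  | low h hp hc ih =>
    intro x hx
    rcases mem_expand.1 hx with ⟨-, hx⟩ | ⟨z, hz, rfl⟩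
    · exact ih x hx
    · obtain ⟨u, rfl, hu⟩ := (ih _ hp).resolve_right hc
      rcases mem_hashCode.1 hz with ⟨v, hv, rfl⟩ | ⟨v, hv, rfl⟩
      · exact Or.inl ⟨u ++ v, (bits_append _ _).symm, by simp [hv]; omega⟩
      · exact Or.inr (by simp)
  | high _ h hp hc ih =>
    intro x hx
    rcases mem_expand.1 hx with ⟨-, hx⟩ | ⟨z, hz, rfl⟩
    · exact ih x hx
    · exact Or.inr (List.mem_append_left _ hc)

theorem Exp.tripleWord_or_hashWord {n m : ℕ} {P : Finset (List Letter)}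
    (h : Exp (none ∈ ·) (hashCode 3) False n m P) :
    ∀ p ∈ P, IsTripleWord p ∨ IsHashWord p := by
  induction h with
  | nil =>
    intro p hp
    exact Or.inl ⟨[], Finset.mem_singleton.1 hp, by simp⟩
  | low h hp hc ih =>
    intro x hx
    rcases mem_expand.1 hx with ⟨-, hx⟩ | ⟨z, hz, rfl⟩
    · exact ih x hx
    · obtain ⟨u, rfl, hu⟩ := (ih _ hp).resolve_right fun h => hc h.mem
      rcases mem_hashCode.1 hz with ⟨v, hv, rfl⟩ | ⟨v, hv, rfl⟩
      · exact Or.inl ⟨u ++ v, (bits_append _ _).symm, by simp [hv]; omega⟩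
      · exact Or.inr ⟨u ++ v, by simp [bits]⟩
  | high h => exact h.elim

theorem mod3Bits_hash_iff {g : BigGroup Letter} (hg : g ∈ mod3Bits) {x y : List Letter}
    (hy : y ∈ g.toMap x) : none ∈ x ↔ none ∈ y := by
  rcases bits_or_hash x with ⟨u, rfl⟩ | ⟨u, w, rfl⟩
  · obtain ⟨v, rfl⟩ := hg.2.1 u y hy
    simp [none_notMem_bits]
  · rcases bits_or_hash y with ⟨v, rfl⟩ | ⟨v, w', rfl⟩
    · obtain ⟨u', hu'⟩ := hg.2.2.1 v _ (BigGroup.mem_inv_iff.2 hy)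
      exact absurd (by rw [← hu']; simp) (none_notMem_bits u')
    · simp

theorem mod3Bits_tripleWord {g : BigGroup Letter} (hg : g ∈ mod3Bits) {x y : List Letter}
    (hy : y ∈ g.toMap x) (hx : IsTripleWord x) : IsTripleWord y := by
  obtain ⟨u, rfl, hu⟩ := hx
  obtain ⟨v, rfl⟩ := hg.2.1 u y hy
  have h1 := hg.2.2.2 u _ hy
  rw [length_bits, Nat.ModEq] at h1
  exact ⟨v, rfl, by omega⟩

/-- For the code of all words of length `3N`, every word is a bit string of length divisible by 3 or
contains `#`, and `g` preserves both properties. -/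
theorem mod3Bits_subset_closure : mod3Bits ⊆ Subgroup.closure (shortSwaps 7 TripleOrHash) := by
  intro g hg
  obtain ⟨N, hN⟩ := mem_smallGroup_iff.1 hg.1
  obtain ⟨f, hf⟩ := exists_fun_of_dom (P := uniformCode (3 * N)) (g := g)
    fun p hp => (hN p (by rw [mem_uniformCode.1 hp]; omega)).1
  have hP : ∀ p ∈ uniformCode (3 * N), IsTripleWord p ∨ none ∈ p := by
    intro p hp
    rcases bits_or_hash p with ⟨u, rfl⟩ | ⟨u, w, rfl⟩
    · have := mem_uniformCode.1 hp
      rw [length_bits] at this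
      exact Or.inl ⟨u, rfl, by omega⟩
    · exact Or.inr (by simp)
  refine mem_of_maps_code (cls := (none ∈ ·)) (Z := hashCode 3) (hi := True)
    (P := uniformCode (3 * N)) (f := f) (by simp) (by simp) (isCode_hashCode 3)
    two_le_card_hashCode (fun n m P hP p hp q hq hpq hne => ?_)
    (fun p hp => ⟨hf p hp, mod3Bits_hash_iff hg (hf p hp)⟩)
    (IsCode.exists_exp_high _ (isCode_uniformCode _) hP)
    (IsCode.exists_exp_high _ ((isCode_uniformCode _).image hf) fun y hy => ?_)
  · refine swap_mem_closure_tripleOrHash ((hP.isCode (isCode_hashCode 3)).incomp p hp q hq hne) ?_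
    rcases hP.tripleWord_or_hash p hp with h1 | h1
    · exact Or.inl ⟨h1, (hP.tripleWord_or_hash q hq).resolve_right fun h => h1.notMem (hpq.2 h)⟩
    · exact Or.inr ⟨h1, hpq.1 h1⟩
  · obtain ⟨p, hp, rfl⟩ := Finset.mem_image.1 hy
    exact (hP p hp).imp (mod3Bits_tripleWord hg (hf p hp)) (mod3Bits_hash_iff hg (hf p hp)).1

/-- Here words must not continue behind `#`, so the code is `hashCode (3 * N)`. It contains short
words `u #`, on which `g` is defined by assumption. -/
theorem mod3BitsHash_subset_closure :
    mod3BitsHash ⊆ Subgroup.closure (shortSwaps 7 TripleOrHashWord) := by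
  rintro g ⟨hg, hgh, -⟩
  obtain ⟨N, hN⟩ := mem_smallGroup_iff.1 hg.1
  have hP : ∀ p ∈ hashCode (3 * N), IsTripleWord p ∨ IsHashWord p := by
    intro p hp
    rcases mem_hashCode.1 hp with ⟨u, hu, rfl⟩ | ⟨u, -, rfl⟩
    · exact Or.inl ⟨u, rfl, by omega⟩
    · exact Or.inr ⟨u, rfl⟩
  obtain ⟨f, hf⟩ := exists_fun_of_dom (P := hashCode (3 * N)) (g := g) fun p hp => by
    rcases mem_hashCode.1 hp with ⟨u, hu, rfl⟩ | ⟨u, -, rfl⟩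
    · exact (hN _ (by rw [length_bits]; omega)).1
    · obtain ⟨v, hv⟩ := hgh u
      exact ⟨_, hv⟩
  have hexp : ∀ P, IsCode P → (∀ p ∈ P, IsTripleWord p ∨ IsHashWord p) →
      ∃ n m, Exp (none ∈ ·) (hashCode 3) False n m P := fun P hP hW =>
    (hP.exists_exp_low False P hW).imp fun n h => ⟨0, h⟩
  refine mem_of_maps_code (cls := (none ∈ ·)) (Z := hashCode 3) (hi := False)
    (P := hashCode (3 * N)) (f := f) (by simp) (by simp) (isCode_hashCode 3)
    two_le_card_hashCode (fun n m P hP p hp q hq hpq hne => ?_)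
    (fun p hp => ⟨hf p hp, mod3Bits_hash_iff hg (hf p hp)⟩)
    (hexp _ (isCode_hashCode _) hP)
    (hexp _ ((isCode_hashCode _).image hf) fun y hy => ?_)
  · refine swap_mem_closure_tripleOrHashWord
      ((hP.isCode (isCode_hashCode 3)).incomp p hp q hq hne) ?_
    rcases hP.tripleWord_or_hashWord p hp with h1 | h1
    · exact Or.inl ⟨h1, (hP.tripleWord_or_hashWord q hq).resolve_right fun h =>
        h1.notMem (hpq.2 h.mem)⟩
    · exact Or.inr ⟨h1, (hP.tripleWord_or_hashWord q hq).resolve_left fun h =>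
        h.notMem (hpq.1 h1.mem)⟩
  · obtain ⟨p, hp, rfl⟩ := Finset.mem_image.1 hy
    rcases hP p hp with h1 | ⟨u, rfl⟩
    · exact Or.inl (mod3Bits_tripleWord hg (hf p hp) h1)
    · obtain ⟨v, hv⟩ := hgh u
      exact Or.inr ⟨v, Option.mem_unique (hf _ hp) hv⟩

/-! ### Finite generation of the four groups -/

theorem closure_union_fg {G : Type} [Group G] {X Y S : Set G} (hS : S.Finite) (hSX : S ⊆ X)
    (hXS : X ⊆ Subgroup.closure S) (hY : Y.Finite) : (Subgroup.closure (X ∪ Y)).FG := by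
  refine (Subgroup.fg_iff _).2 ⟨S ∪ Y, le_antisymm
    (Subgroup.closure_mono (Set.union_subset_union_left Y hSX)) ?_, hS.union hY⟩
  rw [Subgroup.closure_le]
  exact Set.union_subset (hXS.trans (Subgroup.closure_mono Set.subset_union_left))
    (Set.subset_union_right.trans Subgroup.subset_closure)

theorem shortSwaps_subset_smallGroup : shortSwaps 2 (fun _ _ => True) ⊆ smallGroup Letter := by
  rintro _ ⟨p, q, -, -, -, -, rfl⟩
  exact swap_mem_smallGroup p q

theorem shortSwaps_subset_mod3Bits : shortSwaps 7 TripleOrHash ⊆ mod3Bits := by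
  rintro _ ⟨p, q, -, -, h, hpq, rfl⟩
  exact swap_mem_mod3Bits h hpq

theorem shortSwaps_subset_mod3BitsHash : shortSwaps 7 TripleOrHashWord ⊆ mod3BitsHash := by
  rintro _ ⟨p, q, -, -, h, hpq, rfl⟩
  exact swap_mem_mod3BitsHash h hpq

theorem groupK012_fg : groupK012.FG :=
  closure_union_fg (finite_shortSwaps _ _) shortSwaps_subset_smallGroup smallGroup_subset_closure
    (Set.toFinite _)

theorem groupK321_fg : groupK321.FG :=
  closure_union_fg (finite_shortSwaps _ _) shortSwaps_subset_smallGroup smallGroup_subset_closure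
    (Set.toFinite _)

theorem groupH_fg : groupH.FG :=
  closure_union_fg (finite_shortSwaps _ _) shortSwaps_subset_mod3Bits mod3Bits_subset_closure
    (Set.toFinite _)

theorem groupHHash_fg : groupHHash.FG :=
  closure_union_fg (finite_shortSwaps _ _) shortSwaps_subset_mod3BitsHash
    mod3BitsHash_subset_closure (Set.toFinite _)

/-! ### The element `κ_321` -/

/-- It suffices to know the values of `g` on all words that are extended by `#`. -/
theorem BigGroup.mem_of_forall_hash {g : BigGroup Letter} {x y : List Letter}
    (h : ∀ z, y ++ z ++ [none] ∈ g.toMap (x ++ z ++ [none])) : y ∈ g.toMap x := by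
  refine BigGroup.mem_of_extends fun z w hw => ?_
  exact List.append_cancel_right (Option.mem_unique (BigGroup.mem_append hw [none]) (h z))

/-- `κ_0` and `κ_3` use the same triples and differ only on the first one, which `κ_3` leaves fixed.
So the quotient maps `abc t` to `bca t` and fixes the words with `#` among their first three
letters. -/
theorem kappa_three_mul_inv_mem_smallGroup : kappa 3 * (kappa 0)⁻¹ ∈ smallGroup Letter := by
  have h1 : ∀ (a b c : Bool) (t : List Letter),
      bits [b, c, a] ++ t ∈ (kappa 3 * (kappa 0)⁻¹).toMap (bits [a, b, c] ++ t) := by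
    intro a b c t
    refine BigGroup.mem_of_forall_hash fun z => ?_
    obtain ⟨u, w, h⟩ := exists_eq_joinHash (t ++ z)
    have e3 : ∀ s : List Letter, s ++ t ++ z ++ [none] = s ++ (bits u ++ none :: w) := fun s => by
      rw [← h]; simp
    rw [e3, e3]
    -- The common preimage: `κ_0` sends it to `abc u # w`, and `κ_3` to `bca u # w`.
    have e1 := mem_kappa 0 ([b, c, a] ++ unrotTriples u) w
    have e2 := mem_kappa 3 ([b, c, a] ++ unrotTriples u) w
    simp only [permBits, List.take_zero, List.nil_append, List.drop_zero, List.cons_append,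
      rotTriples, rot_unrot] at e1
    simp only [permBits, List.cons_append, List.nil_append, List.take_succ_cons, List.take_zero,
      List.drop_succ_cons, List.drop_zero, rot_unrot] at e2
    exact BigGroup.mem_mul (BigGroup.mem_inv_iff.2 e1) e2
  have h2 : ∀ (u : List Bool) (w : List Letter), u.length < 3 →
      bits u ++ none :: w ∈ (kappa 3 * (kappa 0)⁻¹).toMap (bits u ++ none :: w) := by
    intro u w hu
    have hp : ∀ i, permBits i u = u := by
      intro i
      unfold permBits
      have hd : (u.drop i).length < 3 := by simp; omega
      generalize hv : u.drop i = v at hd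
      have hrot : rotTriples v = v := by
        match v, hd with
        | [], _ => rfl
        | [_], _ => rfl
        | [_, _], _ => rfl
      rw [hrot, ← hv, List.take_append_drop]
    have e1 := mem_kappa 0 u w
    have e2 := mem_kappa 3 u w
    rw [hp] at e1 e2
    exact BigGroup.mem_mul (BigGroup.mem_inv_iff.2 e1) e2
  refine mem_smallGroup_iff.2 ⟨3, fun x hx => ?_⟩
  have hcase : (∃ a b c t, x = bits [a, b, c] ++ t) ∨
      ∃ u w, x = bits u ++ none :: w ∧ u.length < 3 := by
    rcases bits_or_hash x with ⟨u, rfl⟩ | ⟨u, w, rfl⟩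
    · match u, hx with
      | a :: b :: c :: u, _ => exact Or.inl ⟨a, b, c, bits u, rfl⟩
    · match u with
      | [] => exact Or.inr ⟨[], w, rfl, by simp⟩
      | [a] => exact Or.inr ⟨[a], w, rfl, by simp⟩
      | [a, b] => exact Or.inr ⟨[a, b], w, rfl, by simp⟩
      | a :: b :: c :: u => exact Or.inl ⟨a, b, c, bits u ++ none :: w, rfl⟩
  rcases hcase with ⟨a, b, c, t, rfl⟩ | ⟨u, w, rfl, hu⟩
  · exact ⟨⟨_, h1 a b c t⟩, _, h1 c a b t⟩
  · exact ⟨⟨_, h2 u w hu⟩, _, h2 u w hu⟩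

theorem kappa321_mem : kappa321 ∈ groupK012 := by
  have hs : ∀ g ∈ smallGroup Letter, g ∈ groupK012 := fun g hg =>
    Subgroup.subset_closure (Or.inl hg)
  have h0 : kappa 0 ∈ groupK012 := Subgroup.subset_closure (by simp)
  have h1 : kappa 1 ∈ groupK012 := Subgroup.subset_closure (by simp)
  have h2 : kappa 2 ∈ groupK012 := Subgroup.subset_closure (by simp)
  have h3 := mul_mem (hs _ kappa_three_mul_inv_mem_smallGroup) h0
  rw [inv_mul_cancel_right] at h3
  exact mul_mem (mul_mem h3 h2) h1

theorem closure_le_groupK012 {X : Set (BigGroup Letter)} (hX : X ⊆ smallGroup Letter) :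
    Subgroup.closure (X ∪ {kappa321}) ≤ groupK012 := by
  rw [Subgroup.closure_le]
  rintro g (hg | rfl)
  · exact Subgroup.subset_closure (Or.inl (hX hg))
  · exact kappa321_mem

theorem groupK321_le : groupK321 ≤ groupK012 := closure_le_groupK012 le_rfl

theorem groupH_le : groupH ≤ groupK012 := closure_le_groupK012 fun _ h => h.1

theorem groupHHash_le : groupHHash ≤ groupK012 := closure_le_groupK012 fun _ h => h.1.1

end Thompson

end

theorem mainTheorem3 :
    (Thompson.groupK012.FG ∧ Thompson.WordProblemInCoNP Thompson.groupK012) ∧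
    (Thompson.groupH ≤ Thompson.groupK012 ∧
      Thompson.groupH.FG ∧ Thompson.WordProblemInCoNP Thompson.groupH) ∧
    (Thompson.groupHHash ≤ Thompson.groupK012 ∧
      Thompson.groupHHash.FG ∧ Thompson.WordProblemInCoNP Thompson.groupHHash) ∧
    (Thompson.groupK321 ≤ Thompson.groupK012 ∧
      Thompson.groupK321.FG ∧ Thompson.WordProblemInCoNP Thompson.groupK321) ∧
    (∀ (k : ℕ) (s : Fin k → Thompson.BigGroup Thompson.Letter),
      (∀ i, s i ∈ Thompson.groupK012) →
      ∃ c : ℕ, ∀ w : List (Fin k × Bool), Thompson.wordVal s w ≠ 1 →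
        ∃ x y : List Thompson.Letter, x.length ≤ c * w.length ∧
          y ∈ Thompson.wordComp s w x ∧ y ∈ (Thompson.wordVal s w).toMap x ∧ y ≠ x) :=
  ⟨⟨Thompson.groupK012_fg, Thompson.wordProblemInCoNP le_rfl⟩,
    ⟨Thompson.groupH_le, Thompson.groupH_fg, Thompson.wordProblemInCoNP Thompson.groupH_le⟩,
    ⟨Thompson.groupHHash_le, Thompson.groupHHash_fg,
      Thompson.wordProblemInCoNP Thompson.groupHHash_le⟩,
    ⟨Thompson.groupK321_le, Thompson.groupK321_fg,
      Thompson.wordProblemInCoNP Thompson.groupK321_le⟩,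
    fun _ _ hs => Thompson.exists_linear_witness hs⟩
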